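/- **Setting.** For each $p\ge1$ consider a one-way layout with $p$ ordered factor levels and $n_i=n_i(p)\ge 1$ observations at level $i$, $n=\sum_i n_i$. Let $X$ be the $n\times p$ incidence matrix and $R=X'X$. The saturated Gaussian model is $y\sim N(\eta,\sigma^2I_n)$, $\eta=X\mu$, with $\mu\in\mathbb R^p$ unrestricted and $\sigma^2>0$. An estimator $\hat\eta$ of $\eta$ has loss $L(\hat\eta,\eta)=p^{-1}|\hat\eta-\eta|^2$ and risk $R(\hat\eta,\eta,\sigma^2)=\mathrm E\,L(\hat\eta,\eta)$. For each penalty matrix $D$ (a real matrix with $p$ columns) fix a penalty basis $U=U_D=XR^{-1/2}\Gamma$, where $R^{-1/2}D'DR^{-1/2}=\Gamma\Lambda\Gamma'$, $\Gamma$ is orthogonal and $\Lambda=\mathrm{diag}(\lambda_i)$ with $0\le\lambda_1\le\dots\le\lambda_p$. Put $z=z_D=U_D'y$ and $\xi=\xi_D=U_D'\eta$; $\|\cdot\|$ is the maximum norm, $\mathrm{ave}$ is the average of components, and $\hat\sigma^2$ is an estimator of $\sigma^2$ (a measurable function of $y$). **Candidates** have the form $U_D\,\mathrm{diag}(f)\,U_D'y$.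 * MS: $f\in\mathcal F_{\rm MS}(p)=\{f\in[0,1]^p: f_1\ge\dots\ge f_p\}$, with estimated risk $\hat r_{\rm MS}(D,f)=\mathrm{ave}[f^2\hat\sigma^2+(1-f)^2(z^2-\hat\sigma^2)]$. * ST: $f_i=[1-t/|z_i|]_+$, $t\ge0$, with estimated risk $\hat r_{\rm ST}(D,t)=\hat\sigma^2[1-2\hat G(t)]+\int_0^\infty(u\wedge t)^2\,d\hat G(u)$, where $\hat G$ is the empirical distribution function of the $|z_i|$. The class $\mathcal F_{\rm ST}$ is indexed by $t\ge0$, and the risk of the candidate $t$ is the risk of the estimator with that fixed threshold. * HS with split fraction $\alpha\in[0,1]$: with $p_1=\lfloor\alpha p\rfloor$ and $p_2=p-p_1$, the vector $f$ is MS on the first $p_1$ coordinates and ST on the last $p_2$ coordinates, with estimated risk $\hat r_{\rm HS}=p^{-1}[p_1\hat r_{\rm MS}+p_2\hat r_{\rm ST}]$, the two terms being computed on the corresponding subvectors of $z$. Adaptive estimators are obtained from any minimizer of the estimated risk over the candidates such that the resulting estimator is a measurable function of $y$. In the ST case (and for the ST part of HS) the minimization over thresholds is either over all $t\ge0$, or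 over $0\le t\le(2\log p)^{1/2}$ (respectively $0\le t\le(2\log p_2)^{1/2}$ for HS); the assertions hold for both choices. For a nonrandom set $\mathcal D=\mathcal D_p$ of penalty matrices and $c>0$, $\sup_{\|\xi\|\le c}$ denotes the supremum over all $\eta=X\mu$ such that $\|\xi_D\|\le c$ for every $D\in\mathcal D$. For a class $\mathcal K=\mathcal K_p$ of candidates $k$ with estimators $\hat\eta_k$, estimated risks $\hat r_k$ and selected minimizer $\hat k$, consider, for every $c>0$ and every $\sigma^2>0$: (i) $\displaystyle\lim_{p\to\infty}\sup_{\|\xi\|\le c}\mathrm E\sup_{k\in\mathcal K}|V_k-R(\hat\eta_k,\eta,\sigma^2)|=0$, both for $V_k=L(\hat\eta_k,\eta)$ and for $V_k=\hat r_k$; (ii) $\displaystyle\lim_{p\to\infty}\sup_{\|\xi\|\le c}\Big|R(\hat\eta_{\hat k},\eta,\sigma^2)-\inf_{k\in\mathcal K}R(\hat\eta_k,\eta,\sigma^2)\Big|=0$; (iii) $\displaystyle\lim_{p\to\infty}\sup_{\|\xi\|\le c}\mathrm E|\hat r_{\hat k}-W|=0$, both for $W=L(\hat\eta_{\hat k},\eta)$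 and for $W=R(\hat\eta_{\hat k},\eta,\sigma^2)$. **Theorem 4.1.** (a)–(c) Let $D=D_p$ be any fixed penalty matrix for each $p$, take $\mathcal D=\{D\}$, and suppose that $\lim_{p\to\infty}\sup_{\|\xi\|\le c}\mathrm E|\hat\sigma^2-\sigma^2|=0$ for every $c>0$ and $\sigma^2>0$. Then (i), (ii) and (iii) hold for the MS class and for the ST class with penalty matrix $D$. (d) Let $\mathcal D=\mathcal D_p$ be finite, and suppose that $(\#\mathcal D)\sup_{\|\xi\|\le c}\mathrm E|\hat\sigma^2-\sigma^2|\to0$ as $p\to\infty$, for every $c>0$ and $\sigma^2>0$. If $(\#\mathcal D)p^{-1/2}\to0$, then (i)–(iii) hold for the fully adaptive MS estimator, with candidates $(D,f)$, $D\in\mathcal D$, $f\in\mathcal F_{\rm MS}$. If $(\#\mathcal D)p^{-1/2}(\log p)^{1/4}\to0$, then (i)–(iii) hold for the fully adaptive ST estimator, with candidates $(D,t)$, $D\in\mathcal D$, $t\ge0$. (e) Let $\mathcal D=\mathcal D_p$ and $\mathcal A=\mathcal A_p\subset[0,1]$ be finite. If $\max\{\#\mathcal A,\#\mathcal D\}\,p^{-1/2}(\log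 p)^{1/4}\to0$ and, for every $c>0$ and $\sigma^2>0$, $\max\{\#\mathcal A,\#\mathcal D\}\sup_{\|\xi\|\le c}\mathrm E|\hat\sigma^2-\sigma^2|\to0$ as $p\to\infty$, then (i)–(iii) hold for the fully adaptive HS estimator, with candidates $(D,\alpha,f)$, $D\in\mathcal D$, $\alpha\in\mathcal A$, $f\in\mathcal F_{\rm HS}$. -/

import Mathlib

open MeasureTheory ProbabilityTheory Filter Topology Matrix
open scoped NNReal ENNReal

noncomputable section

namespace OneWay

/-- Labels of the observations of a one-way layout with `p` ordered factor levels and `n i`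
measurements at level `i`. -/
abbrev Obs {p : ℕ} (n : Fin p → ℕ) : Type := Σ i : Fin p, Fin (n i)

/-- The space of observation vectors `y`. -/
abbrev Data {p : ℕ} (n : Fin p → ℕ) : Type := Obs n → ℝ

/-- The incidence matrix `X` linking observations to factor levels. -/
def incidence {p : ℕ} (n : Fin p → ℕ) : Matrix (Obs n) (Fin p) ℝ :=
  Matrix.of fun o k => if o.1 = k then 1 else 0

/-- The mean vector `η = X μ`, where `μ` is the (unrestricted) vector of level means. -/
def mean {p : ℕ} (n : Fin p → ℕ) (μ : Fin p → ℝ) : Data n := incidence n *ᵥ μ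

/-- The saturated Gaussian model: `y` has independent components, `y o` being normal with mean
`η o` and variance `v = σ²`. -/
def law {p : ℕ} (n : Fin p → ℕ) (μ : Fin p → ℝ) (v : ℝ≥0) : Measure (Data n) :=
  Measure.pi fun o => gaussianReal (mean n μ o) v

/-- The normalized quadratic loss `p⁻¹ |η̂ - η|²` of an estimator of `η`. -/
def loss {p : ℕ} (n : Fin p → ℕ) (est : Data n → Data n) (μ : Fin p → ℝ) (y : Data n) : ℝ :=
  (p : ℝ)⁻¹ * ∑ o, (est y o - mean n μ o) ^ 2

/-- The risk: expected loss under the saturated model. -/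
def risk {p : ℕ} (n : Fin p → ℕ) (est : Data n → Data n) (μ : Fin p → ℝ) (v : ℝ≥0) : ℝ :=
  ∫ y, loss n est μ y ∂(law n μ v)

/-- Penalty matrices: real matrices with `p` columns and any number of rows. -/
abbrev Penalty (p : ℕ) : Type := Σ m : ℕ, Matrix (Fin m) (Fin p) ℝ

/-- `R^{-1/2}` for the diagonal replication matrix `R = Xᵀ X`. -/
def invSqrtRepl {p : ℕ} (n : Fin p → ℕ) : Matrix (Fin p) (Fin p) ℝ :=
  Matrix.diagonal fun k => (√(((incidence n)ᵀ * incidence n) k k))⁻¹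

/-- `U` is a penalty basis for the penalty matrix `D`: for some spectral representation
`R^{-1/2} Dᵀ D R^{-1/2} = Γ diag(lam) Γᵀ`, with `Γ` orthogonal and the eigenvalues in increasing
order, `U = X R^{-1/2} Γ`. -/
def IsPenaltyBasis {p : ℕ} (n : Fin p → ℕ) (D : Penalty p) (U : Matrix (Obs n) (Fin p) ℝ) :
    Prop :=
  ∃ (Γ : Matrix (Fin p) (Fin p) ℝ) (lam : Fin p → ℝ),
    Γᵀ * Γ = 1 ∧ Γ * Γᵀ = 1 ∧ (∀ i, 0 ≤ lam i) ∧ Monotone lam ∧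
    invSqrtRepl n * (D.2ᵀ * D.2) * invSqrtRepl n = Γ * Matrix.diagonal lam * Γᵀ ∧
    U = incidence n * invSqrtRepl n * Γ

/-- The estimator `U diag(f) Uᵀ y` of `η` given by a shrinkage vector `f`. -/
def shrink {p : ℕ} {n : Fin p → ℕ} (U : Matrix (Obs n) (Fin p) ℝ) (f : Fin p → ℝ)
    (y : Data n) : Data n :=
  U *ᵥ (f * (Uᵀ *ᵥ y))

/-- The average of the components of a vector. -/
def ave {ι : Type} [Fintype ι] (x : ι → ℝ) : ℝ := (Fintype.card ι : ℝ)⁻¹ * ∑ i, x i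

/-- The monotone shrinkage class: vectors in the unit cube with nonincreasing components. -/
def FMS (ι : Type) [Preorder ι] : Set (ι → ℝ) :=
  {f | (∀ i, f i ∈ Set.Icc (0 : ℝ) 1) ∧ Antitone f}

/-- Estimated risk of the monotone shrinkage candidate `f`; `s` is the variance estimate and `z`
the vector of coefficients. -/
def estRiskMS {ι : Type} [Fintype ι] (s : ℝ) (f z : ι → ℝ) : ℝ :=
  ave fun i => f i ^ 2 * s + (1 - f i) ^ 2 * (z i ^ 2 - s)

/-- The soft-thresholding shrinkage vector `[1 - t / |z i|]₊`. -/
def softShrink {ι : Type} (t : ℝ) (z : ι → ℝ) : ι → ℝ := fun i => max (1 - t / |z i|) 0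

/-- The empirical distribution function of the absolute values of the components of `z`. -/
def empCDF {ι : Type} [Fintype ι] (z : ι → ℝ) (t : ℝ) : ℝ :=
  ave (Set.indicator {i | |z i| ≤ t} fun _ => (1 : ℝ))

/-- Estimated risk of soft-thresholding at `t`; the last term is the integral of `(u ∧ t)²`
with respect to the empirical distribution of the `|z i|`. -/
def estRiskST {ι : Type} [Fintype ι] (s t : ℝ) (z : ι → ℝ) : ℝ :=
  s * (1 - 2 * empCDF z t) + ave fun i => (min |z i| t) ^ 2

/-- The split point `p₁ = ⌊α p⌋`. -/
def split (p : ℕ) (α : ℝ) : ℕ := ⌊α * (p : ℝ)⌋₊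

/-- The first `p₁` coordinates. -/
abbrev Low (p p₁ : ℕ) : Type := {i : Fin p // (i : ℕ) < p₁}

/-- The remaining coordinates. -/
abbrev High (p p₁ : ℕ) : Type := {i : Fin p // p₁ ≤ (i : ℕ)}

/-- Estimated risk of the hybrid candidate with split point `p₁`, monotone shrinkage vector `g`
on the low coordinates and threshold `t` on the high ones. -/
def estRiskHS {p : ℕ} (s : ℝ) (p₁ : ℕ) (g : Fin p → ℝ) (t : ℝ) (z : Fin p → ℝ) : ℝ :=
  (p : ℝ)⁻¹ *
    ((p₁ : ℝ) * estRiskMS s (fun i : Low p p₁ => g i) (fun i : Low p p₁ => z i) +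
      ((p : ℝ) - (p₁ : ℝ)) * estRiskST s t (fun i : High p p₁ => z i))

/-- The hybrid shrinkage vector. -/
def hybridShrink {p : ℕ} (p₁ : ℕ) (g : Fin p → ℝ) (t : ℝ) (z : Fin p → ℝ) : Fin p → ℝ :=
  fun i => if (i : ℕ) < p₁ then g i else softShrink t z i

/-! ### Candidate families

A candidate family consists of an index type, the estimator attached to each index, its estimated
risk, and the set of admissible indices.  `U D` is the penalty basis used for the penalty matrix
`D` and `s2` the variance estimator. -/

/-- A monotone shrinkage candidate: a penalty matrix and a shrinkage vector. -/
abbrev IndexMS (p : ℕ) : Type := Penalty p × (Fin p → ℝ)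

/-- The set of monotone shrinkage candidates with penalty matrix in `𝒟`. -/
def candMS {p : ℕ} (𝒟 : Finset (Penalty p)) : Set (IndexMS p) :=
  {k | k.1 ∈ 𝒟 ∧ k.2 ∈ FMS (Fin p)}

/-- The estimator of a monotone shrinkage candidate. -/
def estMS {p : ℕ} {n : Fin p → ℕ} (U : Penalty p → Matrix (Obs n) (Fin p) ℝ)
    (k : IndexMS p) (y : Data n) : Data n :=
  shrink (U k.1) k.2 y

/-- The estimated risk of a monotone shrinkage candidate. -/
def eriskMS {p : ℕ} {n : Fin p → ℕ} (U : Penalty p → Matrix (Obs n) (Fin p) ℝ)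
    (s2 : Data n → ℝ) (k : IndexMS p) (y : Data n) : ℝ :=
  estRiskMS (s2 y) k.2 ((U k.1)ᵀ *ᵥ y)

/-- A soft-thresholding candidate: a penalty matrix and a threshold (the shrinkage vector depends
on the data through the threshold). -/
abbrev IndexST (p : ℕ) : Type := Penalty p × ℝ

/-- The set of soft-thresholding candidates with penalty matrix in `𝒟` and threshold in `T p`. -/
def candST {p : ℕ} (T : ℕ → Set ℝ) (𝒟 : Finset (Penalty p)) : Set (IndexST p) :=
  {k | k.1 ∈ 𝒟 ∧ k.2 ∈ T p}

/-- The estimator of a soft-thresholding candidate. -/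
def estST {p : ℕ} {n : Fin p → ℕ} (U : Penalty p → Matrix (Obs n) (Fin p) ℝ)
    (k : IndexST p) (y : Data n) : Data n :=
  shrink (U k.1) (softShrink k.2 ((U k.1)ᵀ *ᵥ y)) y

/-- The estimated risk of a soft-thresholding candidate. -/
def eriskST {p : ℕ} {n : Fin p → ℕ} (U : Penalty p → Matrix (Obs n) (Fin p) ℝ)
    (s2 : Data n → ℝ) (k : IndexST p) (y : Data n) : ℝ :=
  estRiskST (s2 y) k.2 ((U k.1)ᵀ *ᵥ y)

/-- A hybrid candidate: a penalty matrix, a split fraction, a vector of which only the low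
coordinates are used, and a threshold for the high coordinates. -/
structure IndexHS (p : ℕ) : Type where
  /-- penalty matrix -/
  D : Penalty p
  /-- split fraction -/
  α : ℝ
  /-- shrinkage vector for the low coordinates -/
  g : Fin p → ℝ
  /-- threshold for the high coordinates -/
  t : ℝ

/-- The set of hybrid candidates with penalty matrix in `𝒟`, split fraction in `𝒜`, and threshold
in `T p₂`, where `p₂` is the number of high coordinates. -/
def candHS {p : ℕ} (T : ℕ → Set ℝ) (𝒟 : Finset (Penalty p)) (𝒜 : Finset ℝ) :
    Set (IndexHS p) :=
  {k | k.D ∈ 𝒟 ∧ k.α ∈ 𝒜 ∧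
    (fun i : Low p (split p k.α) => k.g i) ∈ FMS (Low p (split p k.α)) ∧
    k.t ∈ T (p - split p k.α)}

/-- The estimator of a hybrid candidate. -/
def estHS {p : ℕ} {n : Fin p → ℕ} (U : Penalty p → Matrix (Obs n) (Fin p) ℝ)
    (k : IndexHS p) (y : Data n) : Data n :=
  shrink (U k.D) (hybridShrink (split p k.α) k.g k.t ((U k.D)ᵀ *ᵥ y)) y

/-- The estimated risk of a hybrid candidate. -/
def eriskHS {p : ℕ} {n : Fin p → ℕ} (U : Penalty p → Matrix (Obs n) (Fin p) ℝ)
    (s2 : Data n → ℝ) (k : IndexHS p) (y : Data n) : ℝ :=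
  estRiskHS (s2 y) (split p k.α) k.g k.t ((U k.D)ᵀ *ᵥ y)

/-- All nonnegative thresholds. -/
def allThr : ℕ → Set ℝ := fun _ => Set.Ici 0

/-- The thresholds in `[0, (2 log k)^{1/2}]`. -/
def univThr : ℕ → Set ℝ := fun k => Set.Icc 0 (√(2 * Real.log k))

/-! ### Modes of convergence

Expectations of absolute values and suprema are taken in `[0, ∞]`. -/

/-- The level means for which `ξ = Uᵀ η` satisfies `‖ξ‖_∞ ≤ c`, for the penalty basis `U D` of each
`D` in `𝒟`. -/
def paramSet {p : ℕ} (n : Fin p → ℕ) (U : Penalty p → Matrix (Obs n) (Fin p) ℝ)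
    (𝒟 : Finset (Penalty p)) (c : ℝ) : Set (Fin p → ℝ) :=
  {μ | ∀ D ∈ 𝒟, ‖(U D)ᵀ *ᵥ mean n μ‖ ≤ c}

/-- `sup E |σ̂² - σ²|` over the level means in `Θ`. -/
def varError {p : ℕ} (n : Fin p → ℕ) (Θ : Set (Fin p → ℝ)) (s2 : Data n → ℝ) (v : ℝ≥0) :
    ℝ≥0∞ :=
  ⨆ μ ∈ Θ, ∫⁻ y, ‖s2 y - (v : ℝ)‖ₑ ∂(law n μ v)

/-- `sup_{μ ∈ Θ} E sup_{k ∈ K} |V(k) - R(k)|`, where `R(k)` is the risk of candidate `k`. -/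
def uniformGap {p : ℕ} (n : Fin p → ℕ) (Θ : Set (Fin p → ℝ)) {κ : Type} (K : Set κ)
    (est : κ → Data n → Data n) (V : κ → (Fin p → ℝ) → Data n → ℝ) (v : ℝ≥0) : ℝ≥0∞ :=
  ⨆ μ ∈ Θ, ∫⁻ y, ⨆ k ∈ K, ‖V k μ y - risk n (est k) μ v‖ₑ ∂(law n μ v)

/-- `sup_{μ ∈ Θ} |R(η̂) - inf_{k ∈ K} R(k)|` for an estimator `ηhat`. -/
def oracleGap {p : ℕ} (n : Fin p → ℕ) (Θ : Set (Fin p → ℝ)) {κ : Type} (K : Set κ)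
    (est : κ → Data n → Data n) (ηhat : Data n → Data n) (v : ℝ≥0) : ℝ≥0∞ :=
  ⨆ μ ∈ Θ, ‖risk n ηhat μ v - ⨅ k : K, risk n (est k) μ v‖ₑ

/-- `sup_{μ ∈ Θ} E |r̂ - W|`. -/
def plugInGap {p : ℕ} (n : Fin p → ℕ) (Θ : Set (Fin p → ℝ)) (rhat : Data n → ℝ)
    (W : (Fin p → ℝ) → Data n → ℝ) (v : ℝ≥0) : ℝ≥0∞ :=
  ⨆ μ ∈ Θ, ∫⁻ y, ‖rhat y - W μ y‖ₑ ∂(law n μ v)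

/-- `khat` selects, for every data vector, a minimizer of the estimated risk over the search set
`S`, and the resulting adaptive estimator is a measurable function of the data. -/
def IsAdaptive {p : ℕ} {n : Fin p → ℕ} {κ : Type} (S : Set κ) (est : κ → Data n → Data n)
    (erisk : κ → Data n → ℝ) (khat : Data n → κ) : Prop :=
  (∀ y, khat y ∈ S ∧ ∀ k ∈ S, erisk (khat y) y ≤ erisk k y) ∧
    Measurable fun y => est (khat y) y

/-- Adaptation works, uniformly over `Θ c p` for every `c > 0` and for every variance `v > 0`,
as `p → ∞`:
* loss and estimated risk converge to the risk, uniformly over all candidates in `K p`;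
* the risk of the adaptive estimator converges to the smallest risk over `K p`;
* the plug-in estimated risk converges to the loss and to the risk of the adaptive estimator.

The adaptive estimator is any minimizer of estimated risk over the search set `S p`. -/
def AdaptationWorks (n : ∀ p : ℕ, Fin p → ℕ) (Θ : ℝ → ∀ p : ℕ, Set (Fin p → ℝ))
    {κ : ℕ → Type} (K S : ∀ p, Set (κ p)) (est : ∀ p, κ p → Data (n p) → Data (n p))
    (erisk : ∀ p, κ p → Data (n p) → ℝ) : Prop :=
  (∀ c : ℝ, 0 < c → ∀ v : ℝ≥0, 0 < v →
    Tendsto (fun p => uniformGap (n p) (Θ c p) (K p) (est p)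
      (fun k μ y => loss (n p) (est p k) μ y) v) atTop (𝓝 0) ∧
    Tendsto (fun p => uniformGap (n p) (Θ c p) (K p) (est p)
      (fun k _ y => erisk p k y) v) atTop (𝓝 0)) ∧
  ∀ khat : ∀ p, Data (n p) → κ p,
    (∀ p, IsAdaptive (S p) (est p) (erisk p) (khat p)) →
    ∀ c : ℝ, 0 < c → ∀ v : ℝ≥0, 0 < v →
      Tendsto (fun p => oracleGap (n p) (Θ c p) (K p) (est p)
        (fun y => est p (khat p y) y) v) atTop (𝓝 0) ∧
      Tendsto (fun p => plugInGap (n p) (Θ c p) (fun y => erisk p (khat p y) y)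
        (fun μ y => loss (n p) (fun y => est p (khat p y) y) μ y) v) atTop (𝓝 0) ∧
      Tendsto (fun p => plugInGap (n p) (Θ c p) (fun y => erisk p (khat p y) y)
        (fun μ _ => risk (n p) (fun y => est p (khat p y) y) μ v) v) atTop (𝓝 0)

end OneWay

end

namespace OneWay

/-! The penalty bases have orthonormal columns spanning the column space of `X`, so the loss is a
quadratic loss in `z = Uᵀ y`, whose coordinates are independent normals with variance `σ²` and means
`ξ i`, `|ξ i| ≤ c` (`loss_mulVec`, `measurePreserving_coeff`). MS and ST are the hybrid candidates
with split point `p` and `0`, so only hybrid candidates have to be treated.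

The core is `exists_uniform_bound`: for one basis, a single variable `Y` with second moment of order
`p^(-1/2)` bounds the deviation of loss from risk over all split points, monotone vectors and
thresholds at once; with the extra term `|σ̂² - σ²|` it also bounds the deviation of estimated risk.
On the low coordinates the deviations are sums of centered variables with monotone weights in
`[0,1]`. Summation by parts (`abs_partialSum_mul_le`) bounds them by the largest unweighted partial
sum, and Doob's inequality (`runMax_sq_le`, `exists_partialSum_le`) controls that maximum. On the
high coordinates Stein's identity (`integral_softLoss`) identifies the mean of the estimated risk.
Thresholds are discretized to about `m²` grid points with bracketing error of order `1/m` per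
coordinate (`exists_tailSum_le_of_brackets`). The normalized second moment is of order `m²/p +
1/m²`, and `m ≈ p^(1/4)` balances the two terms.

For several penalty matrices the bounds `Y` are combined by the root of the sum of squares. This
multiplies the second moment by `#𝒟` and requires no relation between the different bases
(`exists_dominates`).

Adaptation is then deterministic: a minimizer of a uniformly accurate estimate of risk is nearly
optimal (`Dominates.adaptive_pointwise`). When the search is restricted to thresholds below `√(2 log
p₂)`, lowering a larger threshold to this cap costs little: either the cap is large, or the high
block is a negligible fraction of all coordinates (`exists_threshold_near`). -/

/-! ### Second moment bounds -/

/-- `Y` is square integrable with second moment at most `B`. -/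
structure SqBound {Ω : Type*} [MeasurableSpace Ω] (P : Measure Ω) (Y : Ω → ℝ) (B : ℝ) : Prop where
  memLp : MemLp Y 2 P
  le : ∫ ω, Y ω ^ 2 ∂P ≤ B

namespace SqBound

variable {Ω : Type*} [MeasurableSpace Ω] {P : Measure Ω} {Y Z : Ω → ℝ} {B B' : ℝ}

theorem mono (h : SqBound P Y B) (hB : B ≤ B') : SqBound P Y B' := ⟨h.memLp, h.le.trans hB⟩

theorem add (h : SqBound P Y B) (h' : SqBound P Z B') :
    SqBound P (fun ω => Y ω + Z ω) (2 * B + 2 * B') := by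
  refine ⟨h.memLp.add h'.memLp, ?_⟩
  calc ∫ ω, (Y ω + Z ω) ^ 2 ∂P
      ≤ ∫ ω, (2 * Y ω ^ 2 + 2 * Z ω ^ 2) ∂P := by
        refine integral_mono (h.memLp.add h'.memLp).integrable_sq
          ((h.memLp.integrable_sq.const_mul 2).add (h'.memLp.integrable_sq.const_mul 2)) ?_
        intro ω
        simp only
        nlinarith [sq_nonneg (Y ω - Z ω)]
    _ = 2 * ∫ ω, Y ω ^ 2 ∂P + 2 * ∫ ω, Z ω ^ 2 ∂P := by
        rw [integral_add (h.memLp.integrable_sq.const_mul 2) (h'.memLp.integrable_sq.const_mul 2),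
          integral_const_mul, integral_const_mul]
    _ ≤ _ := by linarith [h.le, h'.le]

theorem const_mul (h : SqBound P Y B) (a : ℝ) : SqBound P (fun ω => a * Y ω) (a ^ 2 * B) := by
  refine ⟨h.memLp.const_mul a, ?_⟩
  simp_rw [mul_pow]
  rw [integral_const_mul]
  exact mul_le_mul_of_nonneg_left h.le (sq_nonneg _)

theorem const [IsProbabilityMeasure P] (a : ℝ) : SqBound P (fun _ => a) (a ^ 2) :=
  ⟨memLp_const a, by simp⟩

/-- The root of the sum of squares dominates each `|Q i|`, so this serves as a union bound: a
maximum over finitely many variables costs the sum of the second moments, under any dependence. It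
is used for the grid of thresholds and for the set of penalty matrices. -/
theorem sqrt_sum {ι : Type*} (s : Finset ι) {Q : ι → Ω → ℝ} {b : ι → ℝ}
    (h : ∀ i ∈ s, SqBound P (Q i) (b i)) :
    SqBound P (fun ω => √(∑ i ∈ s, Q i ω ^ 2)) (∑ i ∈ s, b i) := by
  have hint : Integrable (fun ω => ∑ i ∈ s, Q i ω ^ 2) P :=
    integrable_finsetSum s fun i hi => (h i hi).memLp.integrable_sq
  have hsq : ∀ ω, √(∑ i ∈ s, Q i ω ^ 2) ^ 2 = ∑ i ∈ s, Q i ω ^ 2 := fun ω =>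
    Real.sq_sqrt (Finset.sum_nonneg fun i _ => sq_nonneg _)
  refine ⟨?_, ?_⟩
  · rw [memLp_two_iff_integrable_sq (by
      exact (Real.continuous_sqrt.measurable.comp_aemeasurable hint.aemeasurable).aestronglyMeasurable)]
    simpa only [hsq] using hint
  · simp_rw [hsq]
    rw [integral_finsetSum s fun i hi => (h i hi).memLp.integrable_sq]
    exact Finset.sum_le_sum fun i hi => (h i hi).le

theorem sum {ι : Type*} (s : Finset ι) {Q : ι → Ω → ℝ} {b : ι → ℝ}
    (h : ∀ i ∈ s, SqBound P (Q i) (b i)) :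
    SqBound P (fun ω => ∑ i ∈ s, Q i ω) (s.card * ∑ i ∈ s, b i) := by
  have hm : MemLp (fun ω => ∑ i ∈ s, Q i ω) 2 P :=
    memLp_finsetSum s fun i hi => (h i hi).memLp
  have hint : Integrable (fun ω => ∑ i ∈ s, Q i ω ^ 2) P :=
    integrable_finsetSum s fun i hi => (h i hi).memLp.integrable_sq
  refine ⟨hm, ?_⟩
  calc ∫ ω, (∑ i ∈ s, Q i ω) ^ 2 ∂P ≤ ∫ ω, s.card * ∑ i ∈ s, Q i ω ^ 2 ∂P :=
        integral_mono hm.integrable_sq (hint.const_mul _) fun ω => sq_sum_le_card_mul_sum_sq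
    _ = s.card * ∑ i ∈ s, ∫ ω, Q i ω ^ 2 ∂P := by
        rw [integral_const_mul, integral_finsetSum s fun i hi => (h i hi).memLp.integrable_sq]
    _ ≤ _ := by
        gcongr with i hi
        exact (h i hi).le

theorem comp {Ω' : Type*} [MeasurableSpace Ω'] {P' : Measure Ω'} {f : Ω' → Ω}
    (h : SqBound P Y B) (hf : MeasurePreserving f P' P) : SqBound P' (fun ω => Y (f ω)) B := by
  refine ⟨h.memLp.comp_measurePreserving hf, ?_⟩
  have := h.le
  rw [← hf.map_eq, integral_map hf.aemeasurable] at this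
  · exact this
  · rw [hf.map_eq]
    exact h.memLp.integrable_sq.aestronglyMeasurable

theorem lintegral_le [IsProbabilityMeasure P] (h : SqBound P Y B) :
    ∫⁻ ω, ‖Y ω‖ₑ ∂P ≤ ENNReal.ofReal √B := by
  have h1 : ∫⁻ ω, ‖Y ω‖ₑ ∂P = eLpNorm Y 1 P := eLpNorm_one_eq_lintegral_enorm.symm
  rw [h1]
  refine (eLpNorm_le_eLpNorm_of_exponent_le (p := 1) (q := 2) (by norm_num)
    h.memLp.aestronglyMeasurable).trans ?_
  rw [h.memLp.eLpNorm_eq_integral_rpow_norm (by norm_num) (by norm_num)]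
  apply ENNReal.ofReal_le_ofReal
  rw [Real.sqrt_eq_rpow]
  simp only [ENNReal.toReal_ofNat, Real.norm_eq_abs, Real.rpow_ofNat, sq_abs]
  rw [show (2 : ℝ)⁻¹ = 1 / 2 by norm_num]
  exact Real.rpow_le_rpow (integral_nonneg fun _ => sq_nonneg _) h.le (by norm_num)

end SqBound

/-! ### Partial sums and summation by parts -/

/-- The sum of the components with index less than `k`. -/
def partialSum {p : ℕ} (A : Fin p → ℝ) (k : ℕ) : ℝ :=
  ∑ i : Fin p, if (i : ℕ) < k then A i else 0

/-- Extension of a vector to a sequence by zero. -/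
def extendZero {p : ℕ} (A : Fin p → ℝ) (i : ℕ) : ℝ := if h : i < p then A ⟨i, h⟩ else 0

theorem partialSum_eq_sum_range {p : ℕ} (A : Fin p → ℝ) (k : ℕ) :
    partialSum A k = ∑ i ∈ Finset.range k, extendZero A i := by
  have h1 : partialSum A k = ∑ i ∈ Finset.range p, (if i < k then extendZero A i else 0) := by
    rw [Finset.sum_range, partialSum]
    refine Finset.sum_congr rfl fun i _ => ?_
    simp [extendZero]
  rw [h1, ← Finset.sum_filter]
  have h2 : ∑ i ∈ Finset.range k, extendZero A i
      = ∑ i ∈ Finset.range k with i < p, extendZero A i := by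
    rw [Finset.sum_filter]
    refine Finset.sum_congr rfl fun i _ => ?_
    by_cases h : i < p <;> simp [extendZero, h]
  rw [h2]
  refine Finset.sum_congr ?_ fun _ _ => rfl
  ext i
  simp [and_comm]

theorem partialSum_of_le {p : ℕ} (A : Fin p → ℝ) {k : ℕ} (hk : p ≤ k) :
    partialSum A k = ∑ i, A i := by
  rw [partialSum]
  exact Finset.sum_congr rfl fun i _ => if_pos (i.2.trans_le hk)

/-- The left side is the sum of `(f j - f (j + 1)) * S (j + 1)` over `j < k`, with `S` the partial
sums of `A`. The increments are nonnegative and telescope. -/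
theorem abel_range {f A : ℕ → ℝ} (hf : Antitone f) {M : ℝ}
    (hM : ∀ j, |∑ i ∈ Finset.range j, A i| ≤ M) (k : ℕ) :
    |∑ i ∈ Finset.range k, f i * A i - f k * ∑ i ∈ Finset.range k, A i| ≤ (f 0 - f k) * M := by
  induction k with
  | zero => simp
  | succ k ih =>
    rw [Finset.sum_range_succ]
    have hS : A k = ∑ i ∈ Finset.range (k + 1), A i - ∑ i ∈ Finset.range k, A i := by
      rw [Finset.sum_range_succ]; ring
    have h1 := hM (k + 1)
    have h2 := hf (Nat.le_succ k)
    set S' := ∑ i ∈ Finset.range (k + 1), A i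
    rw [hS]
    have h3 : |(f k - f (k + 1)) * S'| ≤ (f k - f (k + 1)) * M := by
      rw [abs_mul, abs_of_nonneg (sub_nonneg.2 h2)]
      exact mul_le_mul_of_nonneg_left h1 (sub_nonneg.2 h2)
    refine le_trans (le_of_eq ?_) ((abs_add_le _ _).trans (add_le_add ih h3) |>.trans
      (le_of_eq (by ring)))
    congr 1
    ring

/-- This removes the supremum over the infinite class of monotone vectors: the bound does not
involve `g`. Monotonicity is required only below the split point. -/
theorem abs_partialSum_mul_le {p k : ℕ} {g A : Fin p → ℝ} {M : ℝ}
    (hg : ∀ i : Fin p, (i : ℕ) < k → g i ∈ Set.Icc (0 : ℝ) 1)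
    (hanti : ∀ i j : Fin p, i ≤ j → (j : ℕ) < k → g j ≤ g i)
    (hM : ∀ j, |partialSum A j| ≤ M) :
    |partialSum (fun i => g i * A i) k| ≤ M := by
  -- Setting the weights to zero from `k` on keeps them nonincreasing, since they are nonnegative,
  -- and makes the boundary term `f k * S k` vanish.
  set f : ℕ → ℝ := fun i => if h : i < p ∧ i < k then g ⟨i, h.1⟩ else 0 with hf
  have hf0 : ∀ i, 0 ≤ f i := by
    intro i
    by_cases h : i < p ∧ i < k
    · simp only [hf, h, and_self, dite_true]; exact (hg ⟨i, h.1⟩ h.2).1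
    · simp [hf, h]
  have hf1 : ∀ i, f i ≤ 1 := by
    intro i
    by_cases h : i < p ∧ i < k
    · simp only [hf, h, and_self, dite_true]; exact (hg ⟨i, h.1⟩ h.2).2
    · simp [hf, h]
  have hfa : Antitone f := by
    intro i j hij
    by_cases h : j < p ∧ j < k
    · have h' : i < p ∧ i < k := ⟨hij.trans_lt h.1, hij.trans_lt h.2⟩
      simp only [hf, h, h', and_self, dite_true]
      exact hanti _ _ hij h.2
    · have : f j = 0 := by simp [hf, h]
      rw [this]; exact hf0 i
  have hfk : f k = 0 := by simp [hf]
  have key := abel_range (A := extendZero A) hfa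
    (fun j => by rw [← partialSum_eq_sum_range]; exact hM j) k
  rw [hfk, zero_mul, sub_zero, sub_zero] at key
  have hM0 : 0 ≤ M := (abs_nonneg _).trans (hM 0)
  rw [partialSum_eq_sum_range]
  have heq : ∑ i ∈ Finset.range k, extendZero (fun i => g i * A i) i
      = ∑ i ∈ Finset.range k, f i * extendZero A i := by
    refine Finset.sum_congr rfl fun i hi => ?_
    have hi' := Finset.mem_range.1 hi
    by_cases h : i < p <;> simp [hf, extendZero, h, hi']
  rw [heq]
  exact key.trans ((mul_le_of_le_one_left hM0 (hf1 0)))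

/-! ### The maximal inequality -/

/-- The running maximum of the partial sums of a sequence, starting from `0`. -/
def runMax (w : ℕ → ℝ) : ℕ → ℝ
  | 0 => 0
  | k + 1 => max (runMax w k) (∑ i ∈ Finset.range (k + 1), w i)

theorem runMax_nonneg (w : ℕ → ℝ) (k : ℕ) : 0 ≤ runMax w k := by
  induction k with
  | zero => exact le_rfl
  | succ k ih => exact ih.trans (le_max_left _ _)

theorem runMax_mono (w : ℕ → ℝ) : Monotone (runMax w) :=
  monotone_nat_of_le_succ fun _ => le_max_left _ _

theorem sum_range_le_runMax (w : ℕ → ℝ) (k : ℕ) : ∑ i ∈ Finset.range k, w i ≤ runMax w k := by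
  cases k with
  | zero => simp [runMax]
  | succ k => exact le_max_right _ _

theorem runMax_congr {w w' : ℕ → ℝ} {k : ℕ} (h : ∀ i < k, w i = w' i) :
    runMax w k = runMax w' k := by
  induction k with
  | zero => rfl
  | succ k ih =>
    simp only [runMax]
    rw [ih fun i hi => h i (hi.trans (Nat.lt_succ_self k)),
      Finset.sum_congr rfl fun i hi => h i (Finset.mem_range.1 hi)]

/-- Pathwise form of Doob's maximal inequality. -/
theorem runMax_sq_le (w : ℕ → ℝ) (k : ℕ) :
    runMax w k ^ 2 ≤ 4 * (∑ i ∈ Finset.range k, w i) ^ 2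
      - 4 * ∑ i ∈ Finset.range k, runMax w i * w i := by
  -- With `M` the running maximum and `S` the sum, the induction step is trivial while `M` stays
  -- put; at a new record `S'` it reduces to `(S' - M)² ≥ 0`.
  have key : ∑ i ∈ Finset.range k, runMax w i * w i
      ≤ runMax w k * (∑ i ∈ Finset.range k, w i) - runMax w k ^ 2 / 2 := by
    induction k with
    | zero => simp [runMax]
    | succ k ih =>
      rw [Finset.sum_range_succ, runMax]
      have hS : w k = ∑ i ∈ Finset.range (k + 1), w i - ∑ i ∈ Finset.range k, w i := by
        rw [Finset.sum_range_succ]; ring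
      set S' := ∑ i ∈ Finset.range (k + 1), w i
      rw [hS]
      rcases le_total (runMax w k) S' with h | h
      · rw [max_eq_right h]
        nlinarith [sq_nonneg (S' - runMax w k)]
      · rw [max_eq_left h]
        nlinarith
  -- `M S ≤ M²/4 + S²` absorbs half of the `M²/2` in `key`; multiplying by `4` gives the constants.
  nlinarith [sq_nonneg (runMax w k / 2 - ∑ i ∈ Finset.range k, w i)]

section Doob

variable {Ω : Type*} [MeasurableSpace Ω] {P : Measure Ω}

theorem measurable_runMax {α : Type*} [MeasurableSpace α] {w : α → ℕ → ℝ}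
    (hw : ∀ i, Measurable fun ω => w ω i) (k : ℕ) : Measurable fun ω => runMax (w ω) k := by
  induction k with
  | zero => simp only [runMax]; exact measurable_const
  | succ k ih =>
    simp only [runMax]
    exact ih.max (Finset.measurable_fun_sum _ fun i _ => hw i)

theorem memLp_runMax {w : Ω → ℕ → ℝ} (hw : ∀ i, MemLp (fun ω => w ω i) 2 P) (k : ℕ) :
    MemLp (fun ω => runMax (w ω) k) 2 P := by
  induction k with
  | zero => simp only [runMax]; exact MemLp.zero'
  | succ k ih =>
    simp only [runMax]
    exact ih.sup (memLp_finsetSum _ fun i _ => hw i)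

theorem measurable_extendZero {α : Type*} [MeasurableSpace α] {p : ℕ} {W : Fin p → α → ℝ}
    (hW : ∀ i, Measurable (W i)) (i : ℕ) : Measurable fun ω => extendZero (fun j => W j ω) i := by
  by_cases h : i < p
  · simp only [extendZero, h, dite_true]; exact hW _
  · simp only [extendZero, h, dite_false]; exact measurable_const

theorem memLp_extendZero {p : ℕ} {W : Fin p → Ω → ℝ} (hW : ∀ i, MemLp (W i) 2 P) (i : ℕ) :
    MemLp (fun ω => extendZero (fun j => W j ω) i) 2 P := by
  by_cases h : i < p
  · simp only [extendZero, h, dite_true]; exact hW _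
  · simp only [extendZero, h, dite_false]; exact MemLp.zero'

/-- The running maximum at `k` depends only on summands with index below `k`, that is, it is
predictable. -/
theorem indepFun_runMax {p : ℕ} {W : Fin p → Ω → ℝ} (hW : ∀ i, Measurable (W i))
    (hind : iIndepFun W P) (k : Fin p) :
    IndepFun (fun ω => runMax (extendZero fun j => W j ω) k) (W k) P := by
  classical
  let S : Finset (Fin p) := Finset.univ.filter (· < k)
  have h := hind.indepFun_finset S {k} (by simp [S]) hW
  -- Coordinates outside `S` are filled with zeros; `runMax_congr` shows that they do not matter.
  let φ : (S → ℝ) → ℝ := fun x =>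
    runMax (extendZero fun j : Fin p => if h : j ∈ S then x ⟨j, h⟩ else 0) k
  have hφ : Measurable φ := by
    refine measurable_runMax (fun i => measurable_extendZero
      (W := fun (j : Fin p) (x : S → ℝ) => if h : j ∈ S then x ⟨j, h⟩ else 0) (fun j => ?_) i) _
    by_cases h : j ∈ S
    · simp only [h, dite_true]; exact measurable_pi_apply _
    · simp only [h, dite_false]; exact measurable_const
  have hψ : Measurable fun x : (({k} : Finset (Fin p)) → ℝ) => x ⟨k, Finset.mem_singleton_self k⟩ :=
    measurable_pi_apply _
  have h2 := h.comp hφ hψ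
  convert! h2 using 1
  ext ω
  refine runMax_congr fun i hi => ?_
  have hip : i < p := hi.trans k.2
  have : (⟨i, hip⟩ : Fin p) ∈ S := by
    simp only [S, Finset.mem_filter, Finset.mem_univ, true_and]
    exact hi
  simp [extendZero, hip, this]

theorem integral_sq_sum_le {p : ℕ} {W : Fin p → Ω → ℝ} (hmem : ∀ i, MemLp (W i) 2 P)
    (hind : iIndepFun W P) (hzero : ∀ i, ∫ ω, W i ω ∂P = 0) {C : ℝ}
    (hC : ∀ i, ∫ ω, W i ω ^ 2 ∂P ≤ C) :
    ∫ ω, (∑ i, W i ω) ^ 2 ∂P ≤ p * C := by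
  have := hind.isProbabilityMeasure
  have h1 : ∀ i, MemLp (W i) 1 P := fun i => (hmem i).mono_exponent (by norm_num)
  have h := IndepFun.variance_sum (s := Finset.univ) (X := W) (μ := P) (fun i _ => hmem i)
    (fun i _ j _ hij => hind.indepFun hij)
  rw [variance_eq_sub (memLp_finsetSum' _ fun i _ => hmem i)] at h
  have h0 : P[∑ i, W i] = 0 := by
    simp only [Finset.sum_apply]
    rw [integral_finsetSum _ fun i _ => memLp_one_iff_integrable.1 (h1 i)]
    simp [hzero]
  rw [h0] at h
  simp only [Pi.pow_apply, Finset.sum_apply, ne_eq, OfNat.ofNat_ne_zero, not_false_eq_true,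
    zero_pow, sub_zero] at h
  rw [h]
  calc ∑ i, Var[W i; P] ≤ ∑ _i : Fin p, C := by
        refine Finset.sum_le_sum fun i _ => ?_
        rw [variance_of_integral_eq_zero (hmem i).aemeasurable (hzero i)]
        exact hC i
    _ = p * C := by simp

/-- Integrating the pathwise inequality `runMax_sq_le` leaves only the final sum: each cross term is
the mean of a predictable factor times an independent centered one, hence zero. -/
theorem integral_runMax_sq_le {p : ℕ} {W : Fin p → Ω → ℝ} (hW : ∀ i, Measurable (W i))
    (hmem : ∀ i, MemLp (W i) 2 P)
    (hind : iIndepFun W P) (hzero : ∀ i, ∫ ω, W i ω ∂P = 0) {C : ℝ}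
    (hC : ∀ i, ∫ ω, W i ω ^ 2 ∂P ≤ C) :
    SqBound P (fun ω => runMax (extendZero fun j => W j ω) p) (4 * (p * C)) := by
  have hM := fun k => memLp_runMax (fun i => memLp_extendZero hmem i) k
  have hext := fun i => memLp_extendZero hmem i
  refine ⟨hM p, ?_⟩
  have hprod : ∀ i, Integrable (fun ω => runMax (extendZero fun j => W j ω) i
      * extendZero (fun j => W j ω) i) P := fun i => (hM i).integrable_mul (hext i)
  have hS : MemLp (fun ω => ∑ i ∈ Finset.range p, extendZero (fun j => W j ω) i) 2 P :=
    memLp_finsetSum _ fun i _ => hext i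
  have hcross : ∀ i ∈ Finset.range p, ∫ ω, runMax (extendZero fun j => W j ω) i
      * extendZero (fun j => W j ω) i ∂P = 0 := by
    intro i hi
    have hip := Finset.mem_range.1 hi
    have := (indepFun_runMax hW hind ⟨i, hip⟩).integral_fun_mul_eq_mul_integral
      (hM i).aestronglyMeasurable (hmem _).aestronglyMeasurable
    simp only [extendZero, hip, dite_true] at this ⊢
    rw [this, hzero, mul_zero]
  calc ∫ ω, runMax (extendZero fun j => W j ω) p ^ 2 ∂P
      ≤ ∫ ω, (4 * (∑ i ∈ Finset.range p, extendZero (fun j => W j ω) i) ^ 2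
        - 4 * ∑ i ∈ Finset.range p, runMax (extendZero fun j => W j ω) i
          * extendZero (fun j => W j ω) i) ∂P := by
        refine integral_mono (hM p).integrable_sq ((hS.integrable_sq.const_mul 4).sub
          ((integrable_finsetSum _ fun i _ => hprod i).const_mul 4)) fun ω => runMax_sq_le _ _
    _ = 4 * ∫ ω, (∑ i ∈ Finset.range p, extendZero (fun j => W j ω) i) ^ 2 ∂P := by
        rw [integral_sub (hS.integrable_sq.const_mul 4)
          ((integrable_finsetSum _ fun i _ => hprod i).const_mul 4), integral_const_mul,
          integral_const_mul, integral_finsetSum _ fun i _ => hprod i, Finset.sum_eq_zero hcross]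
        ring
    _ = 4 * ∫ ω, (∑ i, W i ω) ^ 2 ∂P := by
        congr 2
        ext ω
        rw [← partialSum_eq_sum_range, partialSum_of_le _ le_rfl]
    _ ≤ _ := by
        have := integral_sq_sum_le hmem hind hzero hC
        linarith

/-- All partial sums of independent centered variables are dominated by one variable whose second
moment is of the order of the number of summands. -/
theorem exists_partialSum_le {p : ℕ} {W : Fin p → Ω → ℝ} (hW : ∀ i, Measurable (W i))
    (hmem : ∀ i, MemLp (W i) 2 P)
    (hind : iIndepFun W P) (hzero : ∀ i, ∫ ω, W i ω ∂P = 0) {C : ℝ}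
    (hC : ∀ i, ∫ ω, W i ω ^ 2 ∂P ≤ C) :
    ∃ Y : Ω → ℝ, SqBound P Y (16 * (p * C)) ∧
      ∀ ω k, |partialSum (fun i => W i ω) k| ≤ Y ω := by
  have h1 := integral_runMax_sq_le hW hmem hind hzero hC
  -- The negated sequence controls the minima. Both running maxima start at `0`, so their sum bounds
  -- the absolute values; its second moment costs `2 * 4 + 2 * 4 = 16`.
  have h2 := integral_runMax_sq_le (W := fun i ω => -W i ω) (P := P) (C := C)
    (fun i => (hW i).neg) (fun i => (hmem i).neg)
    (hind.comp (fun _ x => -x) fun _ => measurable_neg)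
    (fun i => by rw [integral_neg, hzero, neg_zero]) (fun i => by simpa using hC i)
  refine ⟨_, (h1.add h2).mono (by linarith), fun ω k => ?_⟩
  have hk : partialSum (fun i => W i ω) k = partialSum (fun i => W i ω) (min k p) := by
    rw [partialSum, partialSum]
    refine Finset.sum_congr rfl fun i _ => ?_
    simp [i.2]
  have hneg : partialSum (fun i => -W i ω) (min k p) = -partialSum (fun i => W i ω) (min k p) := by
    rw [partialSum, partialSum, ← Finset.sum_neg_distrib]
    exact Finset.sum_congr rfl fun i _ => by split_ifs <;> simp
  have a1 := (sum_range_le_runMax (extendZero fun i => W i ω) (min k p)).trans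
    (runMax_mono _ (min_le_right k p))
  have a2 := (sum_range_le_runMax (extendZero fun i => -W i ω) (min k p)).trans
    (runMax_mono _ (min_le_right k p))
  rw [← partialSum_eq_sum_range] at a1 a2
  rw [hneg] at a2
  have b1 := runMax_nonneg (extendZero fun i => W i ω) p
  have b2 := runMax_nonneg (extendZero fun i => -W i ω) p
  rw [hk, abs_le]
  constructor <;> linarith

end Doob

/-! ### Moments of normal variables with bounded mean -/

/-- A bound for the eighth moments of `1 + |x|` under normal laws with mean in `[-c, c]`. -/
noncomputable def momentBound (c : ℝ) (v : ℝ≥0) : ℝ :=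
  ∫ x, (1 + c + |x|) ^ 8 ∂gaussianReal 0 v

theorem integrable_add_abs_pow (a ξ : ℝ) (v : ℝ≥0) (k : ℕ) :
    Integrable (fun x => (a + |x|) ^ k) (gaussianReal ξ v) := by
  have h : MemLp (fun x : ℝ => a + |x|) (k : ℕ) (gaussianReal ξ v) :=
    (memLp_const a).add (memLp_id_gaussianReal (k : ℝ≥0)).abs
  rcases Nat.eq_zero_or_pos k with rfl | hk
  · simp
  have h2 := h.integrable_norm_pow hk.ne'
  refine h2.mono (by fun_prop) (ae_of_all _ fun x => ?_)
  simp

theorem integral_pow_eight_le {c ξ : ℝ} (hξ : |ξ| ≤ c) (v : ℝ≥0) :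
    ∫ x, (1 + |x|) ^ 8 ∂gaussianReal ξ v ≤ momentBound c v := by
  have h : gaussianReal ξ v = (gaussianReal 0 v).map (fun x => ξ + x) := by
    rw [gaussianReal_map_const_add, zero_add]
  have hc : 0 ≤ c := (abs_nonneg _).trans hξ
  rw [h, integral_map (by fun_prop) (by fun_prop), momentBound]
  refine integral_mono ?_ (integrable_add_abs_pow _ _ _ _) fun x => ?_
  · refine (integrable_add_abs_pow (1 + c) 0 v 8).mono (by fun_prop) (ae_of_all _ fun x => ?_)
    rw [Real.norm_of_nonneg (by positivity), Real.norm_of_nonneg (by positivity)]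
    have := abs_add_le ξ x
    gcongr ?_ ^ 8
    linarith
  · have := abs_add_le ξ x
    simp only
    gcongr ?_ ^ 8
    linarith

theorem one_le_momentBound {c : ℝ} (hc : 0 ≤ c) (v : ℝ≥0) : 1 ≤ momentBound c v := by
  rw [momentBound]
  calc (1 : ℝ) = ∫ _x, (1 : ℝ) ∂gaussianReal 0 v := by simp
    _ ≤ _ := by
      refine integral_mono (integrable_const _) (integrable_add_abs_pow _ _ _ _) fun x => ?_
      exact one_le_pow₀ (by linarith [abs_nonneg x])

/-- `h` is measurable and of growth at most quartic, with constant `K`. -/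
structure QuarticBound (h : ℝ → ℝ) (K : ℝ) : Prop where
  meas : Measurable h
  le : ∀ x, |h x| ≤ K * (1 + |x|) ^ 4

namespace QuarticBound

variable {h : ℝ → ℝ} {K c ξ : ℝ} {v : ℝ≥0}

theorem const_nonneg (hh : QuarticBound h K) : 0 ≤ K := by
  simpa using (abs_nonneg _).trans (hh.le 0)

theorem sq_le (hh : QuarticBound h K) (x : ℝ) : h x ^ 2 ≤ K ^ 2 * (1 + |x|) ^ 8 := by
  rw [← sq_abs]
  calc |h x| ^ 2 ≤ (K * (1 + |x|) ^ 4) ^ 2 := by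
        gcongr
        exact hh.le x
    _ = _ := by ring

theorem memLp (hh : QuarticBound h K) (ξ : ℝ) (v : ℝ≥0) : MemLp h 2 (gaussianReal ξ v) := by
  rw [memLp_two_iff_integrable_sq hh.meas.aestronglyMeasurable]
  refine ((integrable_add_abs_pow 1 ξ v 8).const_mul (K ^ 2)).mono
    (hh.meas.pow_const 2).aestronglyMeasurable (ae_of_all _ fun x => ?_)
  rw [Real.norm_of_nonneg (sq_nonneg _), Real.norm_of_nonneg (by positivity)]
  exact hh.sq_le x

theorem integrable (hh : QuarticBound h K) (ξ : ℝ) (v : ℝ≥0) :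
    Integrable h (gaussianReal ξ v) := (hh.memLp ξ v).integrable (by norm_num)

theorem sqBound (hh : QuarticBound h K) (hξ : |ξ| ≤ c) :
    SqBound (gaussianReal ξ v) h (K ^ 2 * momentBound c v) := by
  refine ⟨hh.memLp ξ v, ?_⟩
  calc ∫ x, h x ^ 2 ∂gaussianReal ξ v ≤ ∫ x, K ^ 2 * (1 + |x|) ^ 8 ∂gaussianReal ξ v :=
        integral_mono (hh.memLp ξ v).integrable_sq
          ((integrable_add_abs_pow 1 ξ v 8).const_mul _) hh.sq_le
    _ ≤ _ := by
        rw [integral_const_mul]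
        exact mul_le_mul_of_nonneg_left (integral_pow_eight_le hξ v) (sq_nonneg _)

theorem integral_abs_le (hh : QuarticBound h K) (hξ : |ξ| ≤ c) :
    ∫ x, |h x| ∂gaussianReal ξ v ≤ K * momentBound c v := by
  calc ∫ x, |h x| ∂gaussianReal ξ v ≤ ∫ x, K * (1 + |x|) ^ 8 ∂gaussianReal ξ v := by
        refine integral_mono (hh.integrable ξ v).abs
          ((integrable_add_abs_pow 1 ξ v 8).const_mul _) fun x => (hh.le x).trans ?_
        have := hh.const_nonneg
        gcongr
        · linarith [abs_nonneg x]
        · norm_num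
    _ ≤ _ := by
        rw [integral_const_mul]
        exact mul_le_mul_of_nonneg_left (integral_pow_eight_le hξ v) hh.const_nonneg

theorem centered_sqBound (hh : QuarticBound h K) (hξ : |ξ| ≤ c) :
    SqBound (gaussianReal ξ v) (fun x => h x - ∫ u, h u ∂gaussianReal ξ v)
      (K ^ 2 * momentBound c v) := by
  refine ⟨(hh.memLp ξ v).sub (memLp_const _), ?_⟩
  rw [← variance_eq_integral hh.meas.aemeasurable]
  exact (variance_le_expectation_sq hh.meas.aestronglyMeasurable).trans (hh.sqBound hξ).le

end QuarticBound

theorem integral_sq_gaussianReal (ξ : ℝ) (v : ℝ≥0) :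
    ∫ x, x ^ 2 ∂gaussianReal ξ v = ξ ^ 2 + v := by
  have h := variance_eq_sub (memLp_id_gaussianReal (μ := ξ) (v := v) 2)
  rw [variance_id_gaussianReal] at h
  simp only [Pi.pow_apply, id_eq, integral_id_gaussianReal] at h
  linarith

/-! ### Soft thresholding of one normal variable -/

/-- Soft thresholding of a real number. -/
noncomputable def soft (t x : ℝ) : ℝ := max (1 - t / |x|) 0 * x

/-- Truncation to `[-t, t]`. -/
noncomputable def clip (t x : ℝ) : ℝ := max (-t) (min x t)

/-- Truncation is Lipschitz in `t`, bounded by `|x|`, and its square is the integrand `(|x| ∧ t)²`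
of the estimated risk, so all later work is done with `clip`. -/
theorem soft_eq {t : ℝ} (ht : 0 ≤ t) (x : ℝ) : soft t x = x - clip t x := by
  unfold soft clip
  rcases lt_trichotomy x 0 with h | rfl | h
  · rw [abs_of_neg h, min_eq_left (h.le.trans ht)]
    rcases le_total x (-t) with h' | h'
    · rw [max_eq_left h', max_eq_left]
      · have := h.ne
        rw [div_neg]
        field_simp
      · rw [sub_nonneg, div_le_one (by linarith)]; linarith
    · rw [max_eq_right h', max_eq_right]
      · ring
      · rw [sub_nonpos, one_le_div (by linarith)]; linarith
  -- At `x = 0` the quotient is zero by convention and the shrinkage factor is `1`, which is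
  -- harmless in front of `x`.
  · simp [ht]
  · rw [abs_of_pos h]
    rcases le_total x t with h' | h'
    · rw [min_eq_left h', max_eq_right (a := -t) (by linarith), max_eq_right]
      · ring
      · rw [sub_nonpos, one_le_div h]; exact h'
    · rw [min_eq_right h', max_eq_right (a := -t) (by linarith), max_eq_left]
      · field_simp
      · rw [sub_nonneg, div_le_one h]; exact h'

theorem clip_sq {t : ℝ} (ht : 0 ≤ t) (x : ℝ) : clip t x ^ 2 = min |x| t ^ 2 := by
  unfold clip
  rcases le_total 0 x with h | h
  · rw [abs_of_nonneg h, max_eq_right]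
    exact (neg_nonpos.2 ht).trans (le_min h ht)
  · rw [abs_of_nonpos h, min_eq_left (h.trans ht), ← neg_sq]
    congr 1
    rw [← min_neg_neg, neg_neg, min_comm]

theorem abs_clip_le {t : ℝ} (ht : 0 ≤ t) (x : ℝ) : |clip t x| ≤ |x| := by
  rw [← sq_le_sq]
  rw [clip_sq ht, ← sq_abs x]
  exact pow_le_pow_left₀ (le_min (abs_nonneg _) ht) (min_le_left _ _) 2

theorem measurable_clip (t : ℝ) : Measurable (clip t) := by
  unfold clip; fun_prop

theorem abs_clip_sub_le (t s x : ℝ) : |clip t x - clip s x| ≤ |t - s| := by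
  unfold clip
  refine (abs_max_sub_max_le_max _ _ _ _).trans (max_le ?_ ?_)
  · rw [neg_sub_neg, abs_sub_comm]
  · refine (abs_min_sub_min_le_max _ _ _ _).trans (max_le ?_ le_rfl)
    simp

/-- The two truncations differ only where `|x| > s`, and there `|x| ≤ x² / s`. This makes the
unbounded range of thresholds effectively compact. -/
theorem abs_clip_sub_le_div {t s : ℝ} (hs : 0 < s) (hst : s ≤ t) (x : ℝ) :
    |clip t x - clip s x| ≤ x ^ 2 / s := by
  have h0 : 0 ≤ x ^ 2 / s := by positivity
  by_cases hx : |x| ≤ s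
  · have h1 : ∀ u, s ≤ u → clip u x = x := by
      intro u hu
      have := abs_le.1 (hx.trans hu)
      unfold clip
      rw [min_eq_left this.2, max_eq_right this.1]
    rw [h1 t hst, h1 s le_rfl]
    simpa using h0
  · push Not at hx
    have h2 : |clip t x - clip s x| ≤ |x| := by
      unfold clip
      rcases le_total 0 x with h | h
      · rw [max_eq_right, max_eq_right, abs_le, abs_of_nonneg h]
        · constructor
          · have := min_le_left x s
            have := le_min h (hs.le.trans hst)
            linarith
          · have := min_le_left x t
            have := le_min h hs.le
            linarith
        · exact (neg_nonpos.2 hs.le).trans (le_min h hs.le)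
        · exact (neg_nonpos.2 (hs.le.trans hst)).trans (le_min h (hs.le.trans hst))
      · rw [min_eq_left (h.trans hs.le), min_eq_left (h.trans (hs.le.trans hst)), abs_le,
          abs_of_nonpos h]
        constructor
        · have := le_max_right (-t) x
          have := max_le (neg_nonpos.2 hs.le) h
          linarith
        · have := le_max_right (-s) x
          have := max_le (neg_nonpos.2 (hs.le.trans hst)) h
          linarith
    refine h2.trans ?_
    rw [le_div_iff₀ hs, ← sq_abs, sq]
    exact mul_le_mul_of_nonneg_left hx.le (abs_nonneg _)

/-- The indicator of `[-t, t]`. -/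
noncomputable def bandInd (t x : ℝ) : ℝ := if |x| ≤ t then 1 else 0

theorem measurable_bandInd (t : ℝ) : Measurable (bandInd t) :=
  Measurable.ite (measurableSet_le (by fun_prop) measurable_const) measurable_const
    measurable_const

theorem bandInd_nonneg (t x : ℝ) : 0 ≤ bandInd t x := by unfold bandInd; split_ifs <;> norm_num

theorem bandInd_le_one (t x : ℝ) : bandInd t x ≤ 1 := by unfold bandInd; split_ifs <;> norm_num

theorem bandInd_mono {s t : ℝ} (h : s ≤ t) (x : ℝ) : bandInd s x ≤ bandInd t x := by
  unfold bandInd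
  split_ifs with h1 h2 <;> first | exact absurd (h1.trans h) h2 | norm_num

theorem one_sub_bandInd_le {t : ℝ} (ht : 0 < t) (x : ℝ) : 1 - bandInd t x ≤ |x| / t := by
  unfold bandInd
  split_ifs with h
  · rw [sub_self]; positivity
  · rw [sub_zero, one_le_div ht]; exact (not_le.1 h).le

theorem quartic_clip_mul {t c ξ : ℝ} (ht : 0 ≤ t) (hξ : |ξ| ≤ c) :
    QuarticBound (fun x => (x - ξ) * clip t x) (1 + c) := by
  refine ⟨(measurable_id.sub_const ξ).mul (measurable_clip t), fun x => ?_⟩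
  have h1 := abs_clip_le ht x
  have h2 := abs_sub x ξ
  have h0 := abs_nonneg x
  have h3 := abs_nonneg ξ
  rw [abs_mul]
  calc |x - ξ| * |clip t x| ≤ ((1 + c) * (1 + |x|)) * (1 + |x|) :=
        mul_le_mul (by nlinarith) (by linarith) (abs_nonneg _) (by nlinarith)
    _ = (1 + c) * (1 + |x|) ^ 2 := by ring
    _ ≤ _ := by
      have : 0 ≤ c := h3.trans hξ
      gcongr
      · linarith
      · norm_num

theorem integrable_pdf_mul {ξ : ℝ} {v : ℝ≥0} (hv : v ≠ 0) {h : ℝ → ℝ}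
    (hh : Integrable h (gaussianReal ξ v)) :
    Integrable fun x => gaussianPDFReal ξ v x * h x := by
  rw [gaussianReal_of_var_ne_zero _ hv, integrable_withDensity_iff_integrable_smul₀'
    (measurable_gaussianPDF ξ v).aemeasurable (ae_of_all _ fun _ => gaussianPDF_lt_top)] at hh
  simpa [toReal_gaussianPDF] using hh

theorem hasDerivAt_gaussianPDFReal {ξ : ℝ} {v : ℝ≥0} (hv : v ≠ 0) (x : ℝ) :
    HasDerivAt (fun x => -(v : ℝ) * gaussianPDFReal ξ v x)
      (gaussianPDFReal ξ v x * (x - ξ)) x := by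
  have hv' : (v : ℝ) ≠ 0 := by exact_mod_cast hv
  unfold gaussianPDFReal
  have h1 : HasDerivAt (fun x : ℝ => -(x - ξ) ^ 2 / (2 * (v : ℝ))) (-(2 * (x - ξ)) / (2 * v)) x := by
    have := ((((hasDerivAt_id x).sub_const ξ).pow 2).neg).div_const (2 * (v : ℝ))
    simpa using this
  have h2 := ((h1.exp.const_mul (√(2 * Real.pi * v))⁻¹)).const_mul (-(v : ℝ))
  refine h2.congr_deriv ?_
  field_simp

/-- Stein's identity for truncation. -/
theorem integral_sub_mul_clip {ξ t : ℝ} {v : ℝ≥0} (hv : v ≠ 0) (ht : 0 ≤ t) :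
    ∫ x, (x - ξ) * clip t x ∂gaussianReal ξ v = v * ∫ x, bandInd t x ∂gaussianReal ξ v := by
  rw [integral_gaussianReal_eq_integral_smul hv, integral_gaussianReal_eq_integral_smul hv]
  simp only [smul_eq_mul]
  set f := gaussianPDFReal ξ v with hf
  have hder := hasDerivAt_gaussianPDFReal (ξ := ξ) hv
  have hint1 : Integrable fun x => f x * (x - ξ) :=
    integrable_pdf_mul hv ((memLp_id_gaussianReal (μ := ξ) (v := v) 1 |>.integrable
      (by norm_num)).sub (integrable_const ξ))
  have hint0 : Integrable fun x => -(v : ℝ) * f x := (integrable_gaussianPDFReal ξ v).const_mul _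
  have hint : Integrable fun x => f x * ((x - ξ) * clip t x) :=
    integrable_pdf_mul hv ((quartic_clip_mul ht le_rfl).integrable ξ v)
  have hintx : Integrable fun x => f x * ((x - ξ) * x) := by
    refine integrable_pdf_mul hv ?_
    have h1 : MemLp id 2 (gaussianReal ξ v) := memLp_id_gaussianReal 2
    exact (h1.sub (memLp_const ξ)).integrable_mul h1
  -- Integration by parts on three pieces: truncation is constant on each tail and the identity in
  -- the middle. The boundary terms at `t` and `-t` cancel.
  have hright : ∫ x in Set.Ioi t, f x * ((x - ξ) * clip t x) = t * (v * f t) := by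
    have h1 : ∫ x in Set.Ioi t, f x * ((x - ξ) * clip t x)
        = ∫ x in Set.Ioi t, t * (f x * (x - ξ)) := by
      refine setIntegral_congr_fun measurableSet_Ioi fun x hx => ?_
      have : clip t x = t := by
        unfold clip; rw [min_eq_right (le_of_lt hx), max_eq_right (by linarith)]
      simp only [this]; ring
    rw [h1, integral_const_mul, integral_Ioi_of_hasDerivAt_of_tendsto' (fun x _ => hder x)
      hint1.integrableOn (tendsto_zero_of_hasDerivAt_of_integrableOn_Ioi (a := t)
        (fun x _ => hder x) hint1.integrableOn hint0.integrableOn)]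
    ring
  have hleft : ∫ x in Set.Iic (-t), f x * ((x - ξ) * clip t x) = t * (v * f (-t)) := by
    have h1 : ∫ x in Set.Iic (-t), f x * ((x - ξ) * clip t x)
        = ∫ x in Set.Iic (-t), (-t) * (f x * (x - ξ)) := by
      refine setIntegral_congr_fun measurableSet_Iic fun x hx => ?_
      have hx' : x ≤ -t := hx
      have : clip t x = -t := by
        unfold clip; rw [min_eq_left (by linarith), max_eq_left hx']
      simp only [this]; ring
    rw [h1, integral_const_mul, integral_Iic_of_hasDerivAt_of_tendsto' (fun x _ => hder x)
      hint1.integrableOn (tendsto_zero_of_hasDerivAt_of_integrableOn_Iic (a := -t)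
        (fun x _ => hder x) hint1.integrableOn hint0.integrableOn)]
    ring
  have hmid : ∫ x in (-t)..t, f x * ((x - ξ) * clip t x)
      = v * (∫ x in (-t)..t, f x) - t * (v * f t) - t * (v * f (-t)) := by
    have h1 : ∫ x in (-t)..t, f x * ((x - ξ) * clip t x)
        = ∫ x in (-t)..t, ((f x * ((x - ξ) * x) - v * f x) + v * f x) := by
      refine intervalIntegral.integral_congr fun x hx => ?_
      rw [Set.uIcc_of_le (by linarith)] at hx
      have : clip t x = x := by
        unfold clip; rw [min_eq_left hx.2, max_eq_right hx.1]
      simp only [this]; ring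
    have hi2 : Integrable fun x => (v : ℝ) * f x := (integrable_gaussianPDFReal ξ v).const_mul _
    have hi3 : Integrable fun x => f x * ((x - ξ) * x) - v * f x := hintx.sub hi2
    -- The bracketed difference is the derivative of `-v * x * f x`; what remains is `v` times the
    -- mass of the band.
    rw [h1, intervalIntegral.integral_add hi3.intervalIntegrable
      hi2.intervalIntegrable, intervalIntegral.integral_const_mul,
      intervalIntegral.integral_eq_sub_of_hasDerivAt (f := fun x => x * (-(v : ℝ) * f x))
        (fun x _ => ?_) hi3.intervalIntegrable]
    · ring
    · refine ((hasDerivAt_id x).mul (hder x)).congr_deriv ?_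
      simp only [id]; ring
  have hband : ∫ x, f x * bandInd t x = ∫ x in (-t)..t, f x := by
    rw [intervalIntegral.integral_of_le (by linarith), ← integral_Icc_eq_integral_Ioc,
      ← integral_indicator measurableSet_Icc]
    congr 1
    ext x
    simp only [bandInd, Set.indicator_apply, Set.mem_Icc, abs_le]
    split_ifs <;> simp
  rw [hband, ← intervalIntegral.integral_Iic_add_Ioi (b := t) hint.integrableOn hint.integrableOn,
    ← sub_add_cancel (∫ x in Set.Iic t, f x * ((x - ξ) * clip t x))
      (∫ x in Set.Iic (-t), f x * ((x - ξ) * clip t x)),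
    intervalIntegral.integral_Iic_sub_Iic hint.integrableOn hint.integrableOn, hleft, hright, hmid]
  ring

theorem quartic_softLoss {t c ξ : ℝ} (ht : 0 ≤ t) (hξ : |ξ| ≤ c) :
    QuarticBound (fun x => (soft t x - ξ) ^ 2) ((2 + c) ^ 2) := by
  have hc : 0 ≤ c := (abs_nonneg _).trans hξ
  simp_rw [soft_eq ht]
  refine ⟨((measurable_id.sub (measurable_clip t)).sub_const ξ).pow_const 2, fun x => ?_⟩
  have h1 := abs_clip_le ht x
  have h0 := abs_nonneg x
  rw [abs_of_nonneg (sq_nonneg _), ← sq_abs]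
  have h2 : |x - clip t x - ξ| ≤ (2 + c) * (1 + |x|) := by
    have h3 := abs_sub (x - clip t x) ξ
    have h4 := abs_sub x (clip t x)
    nlinarith
  calc |x - clip t x - ξ| ^ 2 ≤ ((2 + c) * (1 + |x|)) ^ 2 := by gcongr
    _ = (2 + c) ^ 2 * (1 + |x|) ^ 2 := by ring
    _ ≤ _ := by
      gcongr
      · linarith
      · norm_num

theorem quartic_clip_sq {t : ℝ} (ht : 0 ≤ t) : QuarticBound (fun x => clip t x ^ 2) 1 := by
  refine ⟨(measurable_clip t).pow_const 2, fun x => ?_⟩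
  have h0 := abs_nonneg x
  rw [abs_of_nonneg (sq_nonneg _), ← sq_abs, one_mul]
  calc |clip t x| ^ 2 ≤ (1 + |x|) ^ 2 := by gcongr; linarith [abs_clip_le ht x]
    _ ≤ _ := by
      gcongr
      · linarith
      · norm_num

theorem quartic_bandInd (t : ℝ) : QuarticBound (bandInd t) 1 := by
  refine ⟨measurable_bandInd t, fun x => ?_⟩
  rw [abs_of_nonneg (bandInd_nonneg t x), one_mul]
  exact (bandInd_le_one t x).trans (one_le_pow₀ (by linarith [abs_nonneg x]))

theorem quartic_one : QuarticBound (fun _ => 1) 1 := by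
  refine ⟨measurable_const, fun x => ?_⟩
  rw [abs_one, one_mul]
  exact one_le_pow₀ (by linarith [abs_nonneg x])

theorem quartic_sq : QuarticBound (fun x => x ^ 2) 1 := by
  refine ⟨by fun_prop, fun x => ?_⟩
  have h0 := abs_nonneg x
  rw [abs_of_nonneg (sq_nonneg _), ← sq_abs, one_mul]
  calc |x| ^ 2 ≤ (1 + |x|) ^ 2 := by gcongr; linarith
    _ ≤ _ := by
      gcongr
      · linarith
      · norm_num

theorem quartic_const_mul_id {c ξ : ℝ} (hξ : |ξ| ≤ c) : QuarticBound (fun x => ξ * x) c := by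
  refine ⟨by fun_prop, fun x => ?_⟩
  have h0 := abs_nonneg x
  rw [abs_mul]
  refine mul_le_mul hξ ?_ h0 ((abs_nonneg _).trans hξ)
  calc |x| ≤ (1 + |x|) ^ 1 := by linarith
    _ ≤ _ := by
      gcongr
      · linarith
      · norm_num

/-- Stein's unbiased risk formula for soft thresholding. -/
theorem integral_softLoss {ξ t : ℝ} {v : ℝ≥0} (hv : v ≠ 0) (ht : 0 ≤ t) :
    ∫ x, (soft t x - ξ) ^ 2 ∂gaussianReal ξ v
      = v * (1 - 2 * ∫ x, bandInd t x ∂gaussianReal ξ v)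
        + ∫ x, clip t x ^ 2 ∂gaussianReal ξ v := by
  have h1 : Integrable (fun x => (x - ξ) ^ 2) (gaussianReal ξ v) :=
    ((memLp_id_gaussianReal (μ := ξ) (v := v) 2).sub (memLp_const ξ)).integrable_sq
  have h2 := (quartic_clip_mul ht (le_refl |ξ|)).integrable ξ v
  have h3 := (quartic_clip_sq ht).integrable ξ v
  have hvar : ∫ x, (x - ξ) ^ 2 ∂gaussianReal ξ v = v := by
    have h := variance_eq_integral (μ := gaussianReal ξ v) (X := id) measurable_id.aemeasurable
    rw [variance_id_gaussianReal] at h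
    simp only [id_eq, integral_id_gaussianReal] at h
    exact h.symm
  have heq : ∀ x, (soft t x - ξ) ^ 2
      = ((x - ξ) ^ 2 - 2 * ((x - ξ) * clip t x)) + clip t x ^ 2 := by
    intro x; rw [soft_eq ht]; ring
  simp_rw [heq]
  have h4 : Integrable (fun x => (x - ξ) ^ 2 - 2 * ((x - ξ) * clip t x)) (gaussianReal ξ v) :=
    h1.sub (h2.const_mul 2)
  rw [integral_add h4 h3, integral_sub h1 (h2.const_mul 2),
    integral_const_mul, hvar, integral_sub_mul_clip hv ht]
  ring

/-- A bound for the density of `|x|` under a normal law. -/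
noncomputable def densityBound (v : ℝ≥0) : ℝ := 2 * (√(2 * Real.pi * v))⁻¹

/-- The difference of the bands lies in two intervals of length `t - s`, and the normal density is
at most its peak value, whatever the mean. -/
theorem integral_bandInd_sub_le {ξ s t : ℝ} {v : ℝ≥0} (hv : v ≠ 0) (hst : s ≤ t) :
    ∫ x, bandInd t x ∂gaussianReal ξ v - ∫ x, bandInd s x ∂gaussianReal ξ v
      ≤ densityBound v * (t - s) := by
  rw [← integral_sub ((quartic_bandInd t).integrable ξ v) ((quartic_bandInd s).integrable ξ v),
    integral_gaussianReal_eq_integral_smul hv]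
  simp only [smul_eq_mul]
  set K := (√(2 * Real.pi * v))⁻¹ with hK
  have hK0 : 0 ≤ K := by positivity
  have hI : ∀ a b : ℝ, Integrable (Set.indicator (Set.Icc a b) fun _ => K) := fun a b =>
    (integrable_indicator_iff measurableSet_Icc).2 (integrableOn_const (by simp))
  have hval : ∀ a b : ℝ, a ≤ b → ∫ x, Set.indicator (Set.Icc a b) (fun _ => K) x = K * (b - a) := by
    intro a b hab
    rw [integral_indicator measurableSet_Icc, setIntegral_const]
    simp [hab, mul_comm]
  calc ∫ x, gaussianPDFReal ξ v x * (bandInd t x - bandInd s x)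
      ≤ ∫ x, (Set.indicator (Set.Icc s t) (fun _ => K) x
          + Set.indicator (Set.Icc (-t) (-s)) (fun _ => K) x) := by
        refine integral_mono (integrable_pdf_mul hv (((quartic_bandInd t).integrable ξ v).sub
          ((quartic_bandInd s).integrable ξ v))) ((hI _ _).add (hI _ _)) fun x => ?_
        have hpdf : gaussianPDFReal ξ v x ≤ K := by
          unfold gaussianPDFReal
          refine mul_le_of_le_one_right hK0 (Real.exp_le_one_iff.2 ?_)
          rw [neg_div]
          exact neg_nonpos.2 (by positivity)
        have hn1 : 0 ≤ Set.indicator (Set.Icc s t) (fun _ => K) x :=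
          Set.indicator_nonneg (fun _ _ => hK0) x
        have hn2 : 0 ≤ Set.indicator (Set.Icc (-t) (-s)) (fun _ => K) x :=
          Set.indicator_nonneg (fun _ _ => hK0) x
        simp only
        by_cases h1 : |x| ≤ s
        · have h2 : |x| ≤ t := h1.trans hst
          simp only [bandInd, h1, h2, if_true, sub_self, mul_zero]
          exact add_nonneg hn1 hn2
        by_cases h2 : |x| ≤ t
        · simp only [bandInd, h1, h2, if_true, if_false, sub_zero, mul_one]
          push Not at h1
          rcases le_total 0 x with hx | hx
          · rw [abs_of_nonneg hx] at h1 h2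
            rw [Set.indicator_of_mem (show x ∈ Set.Icc s t from ⟨h1.le, h2⟩)]
            linarith
          · rw [abs_of_nonpos hx] at h1 h2
            rw [Set.indicator_of_mem (show x ∈ Set.Icc (-t) (-s) from ⟨by linarith, by linarith⟩)]
            linarith
        · simp only [bandInd, h1, h2, if_false, sub_self, mul_zero]
          exact add_nonneg hn1 hn2
    _ = densityBound v * (t - s) := by
        rw [integral_add (hI _ _) (hI _ _), hval _ _ hst, hval _ _ (neg_le_neg hst), densityBound]
        ring

/-! ### Reduction to the coefficients `z = Uᵀ y` -/

section Basis

variable {p : ℕ} {n : Fin p → ℕ}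

theorem incidence_transpose_mul (n : Fin p → ℕ) :
    (incidence n)ᵀ * incidence n = Matrix.diagonal fun k => (n k : ℝ) := by
  ext k l
  rw [Matrix.mul_apply, Fintype.sum_sigma, Matrix.diagonal_apply]
  simp only [incidence, Matrix.transpose_apply, Matrix.of_apply, mul_ite, mul_one, mul_zero]
  by_cases h : k = l
  · subst h; simp
  · simp only [h, if_false]
    refine Finset.sum_eq_zero fun i _ => ?_
    split_ifs with h1 h2
    · exact absurd (h2.symm.trans h1) h
    all_goals simp

theorem invSqrtRepl_eq (n : Fin p → ℕ) :
    invSqrtRepl n = Matrix.diagonal fun k => (√(n k : ℝ))⁻¹ := by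
  simp [invSqrtRepl, incidence_transpose_mul]

variable {D : Penalty p} {U : Matrix (Obs n) (Fin p) ℝ}

/-- `R^{-1/2} R R^{-1/2} = 1` since every level is observed, and `Γ` is orthogonal. -/
theorem IsPenaltyBasis.transpose_mul_self (hn : ∀ i, 0 < n i) (hU : IsPenaltyBasis n D U) :
    Uᵀ * U = 1 := by
  obtain ⟨Γ, lam, h1, h2, -, -, -, rfl⟩ := hU
  have h3 : (invSqrtRepl n)ᵀ * ((incidence n)ᵀ * incidence n) * invSqrtRepl n = 1 := by
    rw [incidence_transpose_mul, invSqrtRepl_eq, Matrix.diagonal_transpose,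
      Matrix.diagonal_mul_diagonal, Matrix.diagonal_mul_diagonal, ← Matrix.diagonal_one]
    congr 1
    ext k
    have : (0 : ℝ) < n k := by exact_mod_cast hn k
    have h4 := Real.mul_self_sqrt this.le
    have h5 : √(n k : ℝ) ≠ 0 := (Real.sqrt_pos.2 this).ne'
    field_simp
    rw [sq, h4]
  calc (incidence n * invSqrtRepl n * Γ)ᵀ * (incidence n * invSqrtRepl n * Γ)
      = Γᵀ * ((invSqrtRepl n)ᵀ * ((incidence n)ᵀ * incidence n) * invSqrtRepl n) * Γ := by
        simp only [Matrix.transpose_mul, Matrix.mul_assoc]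
    _ = 1 := by rw [h3, Matrix.mul_one, h1]

/-- `U Uᵀ` is the projection onto the column space of the incidence matrix, which contains `η`.
Hence no part of the loss lies outside the coefficients. -/
theorem IsPenaltyBasis.mul_transpose_mul_mean (hn : ∀ i, 0 < n i) (hU : IsPenaltyBasis n D U)
    (μ : Fin p → ℝ) : U *ᵥ (Uᵀ *ᵥ mean n μ) = mean n μ := by
  obtain ⟨Γ, lam, h1, h2, -, -, -, rfl⟩ := hU
  have h3 : invSqrtRepl n * ((invSqrtRepl n)ᵀ * ((incidence n)ᵀ * incidence n)) = 1 := by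
    rw [incidence_transpose_mul, invSqrtRepl_eq, Matrix.diagonal_transpose,
      Matrix.diagonal_mul_diagonal, Matrix.diagonal_mul_diagonal, ← Matrix.diagonal_one]
    congr 1
    ext k
    have : (0 : ℝ) < n k := by exact_mod_cast hn k
    have h4 := Real.mul_self_sqrt this.le
    have h5 : √(n k : ℝ) ≠ 0 := (Real.sqrt_pos.2 this).ne'
    field_simp
    rw [sq, h4]
  rw [mean, Matrix.mulVec_mulVec, Matrix.mulVec_mulVec, Matrix.mul_assoc]
  congr 1
  calc incidence n * invSqrtRepl n * Γ * ((incidence n * invSqrtRepl n * Γ)ᵀ * incidence n)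
      = incidence n * (invSqrtRepl n * ((Γ * Γᵀ) * ((invSqrtRepl n)ᵀ *
          ((incidence n)ᵀ * incidence n)))) := by
        simp only [Matrix.transpose_mul, Matrix.mul_assoc]
    _ = incidence n := by rw [h2, Matrix.one_mul, h3, Matrix.mul_one]

/-- The normalized loss of `U diag(f) z` in terms of the coefficients. -/
theorem loss_mulVec (hn : ∀ i, 0 < n i) (hU : IsPenaltyBasis n D U) (μ : Fin p → ℝ)
    (w : Data n → Fin p → ℝ) (y : Data n) :
    loss n (fun y => U *ᵥ w y) μ y
      = (p : ℝ)⁻¹ * ∑ i, (w y i - (Uᵀ *ᵥ mean n μ) i) ^ 2 := by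
  unfold loss
  congr 1
  set ξ := Uᵀ *ᵥ mean n μ with hξ
  have h1 : ∀ o, (U *ᵥ w y) o - mean n μ o = (U *ᵥ (w y - ξ)) o := by
    intro o
    rw [Matrix.mulVec_sub, hξ, hU.mul_transpose_mul_mean hn]
    rfl
  simp only [h1]
  calc ∑ o, (U *ᵥ (w y - ξ)) o ^ 2 = (U *ᵥ (w y - ξ)) ⬝ᵥ (U *ᵥ (w y - ξ)) := by
        simp [dotProduct, sq]
    _ = (w y - ξ) ⬝ᵥ ((Uᵀ * U) *ᵥ (w y - ξ)) := by
        rw [← Matrix.mulVec_mulVec, Matrix.dotProduct_mulVec,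
          ← Matrix.mulVec_transpose, dotProduct_comm]
    _ = _ := by
        rw [hU.transpose_mul_self hn, Matrix.one_mulVec]
        simp [dotProduct, sq]

instance (μ : Fin p → ℝ) (v : ℝ≥0) : IsProbabilityMeasure (law n μ v) := by
  unfold law; infer_instance

theorem covariance_coord (μ : Fin p → ℝ) (v : ℝ≥0) (o o' : Obs n) :
    cov[fun y : Data n => y o, fun y => y o'; law n μ v] = if o = o' then (v : ℝ) else 0 := by
  have hm : ∀ o, MeasurePreserving (fun y : Data n => y o) (law n μ v)
      (gaussianReal (mean n μ o) v) := fun o => measurePreserving_eval _ o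
  have hL : ∀ o, MemLp (fun y : Data n => y o) 2 (law n μ v) := fun o =>
    (memLp_id_gaussianReal (μ := mean n μ o) (v := v) 2).comp_measurePreserving (hm o)
  split_ifs with h
  · subst h
    rw [covariance_self (hm o).aemeasurable]
    have := variance_map (μ := law n μ v) (X := id) (Y := fun y : Data n => y o)
      (by rw [(hm o).map_eq]; exact measurable_id.aemeasurable) (hm o).aemeasurable
    rw [(hm o).map_eq, variance_id_gaussianReal] at this
    exact this.symm
  · have hind : iIndepFun (fun (o : Obs n) (y : Data n) => y o) (law n μ v) :=
      iIndepFun_pi (X := fun _ => id) fun _ => aemeasurable_id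
    exact (hind.indepFun h).covariance_eq_zero (hL o) (hL o')

/-- The coefficients `z = Uᵀ y` are independent normal variables with means `ξ = Uᵀ η`. -/
theorem measurePreserving_coeff (hn : ∀ i, 0 < n i) (hU : IsPenaltyBasis n D U)
    (μ : Fin p → ℝ) (v : ℝ≥0) :
    MeasurePreserving (fun y : Data n => Uᵀ *ᵥ y) (law n μ v)
      (Measure.pi fun i => gaussianReal ((Uᵀ *ᵥ mean n μ) i) v) := by
  have hm : ∀ o, MeasurePreserving (fun y : Data n => y o) (law n μ v)
      (gaussianReal (mean n μ o) v) := fun o => measurePreserving_eval _ o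
  have hL : ∀ o, MemLp (fun y : Data n => y o) 2 (law n μ v) := fun o =>
    (memLp_id_gaussianReal (μ := mean n μ o) (v := v) 2).comp_measurePreserving (hm o)
  have hind : iIndepFun (fun (o : Obs n) (y : Data n) => y o) (law n μ v) :=
    iIndepFun_pi (X := fun _ => id) fun _ => aemeasurable_id
  -- Joint normality turns zero covariance into independence; the covariance matrix of the
  -- coefficients is `v` times `Uᵀ U = 1`.
  have hgauss : HasGaussianLaw (fun y : Data n => y) (law n μ v) :=
    hind.hasGaussianLaw fun o => by
      have : HasLaw (fun y : Data n => y o) (gaussianReal (mean n μ o) v) (law n μ v) :=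
        ⟨(hm o).aemeasurable, (hm o).map_eq⟩
      exact this.hasGaussianLaw
  let L : Data n →L[ℝ] (Fin p → ℝ) := (Matrix.mulVecLin Uᵀ).toContinuousLinearMap
  have hz : HasGaussianLaw (fun y : Data n => Uᵀ *ᵥ y) (law n μ v) :=
    hgauss.map_of_measurable L L.continuous.measurable
  have hcoord : ∀ i (y : Data n), (Uᵀ *ᵥ y) i = ∑ o, U o i * y o := fun i y => rfl
  have hcov : ∀ i j, cov[fun y : Data n => (Uᵀ *ᵥ y) i, fun y => (Uᵀ *ᵥ y) j; law n μ v]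
      = if i = j then (v : ℝ) else 0 := by
    intro i j
    simp only [hcoord]
    rw [covariance_fun_sum_fun_sum (fun o => (hL o).const_mul _) (fun o => (hL o).const_mul _)]
    simp_rw [covariance_const_mul_left, covariance_const_mul_right, covariance_coord]
    have h1 : ∀ x : Obs n, ∑ o, U x i * (U o j * if x = o then (v : ℝ) else 0)
        = v * (Uᵀ i x * U x j) := by
      intro x
      rw [Finset.sum_eq_single x]
      · simp only [if_true, Matrix.transpose_apply]; ring
      · intro o _ ho; simp [ho.symm]
      · simp
    simp_rw [h1]
    rw [← Finset.mul_sum, ← Matrix.mul_apply, hU.transpose_mul_self hn, Matrix.one_apply]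
    split_ifs <;> simp
  have hindz : iIndepFun (fun i (y : Data n) => (Uᵀ *ᵥ y) i) (law n μ v) :=
    HasGaussianLaw.iIndepFun_of_covariance_eq_zero (by exact hz)
      fun i j hij => by rw [hcov, if_neg hij]
  have hmeas : Measurable fun y : Data n => Uᵀ *ᵥ y := L.continuous.measurable
  refine ⟨hmeas, ?_⟩
  have h2 := (iIndepFun_iff_map_fun_eq_pi_map
    (fun i => ((measurable_pi_apply i).comp hmeas).aemeasurable)).1 hindz
  refine h2.trans ?_
  congr 1
  ext1 i
  have hi : HasGaussianLaw (fun y : Data n => (Uᵀ *ᵥ y) i) (law n μ v) :=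
    hz.map_of_measurable (ContinuousLinearMap.proj (R := ℝ) (φ := fun _ : Fin p => ℝ) i)
      (ContinuousLinearMap.continuous _).measurable
  refine hi.map_eq_gaussianReal.trans ?_
  congr 1
  · simp only [hcoord]
    rw [integral_finsetSum _ fun o _ => ((hL o).integrable (by norm_num)).const_mul _]
    refine Finset.sum_congr rfl fun o _ => ?_
    rw [integral_const_mul]
    congr 1
    have := integral_map (μ := law n μ v) (φ := fun y : Data n => y o) (f := fun x => x)
      (hm o).aemeasurable (by fun_prop)
    rw [(hm o).map_eq, integral_id_gaussianReal] at this
    exact this.symm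
  · have h3 := hcov i i
    rw [covariance_self hi.aemeasurable, if_pos rfl] at h3
    rw [h3, Real.toNNReal_coe]

end Basis

/-! ### Uniform laws of large numbers for the coefficients -/

/-- The law of independent normal coefficients with means `ξ` and variance `v`. -/
noncomputable def coeffLaw {p : ℕ} (ξ : Fin p → ℝ) (v : ℝ≥0) : Measure (Fin p → ℝ) :=
  Measure.pi fun i => gaussianReal (ξ i) v

instance {p : ℕ} (ξ : Fin p → ℝ) (v : ℝ≥0) : IsProbabilityMeasure (coeffLaw ξ v) := by
  unfold coeffLaw; infer_instance

/-- The sum of the components with index at least `k`. -/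
def tailSum {p : ℕ} (A : Fin p → ℝ) (k : ℕ) : ℝ :=
  ∑ i : Fin p, if (i : ℕ) < k then 0 else A i

theorem tailSum_eq {p : ℕ} (A : Fin p → ℝ) (k : ℕ) :
    tailSum A k = partialSum A p - partialSum A k := by
  rw [partialSum_of_le A le_rfl, partialSum, tailSum, ← Finset.sum_sub_distrib]
  refine Finset.sum_congr rfl fun i _ => ?_
  split_ifs <;> ring

section

variable {p : ℕ} {ξ : Fin p → ℝ} {c K : ℝ} {v : ℝ≥0}

theorem measurePreserving_coord (ξ : Fin p → ℝ) (v : ℝ≥0) (i : Fin p) :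
    MeasurePreserving (fun z : Fin p → ℝ => z i) (coeffLaw ξ v) (gaussianReal (ξ i) v) :=
  measurePreserving_eval _ i

theorem integral_coord {h : ℝ → ℝ} (hh : QuarticBound h K) (i : Fin p) :
    ∫ z, h (z i) ∂coeffLaw ξ v = ∫ x, h x ∂gaussianReal (ξ i) v := by
  rw [← (measurePreserving_coord ξ v i).map_eq,
    integral_map (measurePreserving_coord ξ v i).aemeasurable hh.meas.aestronglyMeasurable]

theorem integrable_coord {h : ℝ → ℝ} (hh : QuarticBound h K) (i : Fin p) :
    Integrable (fun z => h (z i)) (coeffLaw ξ v) :=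
  (measurePreserving_coord ξ v i).integrable_comp_of_integrable (hh.integrable _ _)

theorem exists_partialSum_centered_le (hξ : ∀ i, |ξ i| ≤ c) {h : Fin p → ℝ → ℝ}
    (hh : ∀ i, QuarticBound (h i) K) :
    ∃ Y : (Fin p → ℝ) → ℝ, SqBound (coeffLaw ξ v) Y (16 * (p * (K ^ 2 * momentBound c v))) ∧
      ∀ z k, |partialSum (fun i => h i (z i) - ∫ x, h i x ∂gaussianReal (ξ i) v) k| ≤ Y z := by
  have hmeas : ∀ i, Measurable fun x => h i x - ∫ u, h i u ∂gaussianReal (ξ i) v :=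
    fun i => (hh i).meas.sub_const _
  have hS : ∀ i, SqBound (coeffLaw ξ v)
      (fun z => h i (z i) - ∫ x, h i x ∂gaussianReal (ξ i) v) (K ^ 2 * momentBound c v) :=
    fun i => ((hh i).centered_sqBound (hξ i)).comp (measurePreserving_coord ξ v i)
  refine exists_partialSum_le (W := fun i (z : Fin p → ℝ) => h i (z i) - ∫ x, h i x ∂gaussianReal (ξ i) v)
    (fun i => (hmeas i).comp (measurable_pi_apply i)) (fun i => (hS i).memLp)
    (iIndepFun_pi (X := fun i (x : ℝ) => h i x - ∫ u, h i u ∂gaussianReal (ξ i) v)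
      fun i => (hmeas i).aemeasurable) (fun i => ?_) (fun i => (hS i).le)
  rw [integral_sub (integrable_coord (hh i) i) (integrable_const _), integral_coord (hh i) i]
  simp

/-- The constant in the bracketing bound. -/
noncomputable def bracketConst (K c : ℝ) (v : ℝ≥0) (E : ℝ) : ℝ :=
  132 * (K ^ 2 * momentBound c v) + 4 * (E + K * momentBound c v) ^ 2

/-- A class of functions with few brackets satisfies a uniform law of large numbers, for all tails
of the sample at once. -/
theorem exists_tailSum_le_of_brackets (hξ : ∀ i, |ξ i| ≤ c) (hc : 0 ≤ c) {τ : Type*}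
    (S : Set τ) {ψ : τ → Fin p → ℝ → ℝ} (hψ : ∀ t ∈ S, ∀ i, QuarticBound (ψ t i) K)
    (N : ℕ) {w : ℕ → Fin p → ℝ → ℝ} (hw : ∀ j i, QuarticBound (w j i) K)
    {M : ℝ → ℝ} (hM : QuarticBound M K) {δ E : ℝ} (hδ : 0 ≤ δ) (hE : 0 ≤ E)
    (hbr : ∀ t ∈ S, ∃ a < N, ∃ b < N, ∀ i,
      (∀ x, w a i x - δ * M x ≤ ψ t i x ∧ ψ t i x ≤ w b i x + δ * M x) ∧
      ∫ x, w b i x ∂gaussianReal (ξ i) v - ∫ x, w a i x ∂gaussianReal (ξ i) v ≤ δ * E) :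
    ∃ Y : (Fin p → ℝ) → ℝ,
      SqBound (coeffLaw ξ v) Y (bracketConst K c v E * (N * p + p ^ 2 * δ ^ 2)) ∧
      ∀ t ∈ S, ∀ z k,
        |tailSum (fun i => ψ t i (z i) - ∫ x, ψ t i x ∂gaussianReal (ξ i) v) k| ≤ Y z := by
  have hK := hM.const_nonneg
  have hC := one_le_momentBound hc v
  choose Q hQ hQle using fun j => exists_partialSum_centered_le (v := v) hξ (hw j)
  -- The factor `2` is there because a tail sum is the difference of two partial sums.
  have h1 := SqBound.sqrt_sum (Finset.range N) fun j _ => (hQ j).const_mul 2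
  -- The bracketing error is summed by Cauchy–Schwarz without cancellation, hence the order `p² δ²`.
  have h2 : SqBound (coeffLaw ξ v)
      (fun z => ∑ i, δ * (|M (z i)| + (E + K * momentBound c v)))
      (p * ∑ _i : Fin p, δ ^ 2 * (2 * (K ^ 2 * momentBound c v)
        + 2 * (E + K * momentBound c v) ^ 2)) := by
    have := SqBound.sum (P := coeffLaw ξ v) Finset.univ
      (Q := fun (i : Fin p) z => δ * (|M (z i)| + (E + K * momentBound c v)))
      (b := fun _ => δ ^ 2 * (2 * (K ^ 2 * momentBound c v)
        + 2 * (E + K * momentBound c v) ^ 2)) (fun i _ => ?_)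
    · simpa using this
    · have hMi : SqBound (coeffLaw ξ v) (fun z => |M (z i)|) (K ^ 2 * momentBound c v) := by
        have := (hM.sqBound (v := v) (hξ i)).comp (measurePreserving_coord ξ v i)
        exact ⟨this.memLp.abs, by simpa using this.le⟩
      exact (hMi.add (SqBound.const _)).const_mul δ
  refine ⟨_, (h1.add h2).mono ?_, ?_⟩
  · simp only [Finset.sum_const, Finset.card_range, Finset.card_univ, Fintype.card_fin,
      nsmul_eq_mul, bracketConst]
    have e1 : 0 ≤ (N : ℝ) * p * (4 * (K ^ 2 * momentBound c v)
        + 4 * (E + K * momentBound c v) ^ 2) := by positivity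
    have e2 : 0 ≤ (p : ℝ) ^ 2 * δ ^ 2 * (128 * (K ^ 2 * momentBound c v)) := by positivity
    linarith
  · intro t ht z k
    obtain ⟨a, ha, b, hb, hab⟩ := hbr t ht
    have hQ2 : ∀ j < N, ∀ k, |tailSum (fun i => w j i (z i)
        - ∫ x, w j i x ∂gaussianReal (ξ i) v) k|
        ≤ √(∑ j ∈ Finset.range N, (2 * Q j z) ^ 2) := by
      intro j hj k
      have h3 := hQle j z p
      have h4 := hQle j z k
      have h5 : |tailSum (fun i => w j i (z i) - ∫ x, w j i x ∂gaussianReal (ξ i) v) k|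
          ≤ 2 * Q j z := by
        rw [tailSum_eq]
        refine (abs_sub _ _).trans ?_
        linarith
      refine h5.trans (Real.le_sqrt_of_sq_le ?_)
      exact Finset.single_le_sum (f := fun j => (2 * Q j z) ^ 2) (fun _ _ => sq_nonneg _)
        (Finset.mem_range.2 hj)
    -- Passing from the mean of `ψ` to the mean of a bracket end costs the mean width `δ * E` plus
    -- `δ` times the mean of `M`.
    have hterm : ∀ i, (ψ t i (z i) - ∫ x, ψ t i x ∂gaussianReal (ξ i) v
          ≤ (w b i (z i) - ∫ x, w b i x ∂gaussianReal (ξ i) v)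
            + δ * (|M (z i)| + (E + K * momentBound c v))) ∧
        (w a i (z i) - ∫ x, w a i x ∂gaussianReal (ξ i) v)
            - δ * (|M (z i)| + (E + K * momentBound c v))
          ≤ ψ t i (z i) - ∫ x, ψ t i x ∂gaussianReal (ξ i) v := by
      intro i
      obtain ⟨hx, hE'⟩ := hab i
      have hψi := (hψ t ht i).integrable (ξ i) v
      have hMi := hM.integrable (ξ i) v
      have i1 : ∫ x, w a i x ∂gaussianReal (ξ i) v - δ * ∫ x, M x ∂gaussianReal (ξ i) v
          ≤ ∫ x, ψ t i x ∂gaussianReal (ξ i) v := by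
        rw [← integral_const_mul, ← integral_sub ((hw a i).integrable _ _) (hMi.const_mul δ)]
        exact integral_mono (((hw a i).integrable _ _).sub (hMi.const_mul δ)) hψi
          fun x => (hx x).1
      have i2 : ∫ x, ψ t i x ∂gaussianReal (ξ i) v
          ≤ ∫ x, w b i x ∂gaussianReal (ξ i) v + δ * ∫ x, M x ∂gaussianReal (ξ i) v := by
        rw [← integral_const_mul, ← integral_add ((hw b i).integrable _ _) (hMi.const_mul δ)]
        exact integral_mono hψi (((hw b i).integrable _ _).add (hMi.const_mul δ))
          fun x => (hx x).2
      have i3 : ∫ x, M x ∂gaussianReal (ξ i) v ≤ K * momentBound c v :=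
        (le_abs_self _).trans ((abs_integral_le_integral_abs).trans (hM.integral_abs_le (hξ i)))
      have i4 : M (z i) ≤ |M (z i)| := le_abs_self _
      have i5 := mul_le_mul_of_nonneg_left i3 hδ
      have i6 := mul_le_mul_of_nonneg_left i4 hδ
      have := (hx (z i)).1
      have := (hx (z i)).2
      constructor <;> linarith
    have hr : ∀ k, tailSum (fun i => δ * (|M (z i)| + (E + K * momentBound c v))) k
        ≤ ∑ i, δ * (|M (z i)| + (E + K * momentBound c v)) := by
      intro k
      refine Finset.sum_le_sum fun i _ => ?_
      split_ifs
      · positivity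
      · exact le_rfl
    have u1 : tailSum (fun i => ψ t i (z i) - ∫ x, ψ t i x ∂gaussianReal (ξ i) v) k
        ≤ tailSum (fun i => w b i (z i) - ∫ x, w b i x ∂gaussianReal (ξ i) v) k
          + tailSum (fun i => δ * (|M (z i)| + (E + K * momentBound c v))) k := by
      rw [tailSum, tailSum, tailSum, ← Finset.sum_add_distrib]
      refine Finset.sum_le_sum fun i _ => ?_
      split_ifs
      · simp
      · exact (hterm i).1
    have u2 : tailSum (fun i => w a i (z i) - ∫ x, w a i x ∂gaussianReal (ξ i) v) k
          - tailSum (fun i => δ * (|M (z i)| + (E + K * momentBound c v))) k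
        ≤ tailSum (fun i => ψ t i (z i) - ∫ x, ψ t i x ∂gaussianReal (ξ i) v) k := by
      rw [tailSum, tailSum, tailSum, ← Finset.sum_sub_distrib]
      refine Finset.sum_le_sum fun i _ => ?_
      split_ifs
      · simp
      · exact (hterm i).2
    have := hr k
    have q1 := abs_le.1 (hQ2 a ha k)
    have q2 := abs_le.1 (hQ2 b hb k)
    rw [abs_le]
    constructor <;> linarith

end

/-! ### Brackets for soft thresholding -/

/-- Thresholds up to `m` are rounded down to multiples of `1/m`, with error at most `1/m`. Larger
ones are replaced by `m`, with error `x²/m`. -/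
theorem exists_grid_clip {m : ℕ} (hm : 0 < m) {t : ℝ} (ht : 0 ≤ t) :
    ∃ j ≤ m ^ 2, ∀ x, |clip t x - clip ((j : ℝ) / m) x| ≤ (m : ℝ)⁻¹ * (1 + x ^ 2) := by
  have hm' : (0 : ℝ) < m := by exact_mod_cast hm
  rcases le_or_gt t m with h | h
  · refine ⟨⌊t * m⌋₊, ?_, fun x => (abs_clip_sub_le _ _ _).trans ?_⟩
    · apply Nat.floor_le_of_le
      push_cast
      rw [sq]
      exact mul_le_mul_of_nonneg_right h hm'.le
    · have h1 := Nat.floor_le (mul_nonneg ht hm'.le)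
      have h2 := Nat.lt_floor_add_one (t * m)
      have h3 : |t - (⌊t * m⌋₊ : ℝ) / m| ≤ (m : ℝ)⁻¹ := by
        rw [abs_of_nonneg (by rw [sub_nonneg, div_le_iff₀ hm']; exact h1), sub_le_iff_le_add,
          ← one_div, ← add_div, le_div_iff₀ hm']
        linarith
      refine h3.trans (le_mul_of_one_le_right (by positivity) ?_)
      nlinarith [sq_nonneg x]
  · refine ⟨m ^ 2, le_rfl, fun x => ?_⟩
    have h1 : ((m ^ 2 : ℕ) : ℝ) / m = m := by push_cast; field_simp
    rw [h1]
    refine (abs_clip_sub_le_div hm' h.le x).trans ?_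
    rw [div_eq_inv_mul]
    gcongr
    linarith

/-- The modulus of the discretization of thresholds. -/
noncomputable def softModulus (c x : ℝ) : ℝ := (1 + x ^ 2) * (4 * |x| + 2 * c)

theorem softModulus_nonneg {c : ℝ} (hc : 0 ≤ c) (x : ℝ) : 0 ≤ softModulus c x := by
  unfold softModulus; positivity

theorem quartic_softModulus {c : ℝ} (hc : 0 ≤ c) :
    QuarticBound (softModulus c) ((2 + c) ^ 2) := by
  refine ⟨by unfold softModulus; fun_prop, fun x => ?_⟩
  rw [abs_of_nonneg (softModulus_nonneg hc x), softModulus, ← sq_abs]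
  have h0 := abs_nonneg x
  generalize |x| = y at h0 ⊢
  have h1 : 1 + y ^ 2 ≤ (1 + y) ^ 2 := by nlinarith
  have h2 : 4 * y + 2 * c ≤ (2 + c) ^ 2 * (1 + y) ^ 2 := by
    have h3 : 1 + 2 * y ≤ (1 + y) ^ 2 := by nlinarith
    have h4 : 4 + 4 * c ≤ (2 + c) ^ 2 := by nlinarith
    calc 4 * y + 2 * c ≤ (4 + 4 * c) * (1 + 2 * y) := by nlinarith [mul_nonneg hc h0]
      _ ≤ _ := by gcongr
  calc (1 + y ^ 2) * (4 * y + 2 * c)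
      ≤ (1 + y) ^ 2 * ((2 + c) ^ 2 * (1 + y) ^ 2) := by gcongr
    _ = _ := by ring

/-- In the difference of squares, one factor is the difference of truncations and the other is at
most `4 |x| + 2 c`, since `|x - clip t x| ≤ 2 |x|`. -/
theorem softLoss_sub_le {c ξ δ t s x : ℝ} (hξ : |ξ| ≤ c) (ht : 0 ≤ t) (hs : 0 ≤ s)
    (h : |clip t x - clip s x| ≤ δ * (1 + x ^ 2)) :
    |(soft t x - ξ) ^ 2 - (soft s x - ξ) ^ 2| ≤ δ * softModulus c x := by
  rw [soft_eq ht, soft_eq hs]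
  have e : (x - clip t x - ξ) ^ 2 - (x - clip s x - ξ) ^ 2
      = (clip t x - clip s x) * -((x - clip t x) + (x - clip s x) - 2 * ξ) := by ring
  rw [e, abs_mul, abs_neg, softModulus, ← mul_assoc]
  refine mul_le_mul h ?_ (abs_nonneg _) ((abs_nonneg _).trans h)
  have h1 := abs_le.1 (abs_clip_le ht x)
  have h2 := abs_le.1 (abs_clip_le hs x)
  have h3 := abs_le.1 hξ
  have h4 := abs_le.1 (le_refl |x|)
  rw [abs_le]
  constructor <;> linarith

theorem clip_sq_sub_le {c δ t s x : ℝ} (hc : 0 ≤ c) (ht : 0 ≤ t) (hs : 0 ≤ s)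
    (h : |clip t x - clip s x| ≤ δ * (1 + x ^ 2)) :
    |clip t x ^ 2 - clip s x ^ 2| ≤ δ * softModulus c x := by
  have e : clip t x ^ 2 - clip s x ^ 2 = (clip t x - clip s x) * (clip t x + clip s x) := by ring
  rw [e, abs_mul, softModulus, ← mul_assoc]
  refine mul_le_mul h ?_ (abs_nonneg _) ((abs_nonneg _).trans h)
  have h1 := abs_le.1 (abs_clip_le ht x)
  have h2 := abs_le.1 (abs_clip_le hs x)
  have h3 := abs_nonneg x
  rw [abs_le]
  constructor <;> linarith

theorem one_le_quarticConst {c : ℝ} (hc : 0 ≤ c) : 1 ≤ (2 + c) ^ 2 := by nlinarith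

theorem QuarticBound.mono {h : ℝ → ℝ} {K K' : ℝ} (hh : QuarticBound h K) (hK : K ≤ K') :
    QuarticBound h K' :=
  ⟨hh.meas, fun x => (hh.le x).trans (by gcongr)⟩

section

variable {p m : ℕ} {ξ : Fin p → ℝ} {c : ℝ} {v : ℝ≥0}

/-- The loss is uniformly close to its value at a grid threshold, so both bracket ends are the same
function and `E = 0`. -/
theorem exists_tailSum_softLoss_le (hξ : ∀ i, |ξ i| ≤ c) (hc : 0 ≤ c) (hm : 0 < m) :
    ∃ Y : (Fin p → ℝ) → ℝ, SqBound (coeffLaw ξ v) Y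
      (bracketConst ((2 + c) ^ 2) c v 0 * ((m ^ 2 + 2 : ℕ) * p + p ^ 2 * (m : ℝ)⁻¹ ^ 2)) ∧
      ∀ t ∈ Set.Ici (0 : ℝ), ∀ z k, |tailSum (fun i => (soft t (z i) - ξ i) ^ 2
        - ∫ x, (soft t x - ξ i) ^ 2 ∂gaussianReal (ξ i) v) k| ≤ Y z := by
  refine exists_tailSum_le_of_brackets hξ hc (Set.Ici (0 : ℝ))
    (ψ := fun t i x => (soft t x - ξ i) ^ 2) (fun t ht i => quartic_softLoss ht (hξ i)) (m ^ 2 + 2)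
    (w := fun j i x => (soft ((j : ℝ) / m) x - ξ i) ^ 2)
    (fun j i => quartic_softLoss (by positivity) (hξ i)) (quartic_softModulus hc)
    (by positivity) le_rfl fun t ht => ?_
  obtain ⟨j, hj, hjx⟩ := exists_grid_clip hm ht
  refine ⟨j, by omega, j, by omega, fun i => ⟨fun x => ?_, by simp⟩⟩
  have := abs_le.1 (softLoss_sub_le (hξ i) ht (by positivity : (0 : ℝ) ≤ (j : ℝ) / m) (hjx x))
  constructor <;> linarith

theorem exists_tailSum_clip_sq_le (hξ : ∀ i, |ξ i| ≤ c) (hc : 0 ≤ c) (hm : 0 < m) :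
    ∃ Y : (Fin p → ℝ) → ℝ, SqBound (coeffLaw ξ v) Y
      (bracketConst ((2 + c) ^ 2) c v 0 * ((m ^ 2 + 2 : ℕ) * p + p ^ 2 * (m : ℝ)⁻¹ ^ 2)) ∧
      ∀ t ∈ Set.Ici (0 : ℝ), ∀ z k, |tailSum (fun i => clip t (z i) ^ 2
        - ∫ x, clip t x ^ 2 ∂gaussianReal (ξ i) v) k| ≤ Y z := by
  refine exists_tailSum_le_of_brackets hξ hc (Set.Ici (0 : ℝ))
    (ψ := fun t _ x => clip t x ^ 2)
    (fun t ht i => (quartic_clip_sq ht).mono (one_le_quarticConst hc)) (m ^ 2 + 2)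
    (w := fun j _ x => clip ((j : ℝ) / m) x ^ 2)
    (fun j i => (quartic_clip_sq (by positivity)).mono (one_le_quarticConst hc))
    (quartic_softModulus hc) (by positivity) le_rfl fun t ht => ?_
  obtain ⟨j, hj, hjx⟩ := exists_grid_clip hm ht
  refine ⟨j, by omega, j, by omega, fun i => ⟨fun x => ?_, by simp⟩⟩
  have := abs_le.1 (clip_sq_sub_le hc ht (by positivity : (0 : ℝ) ≤ (j : ℝ) / m) (hjx x))
  constructor <;> linarith

/-- Indicators jump in the threshold, so genuine brackets between neighbouring grid points are
needed. Their mean width is small by the density bound, and beyond `m` by Markov's inequality. -/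
theorem exists_tailSum_bandInd_le (hξ : ∀ i, |ξ i| ≤ c) (hc : 0 ≤ c) (hm : 0 < m)
    (hv : v ≠ 0) :
    ∃ Y : (Fin p → ℝ) → ℝ, SqBound (coeffLaw ξ v) Y
      (bracketConst ((2 + c) ^ 2) c v (densityBound v + momentBound c v) *
        ((m ^ 2 + 2 : ℕ) * p + p ^ 2 * (m : ℝ)⁻¹ ^ 2)) ∧
      ∀ t ∈ Set.Ici (0 : ℝ), ∀ z k, |tailSum (fun i => bandInd t (z i)
        - ∫ x, bandInd t x ∂gaussianReal (ξ i) v) k| ≤ Y z := by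
  have hm' : (0 : ℝ) < m := by exact_mod_cast hm
  have hD : 0 ≤ densityBound v := by unfold densityBound; positivity
  have hC := one_le_momentBound hc v
  refine exists_tailSum_le_of_brackets hξ hc (Set.Ici (0 : ℝ))
    (ψ := fun t _ x => bandInd t x)
    (fun t ht i => (quartic_bandInd t).mono (one_le_quarticConst hc)) (m ^ 2 + 2)
    -- Index `m ^ 2 + 1` stands for an infinite threshold, the upper end of the bracket for `t ≥ m`.
    (w := fun j _ x => if j ≤ m ^ 2 then bandInd ((j : ℝ) / m) x else 1)
    (fun j i => ?_) (quartic_softModulus hc) (by positivity) (by positivity) fun t ht => ?_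
  · by_cases h : j ≤ m ^ 2
    · simp only [h, if_true]; exact (quartic_bandInd _).mono (one_le_quarticConst hc)
    · simp only [h, if_false]; exact quartic_one.mono (one_le_quarticConst hc)
  have hMod : ∀ x, 0 ≤ (m : ℝ)⁻¹ * softModulus c x := fun x =>
    mul_nonneg (by positivity) (softModulus_nonneg hc x)
  have ht0 : (0 : ℝ) ≤ t := ht
  rcases lt_or_ge t m with h | h
  · have h1 := Nat.floor_le (mul_nonneg ht0 hm'.le)
    have h2 := Nat.lt_floor_add_one (t * m)
    have h3 : ⌊t * m⌋₊ < m ^ 2 := by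
      rw [Nat.floor_lt (mul_nonneg ht0 hm'.le)]
      push_cast
      rw [sq]
      exact mul_lt_mul_of_pos_right h hm'
    refine ⟨⌊t * m⌋₊, by omega, ⌊t * m⌋₊ + 1, by omega, fun i => ⟨fun x => ?_, ?_⟩⟩
    · simp only [h3.le, Nat.succ_le_of_lt h3, if_true]
      have g1 : (⌊t * m⌋₊ : ℝ) / m ≤ t := by rw [div_le_iff₀ hm']; exact h1
      have g2 : t ≤ ((⌊t * m⌋₊ + 1 : ℕ) : ℝ) / m := by
        rw [le_div_iff₀ hm']; push_cast; exact h2.le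
      have := bandInd_mono g1 x
      have := bandInd_mono g2 x
      have := hMod x
      constructor <;> linarith
    · simp only [h3.le, Nat.succ_le_of_lt h3, if_true]
      refine (integral_bandInd_sub_le hv (by gcongr; omega)).trans ?_
      rw [← sub_div]
      push_cast
      rw [add_sub_cancel_left, one_div, mul_comm]
      gcongr
      linarith
  · refine ⟨m ^ 2, by omega, m ^ 2 + 1, by omega, fun i => ⟨fun x => ?_, ?_⟩⟩
    · have e : ((m ^ 2 : ℕ) : ℝ) / m = m := by push_cast; field_simp
      simp only [le_refl, if_true, e, show ¬ (m ^ 2 + 1 ≤ m ^ 2) by omega, if_false]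
      have := bandInd_mono h x
      have := bandInd_le_one t x
      have := hMod x
      constructor <;> linarith
    · have e : ((m ^ 2 : ℕ) : ℝ) / m = m := by push_cast; field_simp
      simp only [le_refl, if_true, e, show ¬ (m ^ 2 + 1 ≤ m ^ 2) by omega, if_false]
      have hid : QuarticBound (fun x : ℝ => x) 1 := by
        simpa using quartic_const_mul_id (c := 1) (ξ := 1) (by simp)
      have i1 := hid.integral_abs_le (v := v) (hξ i)
      have i2 := hid.integrable (ξ i) v
      rw [← integral_sub (integrable_const _) ((quartic_bandInd _).integrable _ _)]
      calc ∫ x, (1 - bandInd (m : ℝ) x) ∂gaussianReal (ξ i) v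
          ≤ ∫ x, |x| / m ∂gaussianReal (ξ i) v :=
            integral_mono ((integrable_const _).sub ((quartic_bandInd _).integrable _ _))
              (i2.abs.div_const _) fun x => one_sub_bandInd_le hm' x
        _ ≤ (m : ℝ)⁻¹ * momentBound c v := by
            rw [integral_div, div_eq_inv_mul]
            gcongr
            linarith
        _ ≤ _ := by gcongr; linarith

end

/-! ### Uniform deviations of loss and estimated risk for hybrid candidates -/

section

variable {p : ℕ}

theorem partialSum_sub (A B : Fin p → ℝ) (k : ℕ) :
    partialSum (fun i => A i - B i) k = partialSum A k - partialSum B k := by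
  simp only [partialSum, ← Finset.sum_sub_distrib]
  exact Finset.sum_congr rfl fun i _ => by split_ifs <;> ring

theorem partialSum_const_mul (a : ℝ) (A : Fin p → ℝ) (k : ℕ) :
    partialSum (fun i => a * A i) k = a * partialSum A k := by
  simp only [partialSum, Finset.mul_sum]
  exact Finset.sum_congr rfl fun i _ => by split_ifs <;> ring

theorem tailSum_sub (A B : Fin p → ℝ) (k : ℕ) :
    tailSum (fun i => A i - B i) k = tailSum A k - tailSum B k := by
  simp only [tailSum, ← Finset.sum_sub_distrib]
  exact Finset.sum_congr rfl fun i _ => by split_ifs <;> ring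

theorem tailSum_const_mul (a : ℝ) (A : Fin p → ℝ) (k : ℕ) :
    tailSum (fun i => a * A i) k = a * tailSum A k := by
  simp only [tailSum, Finset.mul_sum]
  exact Finset.sum_congr rfl fun i _ => by split_ifs <;> ring

theorem mul_ave_low {k : ℕ} (hk : k ≤ p) (A : Fin p → ℝ) :
    (k : ℝ) * ave (fun i : Low p k => A i) = partialSum A k := by
  have hcard : Fintype.card (Low p k) = k := by
    rw [Fintype.card_subtype, Fin.card_filter_val_lt, min_eq_right hk]
  have hsum : ∑ i : Low p k, A i = partialSum A k := by
    rw [partialSum, ← Finset.sum_filter]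
    exact (Finset.sum_subtype _ (by simp) A).symm
  rw [ave, hcard, hsum, ← mul_assoc]
  rcases Nat.eq_zero_or_pos k with rfl | h
  · simp [partialSum]
  · rw [mul_inv_cancel₀ (by exact_mod_cast h.ne'), one_mul]

theorem card_high {k : ℕ} (hk : k ≤ p) : Fintype.card (High p k) = p - k := by
  have h1 : Fintype.card (Low p k) = k := by
    rw [Fintype.card_subtype, Fin.card_filter_val_lt, min_eq_right hk]
  have h2 := Fintype.card_subtype_compl (fun i : Fin p => (i : ℕ) < k)
  rw [h1, Fintype.card_fin] at h2
  rw [← h2]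
  exact Fintype.card_congr (Equiv.subtypeEquivRight fun i => not_lt.symm)

theorem mul_ave_high {k : ℕ} (hk : k ≤ p) (A : Fin p → ℝ) :
    ((p : ℝ) - k) * ave (fun i : High p k => A i) = tailSum A k := by
  have hsum : ∑ i : High p k, A i = tailSum A k := by
    have h1 : tailSum A k = ∑ i : Fin p, if k ≤ (i : ℕ) then A i else 0 := by
      rw [tailSum]
      refine Finset.sum_congr rfl fun i _ => ?_
      by_cases h : (i : ℕ) < k
      · simp [h]
      · simp [h, not_lt.1 h]
    rw [h1, ← Finset.sum_filter]
    exact (Finset.sum_subtype _ (by simp) A).symm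
  rw [ave, card_high hk, hsum, ← mul_assoc, Nat.cast_sub hk]
  rcases hk.eq_or_lt with rfl | h
  · have : tailSum A k = 0 := Finset.sum_eq_zero fun i _ => if_pos i.2
    rw [this]; simp
  · rw [mul_inv_cancel₀ (sub_ne_zero.2 (by exact_mod_cast h.ne')), one_mul]

/-- The weights `p₁` and `p₂` undo the normalization of the two averages. An empty block has weight
zero and contributes nothing on either side. -/
theorem estRiskHS_eq {k : ℕ} (hk : k ≤ p) (s : ℝ) (g : Fin p → ℝ) {t : ℝ} (ht : 0 ≤ t)
    (z : Fin p → ℝ) :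
    estRiskHS s k g t z = (p : ℝ)⁻¹ *
      (partialSum (fun i => g i ^ 2 * s + (1 - g i) ^ 2 * (z i ^ 2 - s)) k +
        tailSum (fun i => s * (1 - 2 * bandInd t (z i)) + clip t (z i) ^ 2) k) := by
  have h1 : (k : ℝ) * estRiskMS s (fun i : Low p k => g i) (fun i : Low p k => z i)
      = partialSum (fun i => g i ^ 2 * s + (1 - g i) ^ 2 * (z i ^ 2 - s)) k :=
    mul_ave_low hk fun i => g i ^ 2 * s + (1 - g i) ^ 2 * (z i ^ 2 - s)
  have h2 : ((p : ℝ) - k) * empCDF (fun i : High p k => z i) t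
      = tailSum (fun i => bandInd t (z i)) k := by
    rw [← mul_ave_high hk, empCDF]
    congr 2
  have h3 : ((p : ℝ) - k) * ave (fun i : High p k => min |z i| t ^ 2)
      = tailSum (fun i => clip t (z i) ^ 2) k := by
    rw [mul_ave_high hk fun i => min |z i| t ^ 2]
    simp_rw [clip_sq ht]
  have h4 : tailSum (fun _ : Fin p => (1 : ℝ)) k = (p : ℝ) - k := by
    rw [← mul_ave_high hk, ave, Finset.sum_const, Finset.card_univ, card_high hk, nsmul_eq_mul,
      Nat.cast_sub hk]
    rcases hk.eq_or_lt with rfl | h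
    · simp
    · have : (p : ℝ) - k ≠ 0 := sub_ne_zero.2 (by exact_mod_cast h.ne')
      field_simp
  have h5 : tailSum (fun i => s * (1 - 2 * bandInd t (z i)) + clip t (z i) ^ 2) k
      = s * (tailSum (fun _ : Fin p => (1 : ℝ)) k - 2 * tailSum (fun i => bandInd t (z i)) k)
        + tailSum (fun i => clip t (z i) ^ 2) k := by
    simp only [tailSum, Finset.mul_sum, mul_sub, ← Finset.sum_sub_distrib,
      ← Finset.sum_add_distrib]
    refine Finset.sum_congr rfl fun i _ => ?_
    split_ifs <;> ring
  rw [estRiskHS, h1, h5, h4, ← h2, ← h3, estRiskST]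
  ring

/-- Admissible hybrid candidates: the split point `k`, the monotone shrinkage vector `g` on the
coordinates below `k` and the threshold `t`. -/
structure IsHybrid (k : ℕ) (g : Fin p → ℝ) (t : ℝ) : Prop where
  le : k ≤ p
  mem : ∀ i : Fin p, (i : ℕ) < k → g i ∈ Set.Icc (0 : ℝ) 1
  anti : ∀ i j : Fin p, i ≤ j → (j : ℕ) < k → g j ≤ g i
  nonneg : 0 ≤ t

/-- The loss of a hybrid candidate in terms of the coefficients. -/
noncomputable def coeffLoss (ξ : Fin p → ℝ) (k : ℕ) (g : Fin p → ℝ) (t : ℝ) (z : Fin p → ℝ) : ℝ :=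
  (p : ℝ)⁻¹ * ∑ i, (hybridShrink k g t z i * z i - ξ i) ^ 2

/-- The risk of a hybrid candidate in terms of the coefficients. -/
noncomputable def coeffRisk (ξ : Fin p → ℝ) (v : ℝ≥0) (k : ℕ) (g : Fin p → ℝ) (t : ℝ) : ℝ :=
  ∫ z, coeffLoss ξ k g t z ∂coeffLaw ξ v

theorem coeffLoss_eq (ξ : Fin p → ℝ) (k : ℕ) (g : Fin p → ℝ) (t : ℝ) (z : Fin p → ℝ) :
    coeffLoss ξ k g t z = (p : ℝ)⁻¹ * (partialSum (fun i => (g i * z i - ξ i) ^ 2) k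
      + tailSum (fun i => (soft t (z i) - ξ i) ^ 2) k) := by
  rw [coeffLoss, partialSum, tailSum, ← Finset.sum_add_distrib]
  congr 1
  refine Finset.sum_congr rfl fun i _ => ?_
  unfold hybridShrink softShrink soft
  split_ifs <;> simp

variable {ξ : Fin p → ℝ} {c : ℝ} {v : ℝ≥0}

theorem quartic_linearLoss {a ξ c : ℝ} (ha : a ∈ Set.Icc (0 : ℝ) 1) (hξ : |ξ| ≤ c) :
    QuarticBound (fun x => (a * x - ξ) ^ 2) ((2 + c) ^ 2) := by
  refine ⟨by fun_prop, fun x => ?_⟩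
  have hc : 0 ≤ c := (abs_nonneg _).trans hξ
  have h0 := abs_nonneg x
  rw [abs_of_nonneg (sq_nonneg _), ← sq_abs]
  have h2 : |a * x - ξ| ≤ (2 + c) * (1 + |x|) := by
    have h3 := abs_sub (a * x) ξ
    rw [abs_mul, abs_of_nonneg ha.1] at h3
    nlinarith [mul_le_mul_of_nonneg_right ha.2 h0]
  calc |a * x - ξ| ^ 2 ≤ ((2 + c) * (1 + |x|)) ^ 2 := by gcongr
    _ = (2 + c) ^ 2 * (1 + |x|) ^ 2 := by ring
    _ ≤ _ := by
      gcongr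
      · linarith
      · norm_num

theorem coeffRisk_eq (hξ : ∀ i, |ξ i| ≤ c) {k : ℕ} {g : Fin p → ℝ} {t : ℝ}
    (h : IsHybrid k g t) :
    Integrable (coeffLoss ξ k g t) (coeffLaw ξ v) ∧
    coeffRisk ξ v k g t = (p : ℝ)⁻¹ *
      (partialSum (fun i => ∫ x, (g i * x - ξ i) ^ 2 ∂gaussianReal (ξ i) v) k
      + tailSum (fun i => ∫ x, (soft t x - ξ i) ^ 2 ∂gaussianReal (ξ i) v) k) := by
  have hint : ∀ i : Fin p, Integrable (fun z : Fin p → ℝ =>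
      (if (i : ℕ) < k then (g i * z i - ξ i) ^ 2 else 0)
        + (if (i : ℕ) < k then 0 else (soft t (z i) - ξ i) ^ 2)) (coeffLaw ξ v) := by
    intro i
    by_cases hi : (i : ℕ) < k
    · simp only [hi, if_true, add_zero]
      exact integrable_coord (quartic_linearLoss (h.mem i hi) (hξ i)) i
    · simp only [hi, if_false, zero_add]
      exact integrable_coord (quartic_softLoss h.nonneg (hξ i)) i
  have heq : ∀ z, coeffLoss ξ k g t z = (p : ℝ)⁻¹ * ∑ i : Fin p,
      ((if (i : ℕ) < k then (g i * z i - ξ i) ^ 2 else 0)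
        + (if (i : ℕ) < k then 0 else (soft t (z i) - ξ i) ^ 2)) := by
    intro z
    rw [coeffLoss_eq, partialSum, tailSum, ← Finset.sum_add_distrib]
  constructor
  · rw [funext heq]
    exact (integrable_finsetSum _ fun i _ => hint i).const_mul _
  · rw [coeffRisk, funext heq, integral_const_mul, integral_finsetSum _ fun i _ => hint i,
      partialSum, tailSum, ← Finset.sum_add_distrib]
    congr 1
    refine Finset.sum_congr rfl fun i _ => ?_
    by_cases hi : (i : ℕ) < k
    · simp only [hi, if_true, add_zero]
      exact integral_coord (quartic_linearLoss (h.mem i hi) (hξ i)) i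
    · simp only [hi, if_false, zero_add]
      exact integral_coord (quartic_softLoss h.nonneg (hξ i)) i

theorem integral_linearLoss (a ξ : ℝ) (v : ℝ≥0) :
    ∫ x, (a * x - ξ) ^ 2 ∂gaussianReal ξ v
      = a ^ 2 * ∫ x, x ^ 2 ∂gaussianReal ξ v - 2 * a * ∫ x, ξ * x ∂gaussianReal ξ v + ξ ^ 2 := by
  have h1 := (quartic_sq.integrable ξ v).const_mul (a ^ 2)
  have h2 := ((quartic_const_mul_id (le_refl |ξ|)).integrable ξ v).const_mul (2 * a)
  rw [← integral_const_mul, ← integral_const_mul, ← integral_sub h1 h2]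
  have h3 : ∀ x : ℝ, (a * x - ξ) ^ 2 = (a ^ 2 * x ^ 2 - 2 * a * (ξ * x)) + ξ ^ 2 := fun x => by
    ring
  simp_rw [h3]
  have h4 : Integrable (fun x => a ^ 2 * x ^ 2 - 2 * a * (ξ * x)) (gaussianReal ξ v) := h1.sub h2
  rw [integral_add h4 (integrable_const _)]
  simp

theorem integral_const_mul_id (ξ : ℝ) (v : ℝ≥0) : ∫ x, ξ * x ∂gaussianReal ξ v = ξ ^ 2 := by
  rw [integral_const_mul, integral_id_gaussianReal, sq]

/-- The deterministic core: given bounds on five families of centered sums at one data point `z`,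
both deviations are linear combinations of such sums with monotone weights, plus an error from
replacing `v` by `s`. One bound is used for both, so it carries terms that only one of them needs.
-/
theorem abs_sub_coeffRisk_le (hv : v ≠ 0) (hp : 0 < p) (hξ : ∀ i, |ξ i| ≤ c) {k : ℕ}
    {g : Fin p → ℝ} {t : ℝ} (h : IsHybrid k g t) {z : Fin p → ℝ} (s : ℝ) {q₁ q₂ a b d : ℝ}
    (hQ1k : ∀ k, |partialSum (fun i => z i ^ 2 - ∫ x, x ^ 2 ∂gaussianReal (ξ i) v) k| ≤ q₁)
    (hQ2k : ∀ k, |partialSum (fun i => ξ i * z i - ∫ x, ξ i * x ∂gaussianReal (ξ i) v) k| ≤ q₂)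
    (hTAk : |tailSum (fun i => (soft t (z i) - ξ i) ^ 2
      - ∫ x, (soft t x - ξ i) ^ 2 ∂gaussianReal (ξ i) v) k| ≤ a)
    (hTBk : |tailSum (fun i => clip t (z i) ^ 2
      - ∫ x, clip t x ^ 2 ∂gaussianReal (ξ i) v) k| ≤ b)
    (hTCk : |tailSum (fun i => bandInd t (z i)
      - ∫ x, bandInd t x ∂gaussianReal (ξ i) v) k| ≤ d) :
    |coeffLoss ξ k g t z - coeffRisk ξ v k g t|
        ≤ (p : ℝ)⁻¹ * (2 * q₁ + 2 * q₂ + a + (2 * v * d + b)) ∧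
      |estRiskHS s k g t z - coeffRisk ξ v k g t|
        ≤ (p : ℝ)⁻¹ * (2 * q₁ + 2 * q₂ + a + (2 * v * d + b)) + |s - v| := by
  have hp' : (0 : ℝ) < p := by exact_mod_cast hp
  have hQ10 : 0 ≤ q₁ := (abs_nonneg _).trans (hQ1k 0)
  have hQ20 : 0 ≤ q₂ := (abs_nonneg _).trans (hQ2k 0)
  have hTA0 : 0 ≤ a := (abs_nonneg _).trans hTAk
  have hTB0 : 0 ≤ b := (abs_nonneg _).trans hTBk
  have hTC0 : 0 ≤ d := (abs_nonneg _).trans hTCk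
  have hv0 : 0 ≤ (v : ℝ) := v.2
  rw [(coeffRisk_eq (v := v) hξ h).2]
  set A : Fin p → ℝ := fun i => z i ^ 2 - ∫ x, x ^ 2 ∂gaussianReal (ξ i) v with hA
  set B : Fin p → ℝ := fun i => ξ i * z i - ∫ x, ξ i * x ∂gaussianReal (ξ i) v with hB
  have hgA : |partialSum (fun i => g i ^ 2 * A i) k| ≤ q₁ :=
    abs_partialSum_mul_le (g := fun i => g i ^ 2)
      (fun i hi => ⟨sq_nonneg _, pow_le_one₀ (h.mem i hi).1 (h.mem i hi).2⟩)
      (fun i j hij hj => pow_le_pow_left₀ (h.mem j hj).1 (h.anti i j hij hj) 2) hQ1k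
  have hgB : |partialSum (fun i => g i * B i) k| ≤ q₂ :=
    abs_partialSum_mul_le h.mem h.anti hQ2k
  -- The weight `(1 - g)²` in the estimated risk is nondecreasing, so it is written as `1` minus the
  -- nonincreasing weight `1 - (1 - g)²`.
  have hgC : |partialSum (fun i => (1 - (1 - g i) ^ 2) * A i) k| ≤ q₁ := by
    refine abs_partialSum_mul_le (g := fun i => 1 - (1 - g i) ^ 2)
      (fun i hi => ⟨?_, ?_⟩) (fun i j hij hj => ?_) hQ1k
    · have := h.mem i hi
      nlinarith [this.1, this.2]
    · nlinarith [sq_nonneg (1 - g i)]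
    · have h1 := h.anti i j hij hj
      have h2 := (h.mem i ((Fin.le_def.1 hij).trans_lt hj)).2
      nlinarith
  have scale : ∀ u w b : ℝ, |u - w| ≤ b → |(p : ℝ)⁻¹ * u - (p : ℝ)⁻¹ * w| ≤ (p : ℝ)⁻¹ * b := by
    intro u w b hb
    rw [← mul_sub, abs_mul, abs_of_nonneg (by positivity)]
    gcongr
  constructor
  · rw [coeffLoss_eq]
    have e1 : (partialSum (fun i => (g i * z i - ξ i) ^ 2) k
          + tailSum (fun i => (soft t (z i) - ξ i) ^ 2) k)
        - (partialSum (fun i => ∫ x, (g i * x - ξ i) ^ 2 ∂gaussianReal (ξ i) v) k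
          + tailSum (fun i => ∫ x, (soft t x - ξ i) ^ 2 ∂gaussianReal (ξ i) v) k)
        = partialSum (fun i => g i ^ 2 * A i) k - 2 * partialSum (fun i => g i * B i) k
          + tailSum (fun i => (soft t (z i) - ξ i) ^ 2
            - ∫ x, (soft t x - ξ i) ^ 2 ∂gaussianReal (ξ i) v) k := by
      have hlow : ∀ i, (g i * z i - ξ i) ^ 2 - ∫ x, (g i * x - ξ i) ^ 2 ∂gaussianReal (ξ i) v
          = g i ^ 2 * A i - 2 * (g i * B i) := fun i => by
        rw [integral_linearLoss, hA, hB]; ring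
      rw [add_sub_add_comm, ← partialSum_sub, ← tailSum_sub, funext hlow, partialSum_sub,
        partialSum_const_mul]
    apply scale
    rw [e1]
    have := abs_le.1 hgA
    have := abs_le.1 hgB
    have := abs_le.1 hTAk
    have : 0 ≤ 2 * (v : ℝ) * d := by positivity
    rw [abs_le]
    constructor <;> linarith
  · rw [estRiskHS_eq h.le s g h.nonneg]
    have e1 : (partialSum (fun i => g i ^ 2 * s + (1 - g i) ^ 2 * (z i ^ 2 - s)) k
          + tailSum (fun i => s * (1 - 2 * bandInd t (z i)) + clip t (z i) ^ 2) k)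
        - (partialSum (fun i => ∫ x, (g i * x - ξ i) ^ 2 ∂gaussianReal (ξ i) v) k
          + tailSum (fun i => ∫ x, (soft t x - ξ i) ^ 2 ∂gaussianReal (ξ i) v) k)
        = (partialSum (fun i => (s - v) * (g i ^ 2 - (1 - g i) ^ 2)) k
            + tailSum (fun i => (s - v) * (1 - 2 * bandInd t (z i))) k)
          + (partialSum A k - partialSum (fun i => (1 - (1 - g i) ^ 2) * A i) k)
          - 2 * v * tailSum (fun i => bandInd t (z i)
            - ∫ x, bandInd t x ∂gaussianReal (ξ i) v) k
          + tailSum (fun i => clip t (z i) ^ 2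
            - ∫ x, clip t x ^ 2 ∂gaussianReal (ξ i) v) k := by
      have hlow : ∀ i, g i ^ 2 * s + (1 - g i) ^ 2 * (z i ^ 2 - s)
            - ∫ x, (g i * x - ξ i) ^ 2 ∂gaussianReal (ξ i) v
          = (s - v) * (g i ^ 2 - (1 - g i) ^ 2) - ((1 - (1 - g i) ^ 2) * A i - A i) := fun i => by
        simp only [integral_linearLoss, integral_const_mul_id, hA, integral_sq_gaussianReal]; ring
      have hhigh : ∀ i, s * (1 - 2 * bandInd t (z i)) + clip t (z i) ^ 2
            - ∫ x, (soft t x - ξ i) ^ 2 ∂gaussianReal (ξ i) v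
          = (s - v) * (1 - 2 * bandInd t (z i))
            - (2 * v * (bandInd t (z i) - ∫ x, bandInd t x ∂gaussianReal (ξ i) v)
              - (clip t (z i) ^ 2 - ∫ x, clip t x ^ 2 ∂gaussianReal (ξ i) v)) := fun i => by
        rw [integral_softLoss hv h.nonneg]; ring
      rw [add_sub_add_comm, ← partialSum_sub, ← tailSum_sub, funext hlow, funext hhigh,
        partialSum_sub, partialSum_sub, tailSum_sub, tailSum_sub, tailSum_const_mul (2 * (v : ℝ))]
      ring
    -- The coefficients `g² - (1 - g)²` and `1 - 2 * bandInd` of `s - v` both lie in `[-1, 1]`, so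
    -- the variance error enters the estimated risk at most once.
    have e2 : |partialSum (fun i => (s - v) * (g i ^ 2 - (1 - g i) ^ 2)) k
            + tailSum (fun i => (s - v) * (1 - 2 * bandInd t (z i))) k| ≤ p * |s - v| := by
      rw [partialSum, tailSum, ← Finset.sum_add_distrib]
      refine (Finset.abs_sum_le_sum_abs _ _).trans ?_
      calc _ ≤ ∑ _i : Fin p, |s - v| := by
            refine Finset.sum_le_sum fun i _ => ?_
            split_ifs with hi
            · rw [add_zero, abs_mul]
              refine mul_le_of_le_one_right (abs_nonneg _) ?_
              have := h.mem i hi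
              rw [abs_le]
              constructor <;> nlinarith [this.1, this.2]
            · rw [zero_add, abs_mul]
              refine mul_le_of_le_one_right (abs_nonneg _) ?_
              have := bandInd_nonneg t (z i)
              have := bandInd_le_one t (z i)
              rw [abs_le]
              constructor <;> linarith
        _ = p * |s - v| := by simp
    have e3 : ∀ b : ℝ, (p : ℝ)⁻¹ * b + |s - v| = (p : ℝ)⁻¹ * (b + p * |s - v|) := by
      intro b; field_simp
    rw [e3]
    apply scale
    rw [e1]
    have := abs_le.1 e2
    have := abs_le.1 (hQ1k k)
    have := abs_le.1 hgC
    have := abs_le.1 hTBk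
    have hTC2 := abs_le.1 hTCk
    have := mul_le_mul_of_nonneg_left hTC2.1 (show 0 ≤ 2 * (v : ℝ) by positivity)
    have := mul_le_mul_of_nonneg_left hTC2.2 (show 0 ≤ 2 * (v : ℝ) by positivity)
    rw [abs_le]
    constructor <;> linarith

/-- Loss and estimated risk of all hybrid candidates deviate from the risk by at most one variable
with small second moment, up to the error of the variance estimate. -/
theorem exists_uniform_bound {c : ℝ} (hc : 0 ≤ c) {v : ℝ≥0} (hv : v ≠ 0) :
    ∃ C : ℝ, 0 ≤ C ∧ ∀ (p m : ℕ) (ξ : Fin p → ℝ), 0 < p → 0 < m → (∀ i, |ξ i| ≤ c) →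
      ∃ Y : (Fin p → ℝ) → ℝ,
        SqBound (coeffLaw ξ v) Y (C * ((m : ℝ) ^ 2 / p + (m : ℝ)⁻¹ ^ 2)) ∧
        ∀ k g t, IsHybrid k g t → ∀ z s : _,
          |coeffLoss ξ k g t z - coeffRisk ξ v k g t| ≤ Y z ∧
          |estRiskHS s k g t z - coeffRisk ξ v k g t| ≤ Y z + |s - v| := by
  set q1 := 16 * (1 ^ 2 * momentBound c v) with hq1
  set q2 := 16 * (c ^ 2 * momentBound c v) with hq2
  set a1 := 3 * bracketConst ((2 + c) ^ 2) c v 0 with ha1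
  set a2 := 3 * bracketConst ((2 + c) ^ 2) c v (densityBound v + momentBound c v) with ha2
  have hC := one_le_momentBound hc v
  have hD : 0 ≤ densityBound v := by unfold densityBound; positivity
  have hq10 : 0 ≤ q1 := by positivity
  have hq20 : 0 ≤ q2 := by positivity
  have ha10 : 0 ≤ a1 := by rw [ha1]; unfold bracketConst; positivity
  have ha20 : 0 ≤ a2 := by rw [ha2]; unfold bracketConst; positivity
  -- This is the nesting of `SqBound.add` and `SqBound.const_mul` that builds `hY` below.
  refine ⟨2 * (2 * (2 * (2 ^ 2 * q1) + 2 * (2 ^ 2 * q2)) + 2 * a1)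
    + 2 * (2 * ((2 * v) ^ 2 * a2) + 2 * a1), by positivity, ?_⟩
  intro p m ξ hp hm hξ
  have hp' : (0 : ℝ) < p := by exact_mod_cast hp
  have hm' : (1 : ℝ) ≤ m := by exact_mod_cast hm
  -- A common scale for the five unnormalized second moments; the factor `p⁻²` turns it into the
  -- stated rate.
  set X : ℝ := (m : ℝ) ^ 2 * p + p ^ 2 * (m : ℝ)⁻¹ ^ 2 with hX
  have hpX : (p : ℝ) ≤ X := by
    have : (p : ℝ) ≤ (m : ℝ) ^ 2 * p := le_mul_of_one_le_left hp'.le (one_le_pow₀ hm')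
    have h2 : 0 ≤ (p : ℝ) ^ 2 * (m : ℝ)⁻¹ ^ 2 := by positivity
    linarith
  have hTX : ((m ^ 2 + 2 : ℕ) : ℝ) * p + p ^ 2 * (m : ℝ)⁻¹ ^ 2 ≤ 3 * X := by
    have h1 : (p : ℝ) ≤ (m : ℝ) ^ 2 * p := le_mul_of_one_le_left hp'.le (one_le_pow₀ hm')
    have h2 : 0 ≤ (p : ℝ) ^ 2 * (m : ℝ)⁻¹ ^ 2 := by positivity
    push_cast
    rw [hX]
    nlinarith
  obtain ⟨Q1, hQ1, hQ1le⟩ := exists_partialSum_centered_le (v := v) hξ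
    (h := fun _ x => x ^ 2) fun _ => quartic_sq
  obtain ⟨Q2, hQ2, hQ2le⟩ := exists_partialSum_centered_le (v := v) hξ
    (h := fun i x => ξ i * x) fun i => quartic_const_mul_id (hξ i)
  obtain ⟨TA, hTA, hTAle⟩ := exists_tailSum_softLoss_le (v := v) hξ hc hm
  obtain ⟨TB, hTB, hTBle⟩ := exists_tailSum_clip_sq_le (v := v) hξ hc hm
  obtain ⟨TC, hTC, hTCle⟩ := exists_tailSum_bandInd_le hξ hc hm hv
  have hQ1' := hQ1.mono (show _ ≤ q1 * X by
    rw [hq1]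
    nlinarith [mul_le_mul_of_nonneg_left hpX (show 0 ≤ 1 ^ 2 * momentBound c v by positivity)])
  have hQ2' := hQ2.mono (show _ ≤ q2 * X by
    rw [hq2]
    nlinarith [mul_le_mul_of_nonneg_left hpX (show 0 ≤ c ^ 2 * momentBound c v by positivity)])
  have hb1 : 0 ≤ bracketConst ((2 + c) ^ 2) c v 0 := by unfold bracketConst; positivity
  have hb2 : 0 ≤ bracketConst ((2 + c) ^ 2) c v (densityBound v + momentBound c v) := by
    unfold bracketConst; positivity
  have hTA' := hTA.mono (show _ ≤ a1 * X by
    rw [ha1]; nlinarith [mul_le_mul_of_nonneg_left hTX hb1])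
  have hTB' := hTB.mono (show _ ≤ a1 * X by
    rw [ha1]; nlinarith [mul_le_mul_of_nonneg_left hTX hb1])
  have hTC' := hTC.mono (show _ ≤ a2 * X by
    rw [ha2]; nlinarith [mul_le_mul_of_nonneg_left hTX hb2])
  have hY := (((((hQ1'.const_mul 2).add (hQ2'.const_mul 2)).add hTA').add
    ((hTC'.const_mul (2 * v)).add hTB'))).const_mul (p : ℝ)⁻¹
  refine ⟨_, hY.mono (le_of_eq ?_), ?_⟩
  · have hXp : (m : ℝ) ^ 2 / p + (m : ℝ)⁻¹ ^ 2 = (p : ℝ)⁻¹ ^ 2 * X := by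
      rw [hX]; field_simp
    rw [hXp]; ring
  intro k g t h z s
  exact abs_sub_coeffRisk_le hv hp hξ h s (hQ1le z) (hQ2le z) (hTAle t h.nonneg z k)
    (hTBle t h.nonneg z k) (hTCle t h.nonneg z k)

/-! ### Large thresholds -/

/-- Enlarging a threshold `t'` changes the risk by little if `t'` is large or if there are few high
coordinates. -/
theorem exists_risk_threshold_le {c : ℝ} (hc : 0 ≤ c) (v : ℝ≥0) :
    ∃ C : ℝ, 0 ≤ C ∧ ∀ (p : ℕ) (ξ : Fin p → ℝ), (∀ i, |ξ i| ≤ c) → ∀ k g t t',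
      IsHybrid k g t → 0 ≤ t' → t' ≤ t →
        coeffRisk ξ v k g t' ≤ coeffRisk ξ v k g t + (p : ℝ)⁻¹ * (((p : ℝ) - k) * C) ∧
        (0 < t' → coeffRisk ξ v k g t' ≤ coeffRisk ξ v k g t
          + (p : ℝ)⁻¹ * (((p : ℝ) - k) * (C / t'))) := by
  have hC := one_le_momentBound hc v
  refine ⟨(2 + c) ^ 2 * momentBound c v, by positivity, ?_⟩
  intro p ξ hξ k g t t' h ht' htt
  have h' : IsHybrid k g t' := ⟨h.le, h.mem, h.anti, ht'⟩
  rw [(coeffRisk_eq (v := v) hξ h).2, (coeffRisk_eq (v := v) hξ h').2]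
  have h4 : tailSum (fun _ : Fin p => (1 : ℝ)) k = (p : ℝ) - k := by
    rw [tailSum_eq, partialSum_of_le _ le_rfl, ← mul_ave_low h.le, ave, Finset.sum_const,
      Finset.card_univ, Finset.sum_const, Finset.card_univ]
    have : Fintype.card (Low p k) = k := by
      rw [Fintype.card_subtype, Fin.card_filter_val_lt, min_eq_right h.le]
    rw [this]
    rcases Nat.eq_zero_or_pos k with rfl | hk
    · simp
    · have : (k : ℝ) ≠ 0 := by exact_mod_cast hk.ne'
      simp [this]
  have key : ∀ b : ℝ, (∀ i : Fin p, ∫ x, (soft t' x - ξ i) ^ 2 ∂gaussianReal (ξ i) v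
        ≤ ∫ x, (soft t x - ξ i) ^ 2 ∂gaussianReal (ξ i) v + b) →
      tailSum (fun i => ∫ x, (soft t' x - ξ i) ^ 2 ∂gaussianReal (ξ i) v) k
        ≤ tailSum (fun i => ∫ x, (soft t x - ξ i) ^ 2 ∂gaussianReal (ξ i) v) k
          + ((p : ℝ) - k) * b := by
    intro b hb
    rw [← h4, tailSum, tailSum, tailSum, Finset.sum_mul, ← Finset.sum_add_distrib]
    refine Finset.sum_le_sum fun i _ => ?_
    split_ifs
    · simp
    · simpa using hb i
  have fin : ∀ b : ℝ, (∀ i : Fin p, ∫ x, (soft t' x - ξ i) ^ 2 ∂gaussianReal (ξ i) v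
        ≤ ∫ x, (soft t x - ξ i) ^ 2 ∂gaussianReal (ξ i) v + b) →
      (p : ℝ)⁻¹ * (partialSum (fun i => ∫ x, (g i * x - ξ i) ^ 2 ∂gaussianReal (ξ i) v) k
      + tailSum (fun i => ∫ x, (soft t' x - ξ i) ^ 2 ∂gaussianReal (ξ i) v) k)
      ≤ (p : ℝ)⁻¹ * (partialSum (fun i => ∫ x, (g i * x - ξ i) ^ 2 ∂gaussianReal (ξ i) v) k
      + tailSum (fun i => ∫ x, (soft t x - ξ i) ^ 2 ∂gaussianReal (ξ i) v) k)
        + (p : ℝ)⁻¹ * (((p : ℝ) - k) * b) := by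
    intro b hb
    rw [← mul_add]
    have := key b hb
    exact mul_le_mul_of_nonneg_left (by linarith) (by positivity)
  -- The first bound drops the risk at `t` and uses only that the risk at `t'` is bounded; the
  -- second compares losses pointwise, with truncations differing by at most `x² / t'`.
  refine ⟨fin _ fun i => ?_, fun hpos => fin _ fun i => ?_⟩
  · have h1 := (le_abs_self _).trans ((abs_integral_le_integral_abs).trans
      ((quartic_softLoss ht' (hξ i)).integral_abs_le (v := v) (hξ i)))
    have h2 : 0 ≤ ∫ x, (soft t x - ξ i) ^ 2 ∂gaussianReal (ξ i) v :=
      integral_nonneg fun _ => sq_nonneg _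
    linarith
  · have hM := quartic_softModulus hc
    have i1 := (quartic_softLoss h.nonneg (hξ i)).integrable (ξ i) v
    have i2 := (quartic_softLoss ht' (hξ i)).integrable (ξ i) v
    have h1 : ∫ x, softModulus c x ∂gaussianReal (ξ i) v ≤ (2 + c) ^ 2 * momentBound c v :=
      (le_abs_self _).trans ((abs_integral_le_integral_abs).trans (hM.integral_abs_le (hξ i)))
    calc ∫ x, (soft t' x - ξ i) ^ 2 ∂gaussianReal (ξ i) v
        ≤ ∫ x, ((soft t x - ξ i) ^ 2 + t'⁻¹ * softModulus c x) ∂gaussianReal (ξ i) v := by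
          refine integral_mono i2 (i1.add ((hM.integrable _ _).const_mul _)) fun x => ?_
          have := abs_le.1 (softLoss_sub_le (hξ i) h.nonneg ht' (δ := t'⁻¹) (x := x) (by
            refine (abs_clip_sub_le_div hpos htt x).trans ?_
            rw [div_eq_inv_mul]
            gcongr
            linarith))
          simp only
          linarith [this.1]
      _ = ∫ x, (soft t x - ξ i) ^ 2 ∂gaussianReal (ξ i) v
          + t'⁻¹ * ∫ x, softModulus c x ∂gaussianReal (ξ i) v := by
          rw [integral_add i1 ((hM.integrable _ _).const_mul _), integral_const_mul]
      _ ≤ _ := by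
          rw [div_eq_inv_mul]
          gcongr

end

/-! ### From uniform deviations to adaptation -/

theorem loss_nonneg {p : ℕ} (n : Fin p → ℕ) (est : Data n → Data n) (μ : Fin p → ℝ) (y : Data n) :
    0 ≤ loss n est μ y :=
  mul_nonneg (by positivity) (Finset.sum_nonneg fun _ _ => sq_nonneg _)

theorem risk_nonneg {p : ℕ} (n : Fin p → ℕ) (est : Data n → Data n) (μ : Fin p → ℝ) (v : ℝ≥0) :
    0 ≤ risk n est μ v := integral_nonneg fun _ => loss_nonneg _ _ _ _

theorem measurable_loss {p : ℕ} (n : Fin p → ℕ) {est : Data n → Data n} (h : Measurable est)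
    (μ : Fin p → ℝ) : Measurable (loss n est μ) := by
  unfold loss
  refine Measurable.const_mul (Finset.measurable_fun_sum _ fun o _ => ?_) _
  exact (((measurable_pi_apply o).comp h).sub_const _).pow_const 2

section Fixed

variable {p : ℕ} {n : Fin p → ℕ} {κ : Type} {K S : Set κ} {est : κ → Data n → Data n}
  {erisk : κ → Data n → ℝ} {s2 : Data n → ℝ} {μ : Fin p → ℝ} {v : ℝ≥0} {Y : Data n → ℝ}
  {b e : ℝ≥0∞}

/-- `Y` bounds, uniformly over the candidates in `K`, the deviation of the loss from the risk, and
`Y + |σ̂² - σ²|` bounds that of the estimated risk. -/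
structure Dominates (n : Fin p → ℕ) (K : Set κ) (est : κ → Data n → Data n)
    (erisk : κ → Data n → ℝ) (s2 : Data n → ℝ) (μ : Fin p → ℝ) (v : ℝ≥0) (Y : Data n → ℝ)
    (b : ℝ≥0∞) : Prop where
  aemeas : AEMeasurable Y (law n μ v)
  lintegral_le : ∫⁻ y, ‖Y y‖ₑ ∂law n μ v ≤ b
  loss_le : ∀ k ∈ K, ∀ y, |loss n (est k) μ y - risk n (est k) μ v| ≤ Y y
  erisk_le : ∀ k ∈ K, ∀ y, |erisk k y - risk n (est k) μ v| ≤ Y y + |s2 y - v|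

theorem Dominates.lintegral_loss (h : Dominates n K est erisk s2 μ v Y b) :
    ∫⁻ y, ⨆ k ∈ K, ‖loss n (est k) μ y - risk n (est k) μ v‖ₑ ∂law n μ v ≤ b := by
  refine (lintegral_mono fun y => iSup₂_le fun k hk => ?_).trans h.lintegral_le
  exact enorm_le_iff_norm_le.2 ((h.loss_le k hk y).trans (le_abs_self _))

theorem lintegral_affine_le (hY : AEMeasurable Y (law n μ v)) (hs2 : Measurable s2)
    (hb : ∫⁻ y, ‖Y y‖ₑ ∂law n μ v ≤ b) (he : ∫⁻ y, ‖s2 y - (v : ℝ)‖ₑ ∂law n μ v ≤ e)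
    (a d : ℝ≥0∞) (x : ℝ≥0∞) :
    ∫⁻ y, (x + a * ‖Y y‖ₑ + d * ‖s2 y - (v : ℝ)‖ₑ) ∂law n μ v ≤ x + a * b + d * e := by
  rw [lintegral_add_right _ (((hs2.sub_const _).enorm).const_mul d),
    lintegral_add_right' _ ((hY.enorm).const_mul a), lintegral_const_mul'' _ hY.enorm,
    lintegral_const_mul _ (hs2.sub_const _).enorm]
  simp only [lintegral_const, measure_univ, mul_one]
  gcongr

theorem enorm_le_affine {x ε a d u w : ℝ} (hε : 0 ≤ ε) (ha : 0 ≤ a) (hd : 0 ≤ d)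
    (h : |x| ≤ ε + a * u + d * |w|) :
    ‖x‖ₑ ≤ ENNReal.ofReal ε + ENNReal.ofReal a * ‖u‖ₑ + ENNReal.ofReal d * ‖w‖ₑ := by
  rw [← ofReal_norm, ← ofReal_norm u, ← ofReal_norm w,
    ← ENNReal.ofReal_mul ha, ← ENNReal.ofReal_mul hd,
    ← ENNReal.ofReal_add hε (by positivity), ← ENNReal.ofReal_add (by positivity) (by positivity)]
  apply ENNReal.ofReal_le_ofReal
  simp only [Real.norm_eq_abs]
  have := mul_le_mul_of_nonneg_left (le_abs_self u) ha
  linarith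

theorem Dominates.lintegral_erisk (h : Dominates n K est erisk s2 μ v Y b) (hs2 : Measurable s2)
    (he : ∫⁻ y, ‖s2 y - (v : ℝ)‖ₑ ∂law n μ v ≤ e) :
    ∫⁻ y, ⨆ k ∈ K, ‖erisk k y - risk n (est k) μ v‖ₑ ∂law n μ v ≤ b + e := by
  refine (lintegral_mono fun y => iSup₂_le fun k hk => ?_).trans
    ((lintegral_affine_le h.aemeas hs2 h.lintegral_le he 1 1 0).trans (by simp))
  have := enorm_le_affine (x := erisk k y - risk n (est k) μ v) (ε := 0) (a := 1) (d := 1)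
    (u := Y y) (w := s2 y - v) le_rfl zero_le_one zero_le_one
    (by simpa using h.erisk_le k hk y)
  simpa using this

variable {khat : Data n → κ} {ε : ℝ}

/-- The loss of the adaptive estimator is close to the smallest risk, and to the selected estimated
risk. -/
theorem Dominates.adaptive_pointwise (h : Dominates n K est erisk s2 μ v Y b) (hSK : S ⊆ K)
    (hk : ∀ y, khat y ∈ S ∧ ∀ k ∈ S, erisk (khat y) y ≤ erisk k y)
    (hnear : ∀ k ∈ K, ∃ k' ∈ S, risk n (est k') μ v ≤ risk n (est k) μ v + ε) (hε : 0 ≤ ε)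
    (y : Data n) :
    |loss n (fun y => est (khat y) y) μ y - ⨅ k : K, risk n (est k) μ v|
        ≤ ε + 3 * Y y + 2 * |s2 y - v| ∧
      |erisk (khat y) y - loss n (fun y => est (khat y) y) μ y|
        ≤ 0 + 2 * Y y + 1 * |s2 y - v| := by
  obtain ⟨hkS, hmin⟩ := hk y
  have hkK := hSK hkS
  have hl : loss n (fun y => est (khat y) y) μ y = loss n (est (khat y)) μ y := rfl
  have h1 := abs_le.1 (h.loss_le _ hkK y)
  have h2 := abs_le.1 (h.erisk_le _ hkK y)
  have hY0 : 0 ≤ Y y := (abs_nonneg _).trans (h.loss_le _ hkK y)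
  have hs0 := abs_nonneg (s2 y - v)
  have hbdd : BddBelow (Set.range fun k : K => risk n (est k) μ v) :=
    ⟨0, by rintro _ ⟨k, rfl⟩; exact risk_nonneg _ _ _ _⟩
  have hI1 : ⨅ k : K, risk n (est k) μ v ≤ risk n (est (khat y)) μ v := ciInf_le hbdd ⟨_, hkK⟩
  have : Nonempty K := ⟨⟨_, hkK⟩⟩
  -- Chain: selected loss, its risk, its estimated risk, the estimated risk of `k'`, the risk of
  -- `k'`, the risk of `k`. Three links cost `Y`, two of these also cost the variance error, and the
  -- last costs `ε`.
  have hI2 : loss n (est (khat y)) μ y - (ε + 3 * Y y + 2 * |s2 y - v|)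
      ≤ ⨅ k : K, risk n (est k) μ v := by
    refine le_ciInf fun k => ?_
    obtain ⟨k', hk'S, hk'⟩ := hnear k k.2
    have h3 := abs_le.1 (h.erisk_le _ (hSK hk'S) y)
    have h4 := hmin k' hk'S
    linarith
  rw [hl, abs_le, abs_le]
  refine ⟨⟨?_, ?_⟩, ?_, ?_⟩ <;> linarith

theorem Dominates.adaptive (h : Dominates n K est erisk s2 μ v Y b) (hSK : S ⊆ K)
    (hs2 : Measurable s2) (he : ∫⁻ y, ‖s2 y - (v : ℝ)‖ₑ ∂law n μ v ≤ e)
    (hk : IsAdaptive S est erisk khat)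
    (hnear : ∀ k ∈ K, ∃ k' ∈ S, risk n (est k') μ v ≤ risk n (est k) μ v + ε) (hε : 0 ≤ ε) :
    ‖risk n (fun y => est (khat y) y) μ v - ⨅ k : K, risk n (est k) μ v‖ₑ
        ≤ 10 * (ENNReal.ofReal ε + b + e) ∧
      ∫⁻ y, ‖erisk (khat y) y - loss n (fun y => est (khat y) y) μ y‖ₑ ∂law n μ v
        ≤ 10 * (ENNReal.ofReal ε + b + e) ∧
      ∫⁻ y, ‖erisk (khat y) y - risk n (fun y => est (khat y) y) μ v‖ₑ ∂law n μ v
        ≤ 10 * (ENNReal.ofReal ε + b + e) := by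
  set I := ⨅ k : K, risk n (est k) μ v with hI
  set L := loss n (fun y => est (khat y) y) μ with hL
  set A := ENNReal.ofReal ε + ENNReal.ofReal 3 * b + ENNReal.ofReal 2 * e with hA
  set B := ENNReal.ofReal 2 * b + ENNReal.ofReal 1 * e with hB
  have hpt := h.adaptive_pointwise hSK hk.1 hnear hε
  have hpt1 := fun y => enorm_le_affine hε (by norm_num) (by norm_num) (hpt y).1
  have hpt2 := fun y => enorm_le_affine le_rfl (by norm_num) (by norm_num) (hpt y).2
  have hLI : ∫⁻ y, ‖L y - I‖ₑ ∂law n μ v ≤ A :=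
    (lintegral_mono hpt1).trans (lintegral_affine_le h.aemeas hs2 h.lintegral_le he _ _ _)
  have hEL : ∫⁻ y, ‖erisk (khat y) y - L y‖ₑ ∂law n μ v ≤ B :=
    (lintegral_mono hpt2).trans
      ((lintegral_affine_le h.aemeas hs2 h.lintegral_le he _ _ _).trans (by simp [hB]))
  have e3 : ENNReal.ofReal 3 = 3 := by simp
  have e2 : ENNReal.ofReal 2 = 2 := by simp
  have hA10 : A ≤ 3 * (ENNReal.ofReal ε + b + e) := by
    rw [hA, e3, e2, mul_add, mul_add]
    gcongr
    · exact le_mul_of_one_le_left' (by norm_num)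
    · norm_num
  have hB10 : B ≤ 3 * (ENNReal.ofReal ε + b + e) := by
    rw [hB, e2, ENNReal.ofReal_one, mul_add, mul_add, add_assoc]
    refine le_trans ?_ le_add_self
    gcongr <;> norm_num
  have hmL : Measurable L := measurable_loss n hk.2 μ
  have hR : ‖risk n (fun y => est (khat y) y) μ v - I‖ₑ ≤ A := by
    -- A finite bound makes the selected loss integrable, so that its Bochner integral is the true
    -- expectation; an infinite bound has nothing to show.
    by_cases hfin : A = ∞
    · rw [hfin]; exact le_top
    have hint : Integrable (fun y => L y - I) (law n μ v) :=
      ⟨(hmL.sub_const I).aestronglyMeasurable, hLI.trans_lt (lt_top_iff_ne_top.2 hfin)⟩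
    have hintL : Integrable L (law n μ v) := 
      (hint.add (integrable_const I)).congr (ae_of_all _ fun y => by simp)
    have heq : risk n (fun y => est (khat y) y) μ v - I = ∫ y, (L y - I) ∂law n μ v := by
      rw [integral_sub hintL (integrable_const I)]
      simp [risk, hL]
    rw [heq]
    exact (enorm_integral_le_lintegral_enorm _).trans hLI
  refine ⟨hR.trans (hA10.trans (by gcongr; norm_num)), hEL.trans (hB10.trans (by gcongr; norm_num)),
    ?_⟩
  have hfinal : ∀ y, ‖erisk (khat y) y - risk n (fun y => est (khat y) y) μ v‖ₑ
      ≤ (ENNReal.ofReal ε + A) + 5 * ‖Y y‖ₑ + 3 * ‖s2 y - (v : ℝ)‖ₑ := by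
    intro y
    -- The estimated risk is compared with the risk through the selected loss `L` and the oracle
    -- value `I`.
    have hsplit : erisk (khat y) y - risk n (fun y => est (khat y) y) μ v
        = (erisk (khat y) y - L y) + ((L y - I) - (risk n (fun y => est (khat y) y) μ v - I)) := by
      ring
    rw [hsplit]
    refine (enorm_add_le _ _).trans ((add_le_add (hpt2 y)
      ((enorm_sub_le).trans (add_le_add (hpt1 y) hR))).trans (le_of_eq ?_))
    rw [e2, e3, ENNReal.ofReal_zero, ENNReal.ofReal_one]
    ring
  refine (lintegral_mono hfinal).trans
    ((lintegral_affine_le h.aemeas hs2 h.lintegral_le he _ _ _).trans ?_)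
  calc ENNReal.ofReal ε + A + 5 * b + 3 * e
      ≤ ENNReal.ofReal ε + 3 * (ENNReal.ofReal ε + b + e) + 5 * b + 3 * e := by gcongr
    _ = 4 * ENNReal.ofReal ε + 8 * b + 6 * e := by ring
    _ ≤ 10 * ENNReal.ofReal ε + 10 * b + 10 * e := by gcongr <;> norm_num
    _ = _ := by ring

end Fixed

theorem tendsto_zero_of_eventually_le {f b e : ℕ → ℝ≥0∞} (hb : Tendsto b atTop (𝓝 0))
    (he : Tendsto e atTop (𝓝 0))
    (h : ∀ ε : ℝ, 0 < ε → ∀ᶠ p in atTop, f p ≤ 10 * (ENNReal.ofReal ε + b p + e p)) :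
    Tendsto f atTop (𝓝 0) := by
  rw [ENNReal.tendsto_nhds_zero]
  intro δ hδ
  rcases eq_or_ne δ ∞ with rfl | hδt
  · exact Eventually.of_forall fun _ => le_top
  have hδ' : 0 < δ.toReal := ENNReal.toReal_pos hδ.ne' hδt
  set ε := δ.toReal / 30 with hε
  have hε0 : 0 < ε := by positivity
  have hpos : 0 < ENNReal.ofReal ε := ENNReal.ofReal_pos.2 hε0
  filter_upwards [h ε hε0, ENNReal.tendsto_nhds_zero.1 hb _ hpos,
    ENNReal.tendsto_nhds_zero.1 he _ hpos] with p h1 h2 h3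
  calc f p ≤ 10 * (ENNReal.ofReal ε + ENNReal.ofReal ε + ENNReal.ofReal ε) := by
        refine h1.trans ?_
        gcongr
    _ = δ := by
        rw [← ENNReal.ofReal_add hε0.le hε0.le, ← ENNReal.ofReal_add (by positivity) hε0.le,
          show (10 : ℝ≥0∞) = ENNReal.ofReal 10 by simp, ← ENNReal.ofReal_mul (by norm_num), hε]
        rw [show 10 * (δ.toReal / 30 + δ.toReal / 30 + δ.toReal / 30) = δ.toReal by ring,
          ENNReal.ofReal_toReal hδt]

theorem adaptationWorks_of_dominates {n : ∀ p : ℕ, Fin p → ℕ}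
    {Θ : ℝ → ∀ p : ℕ, Set (Fin p → ℝ)} {κ : ℕ → Type} {K S : ∀ p, Set (κ p)}
    {est : ∀ p, κ p → Data (n p) → Data (n p)} {erisk : ∀ p, κ p → Data (n p) → ℝ}
    {s2 : ∀ p, Data (n p) → ℝ} (hs2 : ∀ p, Measurable (s2 p)) (hSK : ∀ p, S p ⊆ K p)
    (h : ∀ c : ℝ, 0 < c → ∀ v : ℝ≥0, 0 < v → ∃ b e : ℕ → ℝ≥0∞,
      Tendsto b atTop (𝓝 0) ∧ Tendsto e atTop (𝓝 0) ∧
      (∀ p, (K p).Nonempty → varError (n p) (Θ c p) (s2 p) v ≤ e p) ∧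
      (∀ᶠ p in atTop, ∀ μ ∈ Θ c p, ∃ Y, Dominates (n p) (K p) (est p) (erisk p) (s2 p) μ v Y (b p)) ∧
      ∀ ε : ℝ, 0 < ε → ∀ᶠ p in atTop, ∀ μ ∈ Θ c p, ∀ k ∈ K p, ∃ k' ∈ S p,
        risk (n p) (est p k') μ v ≤ risk (n p) (est p k) μ v + ε) :
    AdaptationWorks n Θ K S est erisk := by
  constructor
  · intro c hc v hv
    obtain ⟨b, e, hb, he, hvar, hdom, -⟩ := h c hc v hv
    constructor
    · refine tendsto_of_tendsto_of_tendsto_of_le_of_le' tendsto_const_nhds hb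
        (Eventually.of_forall fun _ => zero_le) ?_
      filter_upwards [hdom] with p hp
      refine iSup₂_le fun μ hμ => ?_
      obtain ⟨Y, hY⟩ := hp μ hμ
      exact hY.lintegral_loss
    · have hbe : Tendsto (fun p => b p + e p) atTop (𝓝 0) := by simpa using hb.add he
      refine tendsto_of_tendsto_of_tendsto_of_le_of_le' tendsto_const_nhds hbe
        (Eventually.of_forall fun _ => zero_le) ?_
      filter_upwards [hdom] with p hp
      refine iSup₂_le fun μ hμ => ?_
      obtain ⟨Y, hY⟩ := hp μ hμ
      -- With no penalty matrices the weighted variance condition bounds nothing, but then there is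
      -- no candidate and the supremum is zero.
      rcases (K p).eq_empty_or_nonempty with hK | hK
      · simp [hK]
      · exact hY.lintegral_erisk (hs2 p)
          ((le_iSup₂ (f := fun μ _ => ∫⁻ y, ‖s2 p y - (v : ℝ)‖ₑ ∂law (n p) μ v) μ hμ).trans
            (hvar p hK))
  · intro khat hkhat c hc v hv
    obtain ⟨b, e, hb, he, hvar, hdom, hnear⟩ := h c hc v hv
    have hK : ∀ p, (K p).Nonempty := fun p => ⟨_, hSK p ((hkhat p).1 0).1⟩
    have key : ∀ ε : ℝ, 0 < ε → ∀ᶠ p in atTop, ∀ μ ∈ Θ c p, _ := fun ε hε => by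
      filter_upwards [hdom, hnear ε hε] with p hp hnp
      intro μ hμ
      obtain ⟨Y, hY⟩ := hp μ hμ
      exact hY.adaptive (hSK p) (hs2 p)
        ((le_iSup₂ (f := fun μ _ => ∫⁻ y, ‖s2 p y - (v : ℝ)‖ₑ ∂law (n p) μ v) μ hμ).trans
          (hvar p (hK p))) (hkhat p) (hnp μ hμ) hε.le
    refine ⟨tendsto_zero_of_eventually_le hb he fun ε hε => ?_,
      tendsto_zero_of_eventually_le hb he fun ε hε => ?_,
      tendsto_zero_of_eventually_le hb he fun ε hε => ?_⟩ <;>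
    filter_upwards [key ε hε] with p hp
    · exact iSup₂_le fun μ hμ => (hp μ hμ).1
    · exact iSup₂_le fun μ hμ => (hp μ hμ).2.1
    · exact iSup₂_le fun μ hμ => (hp μ hμ).2.2

/-! ### Adaptation over hybrid candidates -/

/-- The description of a candidate by a penalty matrix, a split point, a shrinkage vector for the
low coordinates and a threshold for the high ones. -/
structure HybridCode (p : ℕ) : Type where
  /-- penalty matrix -/
  D : Penalty p
  /-- split point -/
  k : ℕ
  /-- shrinkage vector -/
  g : Fin p → ℝ
  /-- threshold -/
  t : ℝ

section

variable {p : ℕ} {n : Fin p → ℕ}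

theorem loss_hybrid (hn : ∀ i, 0 < n i) {D : Penalty p} {U : Matrix (Obs n) (Fin p) ℝ}
    (hU : IsPenaltyBasis n D U) (μ : Fin p → ℝ) (k : ℕ) (g : Fin p → ℝ) (t : ℝ) (y : Data n) :
    loss n (fun y => shrink U (hybridShrink k g t (Uᵀ *ᵥ y)) y) μ y
      = coeffLoss (Uᵀ *ᵥ mean n μ) k g t (Uᵀ *ᵥ y) :=
  loss_mulVec hn hU μ (fun y => hybridShrink k g t (Uᵀ *ᵥ y) * (Uᵀ *ᵥ y)) y

theorem risk_hybrid (hn : ∀ i, 0 < n i) {D : Penalty p} {U : Matrix (Obs n) (Fin p) ℝ}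
    (hU : IsPenaltyBasis n D U) {c : ℝ} (μ : Fin p → ℝ) (hμ : ∀ i, |(Uᵀ *ᵥ mean n μ) i| ≤ c)
    (v : ℝ≥0) {k : ℕ} {g : Fin p → ℝ} {t : ℝ} (h : IsHybrid k g t) :
    risk n (fun y => shrink U (hybridShrink k g t (Uᵀ *ᵥ y)) y) μ v
      = coeffRisk (Uᵀ *ᵥ mean n μ) v k g t := by
  have hmp := measurePreserving_coeff hn hU μ v
  have hint := (coeffRisk_eq (v := v) hμ h).1
  rw [coeffRisk]
  unfold coeffLaw at hint ⊢
  rw [← hmp.map_eq, integral_map hmp.aemeasurable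
    (by rw [hmp.map_eq]; exact hint.aestronglyMeasurable), risk]
  simp_rw [loss_hybrid hn hU]

end

/-- The choice `m = ⌈p^(1/4)⌉` balances the cost `m²/p` of the grid against the discretization error
`1/m²`. -/
theorem exists_grid_rate {p : ℕ} (hp : 0 < p) :
    ∃ m : ℕ, 0 < m ∧ (m : ℝ) ^ 2 / p + (m : ℝ)⁻¹ ^ 2 ≤ 5 * (p : ℝ) ^ (-(1 / 2) : ℝ) := by
  have hp1 : (1 : ℝ) ≤ p := by exact_mod_cast hp
  have hp0 : (0 : ℝ) < p := by linarith
  set s := √(p : ℝ) with hs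
  have hs1 : 1 ≤ s := Real.one_le_sqrt.2 hp1
  have hss : s ^ 2 = p := Real.sq_sqrt hp0.le
  set r := √s with hr
  have hr1 : 1 ≤ r := Real.one_le_sqrt.2 hs1
  have hrr : r ^ 2 = s := Real.sq_sqrt (by linarith)
  have hpow : (p : ℝ) ^ (-(1 / 2) : ℝ) = s⁻¹ := by
    rw [Real.rpow_neg hp0.le, hs, Real.sqrt_eq_rpow]
  have hm1 : r ≤ ⌈r⌉₊ := Nat.le_ceil r
  have hm2 : (⌈r⌉₊ : ℝ) ≤ 2 * r := by
    have := Nat.ceil_lt_add_one (show 0 ≤ r by linarith)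
    linarith
  have hm0 : 0 < ⌈r⌉₊ := Nat.ceil_pos.2 (by linarith)
  refine ⟨⌈r⌉₊, hm0, ?_⟩
  rw [hpow]
  have h1 : (⌈r⌉₊ : ℝ) ^ 2 / p ≤ 4 * s⁻¹ := by
    rw [div_le_iff₀ hp0, ← hss]
    have : 4 * s⁻¹ * s ^ 2 = (2 * r) ^ 2 := by
      rw [mul_pow, hrr]; field_simp; norm_num
    rw [this]
    gcongr
  have h2 : ((⌈r⌉₊ : ℝ)⁻¹) ^ 2 ≤ s⁻¹ := by
    rw [inv_pow, ← hrr]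
    gcongr
  linarith

/-- For one basis a single variable covers all split points, so the union is only over `𝒟`. The
constant `C` depends on `c` and `v` alone, which gives uniformity over the parameter set. -/
theorem exists_dominates {c : ℝ} (hc : 0 ≤ c) {v : ℝ≥0} (hv : v ≠ 0) :
    ∃ C : ℝ, 0 ≤ C ∧ ∀ (p : ℕ) (_ : 0 < p) (n : Fin p → ℕ) (_ : ∀ i, 0 < n i)
      (U : Penalty p → Matrix (Obs n) (Fin p) ℝ) (_ : ∀ D, IsPenaltyBasis n D (U D))
      (s2 : Data n → ℝ) (𝒟 : Finset (Penalty p)) (κ : Type) (K : Set κ) (code : κ → HybridCode p)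
      (est : κ → Data n → Data n) (erisk : κ → Data n → ℝ)
      (_ : ∀ k ∈ K, (code k).D ∈ 𝒟 ∧ IsHybrid (code k).k (code k).g (code k).t)
      (_ : ∀ k ∈ K, est k = fun y => shrink (U (code k).D)
        (hybridShrink (code k).k (code k).g (code k).t ((U (code k).D)ᵀ *ᵥ y)) y)
      (_ : ∀ k ∈ K, ∀ y, erisk k y
        = estRiskHS (s2 y) (code k).k (code k).g (code k).t ((U (code k).D)ᵀ *ᵥ y)),
      ∀ μ ∈ paramSet n U 𝒟 c, ∃ Y, Dominates n K est erisk s2 μ v Y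
        (ENNReal.ofReal √(C * ((𝒟.card : ℝ) * (p : ℝ) ^ (-(1 / 2) : ℝ)))) := by
  obtain ⟨C, hC, hbound⟩ := exists_uniform_bound hc hv
  refine ⟨5 * C, by positivity, ?_⟩
  intro p hp n hn U hU s2 𝒟 κ K code est erisk hcode hest herisk μ hμ
  obtain ⟨m, hm, hrate⟩ := exists_grid_rate hp
  have hξ : ∀ D ∈ 𝒟, ∀ i, |((U D)ᵀ *ᵥ mean n μ) i| ≤ c := fun D hD i =>
    (norm_le_pi_norm ((U D)ᵀ *ᵥ mean n μ) i).trans (hμ D hD)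
  have hY : ∀ D : Penalty p, ∃ Y : Data n → ℝ, D ∈ 𝒟 →
      SqBound (law n μ v) Y (C * ((m : ℝ) ^ 2 / p + (m : ℝ)⁻¹ ^ 2)) ∧
      ∀ k g t, IsHybrid k g t → ∀ y s : _,
        |coeffLoss ((U D)ᵀ *ᵥ mean n μ) k g t ((U D)ᵀ *ᵥ y)
          - coeffRisk ((U D)ᵀ *ᵥ mean n μ) v k g t| ≤ Y y ∧
        |estRiskHS s k g t ((U D)ᵀ *ᵥ y)
          - coeffRisk ((U D)ᵀ *ᵥ mean n μ) v k g t| ≤ Y y + |s - v| := by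
    intro D
    by_cases hD : D ∈ 𝒟
    · obtain ⟨Y, hY1, hY2⟩ := hbound p m _ hp hm (hξ D hD)
      exact ⟨fun y => Y ((U D)ᵀ *ᵥ y), fun _ => ⟨hY1.comp (measurePreserving_coeff hn (hU D) μ v),
        fun k g t h y s => hY2 k g t h _ s⟩⟩
    · exact ⟨fun _ => 0, fun h => absurd h hD⟩
  -- The domination holds only for `D ∈ 𝒟`; other matrices get the value `0`, so that `Y` is a total
  -- function of `D`.
  choose Y hY using hY
  have hsum := SqBound.sqrt_sum 𝒟 fun D hD => (hY D hD).1
  have hsum' := hsum.mono (show _ ≤ 5 * C * ((𝒟.card : ℝ) * (p : ℝ) ^ (-(1 / 2) : ℝ)) by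
    rw [Finset.sum_const, nsmul_eq_mul]
    calc (𝒟.card : ℝ) * (C * ((m : ℝ) ^ 2 / p + (m : ℝ)⁻¹ ^ 2))
        ≤ (𝒟.card : ℝ) * (C * (5 * (p : ℝ) ^ (-(1 / 2) : ℝ))) := by gcongr
      _ = _ := by ring)
  have hle : ∀ D ∈ 𝒟, ∀ y, Y D y ≤ √(∑ D ∈ 𝒟, Y D y ^ 2) := fun D hD y =>
    Real.le_sqrt_of_sq_le
      (Finset.single_le_sum (f := fun D => Y D y ^ 2) (fun _ _ => sq_nonneg _) hD)
  refine ⟨_, hsum'.memLp.aestronglyMeasurable.aemeasurable, hsum'.lintegral_le, ?_, ?_⟩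
  · intro k hk y
    obtain ⟨hD, hh⟩ := hcode k hk
    rw [hest k hk, loss_hybrid hn (hU _), risk_hybrid hn (hU _) μ (hξ _ hD) v hh]
    exact ((hY _ hD).2 _ _ _ hh y 0).1.trans (hle _ hD y)
  · intro k hk y
    obtain ⟨hD, hh⟩ := hcode k hk
    rw [hest k hk, herisk k hk, risk_hybrid hn (hU _) μ (hξ _ hD) v hh]
    exact ((hY _ hD).2 _ _ _ hh y (s2 y)).2.trans (by gcongr; exact hle _ hD y)

/-- A class of candidates enters only through its hybrid description. What is left to check is the
growth of `#𝒟`, the variance error, and that the search set nearly attains the risks of the full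
class. -/
theorem adaptationWorks_of_code {n : ∀ p : ℕ, Fin p → ℕ} (hn : ∀ p i, 0 < n p i)
    {U : ∀ p, Penalty p → Matrix (Obs (n p)) (Fin p) ℝ}
    (hU : ∀ p D, IsPenaltyBasis (n p) D (U p D))
    {s2 : ∀ p, Data (n p) → ℝ} (hs2 : ∀ p, Measurable (s2 p))
    {𝒟 : ∀ p, Finset (Penalty p)} {κ : ℕ → Type} {K S : ∀ p, Set (κ p)}
    {est : ∀ p, κ p → Data (n p) → Data (n p)} {erisk : ∀ p, κ p → Data (n p) → ℝ}
    (code : ∀ p, κ p → HybridCode p) (hSK : ∀ p, S p ⊆ K p)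
    (hcode : ∀ p, ∀ k ∈ K p, (code p k).D ∈ 𝒟 p ∧
      IsHybrid (code p k).k (code p k).g (code p k).t)
    (hest : ∀ p, ∀ k ∈ K p, est p k = fun y => shrink (U p (code p k).D)
      (hybridShrink (code p k).k (code p k).g (code p k).t ((U p (code p k).D)ᵀ *ᵥ y)) y)
    (herisk : ∀ p, 0 < p → ∀ k ∈ K p, ∀ y, erisk p k y
      = estRiskHS (s2 p y) (code p k).k (code p k).g (code p k).t ((U p (code p k).D)ᵀ *ᵥ y))
    (hcard : Tendsto (fun p : ℕ => ((𝒟 p).card : ℝ) * (p : ℝ) ^ (-(1 / 2) : ℝ)) atTop (𝓝 0))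
    (hvar : ∀ c : ℝ, 0 < c → ∀ v : ℝ≥0, 0 < v → ∃ e : ℕ → ℝ≥0∞, Tendsto e atTop (𝓝 0) ∧
      ∀ p, (K p).Nonempty → varError (n p) (paramSet (n p) (U p) (𝒟 p) c) (s2 p) v ≤ e p)
    (hnear : ∀ c : ℝ, 0 ≤ c → ∀ v : ℝ≥0, ∀ ε : ℝ, 0 < ε → ∀ᶠ p in atTop, ∀ k ∈ K p, ∃ k' ∈ S p,
      (code p k').D = (code p k).D ∧ ∀ ξ : Fin p → ℝ, (∀ i, |ξ i| ≤ c) →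
        coeffRisk ξ v (code p k').k (code p k').g (code p k').t
          ≤ coeffRisk ξ v (code p k).k (code p k).g (code p k).t + ε) :
    AdaptationWorks n (fun c p => paramSet (n p) (U p) (𝒟 p) c) K S est erisk := by
  refine adaptationWorks_of_dominates hs2 hSK fun c hc v hv => ?_
  obtain ⟨e, he, hvar⟩ := hvar c hc v hv
  obtain ⟨C, hC, hdom⟩ := exists_dominates hc.le hv.ne'
  refine ⟨fun p => ENNReal.ofReal √(C * (((𝒟 p).card : ℝ) * (p : ℝ) ^ (-(1 / 2) : ℝ))), e, ?_, he,
    hvar, ?_, fun ε hε => ?_⟩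
  · have h1 := ((hcard.const_mul C).sqrt)
    simpa [Function.comp_def] using (ENNReal.continuous_ofReal.tendsto _).comp h1
  · filter_upwards [eventually_gt_atTop 0] with p hp μ hμ
    exact hdom p hp (n p) (hn p) (U p) (hU p) (s2 p) (𝒟 p) (κ p) (K p) (code p) (est p) (erisk p)
      (hcode p) (hest p) (herisk p hp) μ hμ
  · filter_upwards [hnear c hc.le v ε hε] with p hp μ hμ k hk
    obtain ⟨k', hk', hD, hle⟩ := hp k hk
    refine ⟨k', hk', ?_⟩
    obtain ⟨hkD, hh⟩ := hcode p k hk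
    obtain ⟨-, hh'⟩ := hcode p k' (hSK p hk')
    have hξ : ∀ i, |((U p (code p k).D)ᵀ *ᵥ mean (n p) μ) i| ≤ c := fun i =>
      (norm_le_pi_norm ((U p (code p k).D)ᵀ *ᵥ mean (n p) μ) i).trans (hμ _ hkD)
    rw [hest p k hk, hest p k' (hSK p hk'), hD, risk_hybrid (hn p) (hU p _) μ hξ v hh,
      risk_hybrid (hn p) (hU p _) μ hξ v hh']
    exact hle _ hξ

/-! ### Restricted thresholds -/

theorem tendsto_sqrt_two_mul_log : Tendsto (fun k : ℕ => √(2 * Real.log k)) atTop atTop :=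
  Real.tendsto_sqrt_atTop.comp (Tendsto.const_mul_atTop (by norm_num)
    (Real.tendsto_log_atTop.comp tendsto_natCast_atTop_atTop))

theorem exists_threshold_near {T : ℕ → Set ℝ} (hT : T = allThr ∨ T = univThr) {c : ℝ}
    (hc : 0 ≤ c) (v : ℝ≥0) {ε : ℝ} (hε : 0 < ε) :
    ∀ᶠ p : ℕ in atTop, ∀ (k : ℕ) (g : Fin p → ℝ) (t : ℝ), IsHybrid k g t →
      ∃ t' ∈ T (p - k), ∀ ξ : Fin p → ℝ, (∀ i, |ξ i| ≤ c) →
        coeffRisk ξ v k g t' ≤ coeffRisk ξ v k g t + ε := by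
  rcases hT with rfl | rfl
  · exact Eventually.of_forall fun p k g t h => ⟨t, h.nonneg, fun ξ _ => by linarith⟩
  obtain ⟨C, hC, hbound⟩ := exists_risk_threshold_le hc v
  obtain ⟨Q, hQ⟩ := eventually_atTop.1
    (tendsto_sqrt_two_mul_log.eventually_ge_atTop (max 1 (C / ε)))
  filter_upwards [eventually_gt_atTop 0, tendsto_natCast_atTop_atTop.eventually_ge_atTop
    (Q * C / ε)] with p hp hpQ k g t h
  have hp0 : (0 : ℝ) < p := by exact_mod_cast hp
  rcases le_or_gt t (√(2 * Real.log ((p - k : ℕ) : ℝ))) with ht | ht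
  · exact ⟨t, ⟨h.nonneg, ht⟩, fun ξ _ => by linarith⟩
  refine ⟨√(2 * Real.log ((p - k : ℕ) : ℝ)), ⟨Real.sqrt_nonneg _, le_rfl⟩, fun ξ hξ => ?_⟩
  have hb := hbound p ξ hξ k g t _ h (Real.sqrt_nonneg _) ht.le
  have hcast : (p : ℝ) - k = ((p - k : ℕ) : ℝ) := (Nat.cast_sub h.le).symm
  -- With fewer than `Q` high coordinates their share `Q / p` of the normalized risk is negligible;
  -- otherwise the cap `√(2 log p₂)` itself is at least `C / ε`.
  rcases lt_or_ge (p - k) Q with hlt | hge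
  · refine hb.1.trans ?_
    have h1 : ((p : ℝ) - k) * C ≤ Q * C := by
      rw [hcast]
      gcongr
    have h2 : (p : ℝ)⁻¹ * (((p : ℝ) - k) * C) ≤ ε := by
      rw [inv_mul_le_iff₀ hp0]
      rw [div_le_iff₀ hε] at hpQ
      linarith
    linarith
  · have hq := hQ _ hge
    have hq1 : (0 : ℝ) < √(2 * Real.log ((p - k : ℕ) : ℝ)) :=
      zero_lt_one.trans_le ((le_max_left _ _).trans hq)
    refine (hb.2 hq1).trans ?_
    have h1 : C / √(2 * Real.log ((p - k : ℕ) : ℝ)) ≤ ε := by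
      rw [div_le_iff₀ hq1, mul_comm, ← div_le_iff₀ hε]
      exact (le_max_right _ _).trans hq
    have h2 : (p : ℝ)⁻¹ * (((p : ℝ) - k) * (C / √(2 * Real.log ((p - k : ℕ) : ℝ)))) ≤ ε := by
      rw [inv_mul_le_iff₀ hp0]
      have h3 : 0 ≤ C / √(2 * Real.log ((p - k : ℕ) : ℝ)) := by positivity
      have h4 : (p : ℝ) - k ≤ p := by linarith [Nat.cast_nonneg (α := ℝ) k]
      have h5 : (0 : ℝ) ≤ (p : ℝ) - k := by rw [hcast]; positivity
      nlinarith
    linarith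

theorem threshold_subset {T : ℕ → Set ℝ} (hT : T = allThr ∨ T = univThr) (k : ℕ) :
    T k ⊆ Set.Ici 0 := by
  rcases hT with rfl | rfl
  · exact le_rfl
  · exact fun t ht => ht.1

/-! ### The three candidate classes -/

section Classes

variable {n : ∀ p : ℕ, Fin p → ℕ} {U : ∀ p, Penalty p → Matrix (Obs (n p)) (Fin p) ℝ}
  {s2 : ∀ p, Data (n p) → ℝ} {T : ℕ → Set ℝ} {𝒟 : ∀ p, Finset (Penalty p)}

theorem estRiskMS_eq {p : ℕ} (s : ℝ) (f z : Fin p → ℝ) :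
    estRiskMS s f z = estRiskHS s p f 0 z := by
  have h : ∀ A : Fin p → ℝ, tailSum A p = 0 := fun A => Finset.sum_eq_zero fun i _ => if_pos i.2
  rw [estRiskHS_eq le_rfl s f le_rfl, h, partialSum_of_le _ le_rfl, estRiskMS, ave,
    Fintype.card_fin, add_zero]

/-- For `p = 0` this fails: the empty empirical distribution leaves `s` on the left, against `0` on
the right. -/
theorem estRiskST_eq {p : ℕ} (hp : 0 < p) (s : ℝ) {t : ℝ} (ht : 0 ≤ t) (z : Fin p → ℝ) :
    estRiskST s t z = estRiskHS s 0 0 t z := by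
  have hp' : (p : ℝ) ≠ 0 := by exact_mod_cast hp.ne'
  have h : ∀ A : Fin p → ℝ, tailSum A 0 = ∑ i, A i := fun A => by simp [tailSum]
  have h1 : empCDF z t = (p : ℝ)⁻¹ * ∑ i, bandInd t (z i) := by
    rw [empCDF, ave, Fintype.card_fin]
    rfl
  rw [estRiskHS_eq (Nat.zero_le _) s 0 ht, h, estRiskST, h1, ave, Fintype.card_fin,
    Finset.sum_add_distrib, ← Finset.mul_sum, Finset.sum_sub_distrib, ← Finset.mul_sum]
  simp only [← clip_sq ht, partialSum, Finset.sum_const, Finset.card_univ, Fintype.card_fin,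
    nsmul_eq_mul, Nat.not_lt_zero, if_false]
  field_simp
  ring

theorem adaptationWorks_MS (hn : ∀ p i, 0 < n p i)
    (hU : ∀ p D, IsPenaltyBasis (n p) D (U p D)) (hs2 : ∀ p, Measurable (s2 p))
    (hcard : Tendsto (fun p : ℕ => ((𝒟 p).card : ℝ) * (p : ℝ) ^ (-(1 / 2) : ℝ)) atTop (𝓝 0))
    (hvar : ∀ c : ℝ, 0 < c → ∀ v : ℝ≥0, 0 < v →
      Tendsto (fun p => ((𝒟 p).card : ℝ≥0∞) *
        varError (n p) (paramSet (n p) (U p) (𝒟 p) c) (s2 p) v) atTop (𝓝 0)) :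
    AdaptationWorks n (fun c p => paramSet (n p) (U p) (𝒟 p) c) (fun p => candMS (𝒟 p))
      (fun p => candMS (𝒟 p)) (fun p => estMS (U p)) (fun p => eriskMS (U p) (s2 p)) := by
  refine adaptationWorks_of_code hn hU hs2 (fun p k => ⟨k.1, p, k.2, 0⟩) (fun p => le_rfl)
    (fun p k hk => ⟨hk.1, le_rfl, fun i _ => hk.2.1 i, fun i j hij _ => hk.2.2 hij, le_rfl⟩)
    (fun p k _ => ?_) (fun p _ k _ y => estRiskMS_eq _ _ _) hcard
    (fun c hc v hv => ⟨_, hvar c hc v hv, fun p ⟨k, hk⟩ => le_mul_of_one_le_left' ?_⟩)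
    (fun c _ v ε hε => Eventually.of_forall fun p k hk => ⟨k, hk, rfl, fun ξ _ => by linarith⟩)
  · funext y
    have : hybridShrink p k.2 0 ((U p k.1)ᵀ *ᵥ y) = k.2 := funext fun i => if_pos i.2
    simp only [this]
    rfl
  -- A candidate forces `𝒟` to be nonempty, so the weighted variance error dominates the unweighted
  -- one.
  · exact_mod_cast Finset.card_pos.2 ⟨_, hk.1⟩

theorem adaptationWorks_ST (hn : ∀ p i, 0 < n p i)
    (hU : ∀ p D, IsPenaltyBasis (n p) D (U p D)) (hs2 : ∀ p, Measurable (s2 p))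
    (hT : T = allThr ∨ T = univThr)
    (hcard : Tendsto (fun p : ℕ => ((𝒟 p).card : ℝ) * (p : ℝ) ^ (-(1 / 2) : ℝ)) atTop (𝓝 0))
    (hvar : ∀ c : ℝ, 0 < c → ∀ v : ℝ≥0, 0 < v →
      Tendsto (fun p => ((𝒟 p).card : ℝ≥0∞) *
        varError (n p) (paramSet (n p) (U p) (𝒟 p) c) (s2 p) v) atTop (𝓝 0)) :
    AdaptationWorks n (fun c p => paramSet (n p) (U p) (𝒟 p) c)
      (fun p => candST allThr (𝒟 p)) (fun p => candST T (𝒟 p))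
      (fun p => estST (U p)) (fun p => eriskST (U p) (s2 p)) := by
  have hcode : ∀ p, ∀ k ∈ candST (p := p) allThr (𝒟 p), IsHybrid (p := p) 0 0 k.2 := fun p k hk =>
    ⟨Nat.zero_le _, fun i hi => absurd hi (Nat.not_lt_zero _),
      fun i j _ hj => absurd hj (Nat.not_lt_zero _), hk.2⟩
  refine adaptationWorks_of_code hn hU hs2 (fun p k => ⟨k.1, 0, 0, k.2⟩)
    (fun p k hk => ⟨hk.1, threshold_subset hT _ hk.2⟩) (fun p k hk => ⟨hk.1, hcode p k hk⟩)
    (fun p k _ => rfl) (fun p hp k hk y => estRiskST_eq hp _ hk.2 _) hcard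
    (fun c hc v hv => ⟨_, hvar c hc v hv, fun p ⟨k, hk⟩ => le_mul_of_one_le_left' ?_⟩)
    (fun c hc v ε hε => ?_)
  · exact_mod_cast Finset.card_pos.2 ⟨_, hk.1⟩
  · filter_upwards [exists_threshold_near hT hc v hε] with p hp k hk
    obtain ⟨t', ht', hle⟩ := hp 0 0 k.2 (hcode p k hk)
    exact ⟨(k.1, t'), ⟨hk.1, ht'⟩, rfl, hle⟩

theorem split_le {p : ℕ} {α : ℝ} (hα : α ∈ Set.Icc (0 : ℝ) 1) : split p α ≤ p :=
  Nat.floor_le_of_le (mul_le_of_le_one_left (Nat.cast_nonneg p) hα.2)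

theorem adaptationWorks_HS (hn : ∀ p i, 0 < n p i)
    (hU : ∀ p D, IsPenaltyBasis (n p) D (U p D)) (hs2 : ∀ p, Measurable (s2 p))
    (hT : T = allThr ∨ T = univThr) {𝒜 : ℕ → Finset ℝ}
    (h𝒜 : ∀ p, ∀ α ∈ 𝒜 p, α ∈ Set.Icc (0 : ℝ) 1)
    (hcard : Tendsto (fun p : ℕ => ((𝒟 p).card : ℝ) * (p : ℝ) ^ (-(1 / 2) : ℝ)) atTop (𝓝 0))
    (hvar : ∀ c : ℝ, 0 < c → ∀ v : ℝ≥0, 0 < v →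
      Tendsto (fun p => ((max (𝒜 p).card (𝒟 p).card : ℕ) : ℝ≥0∞) *
        varError (n p) (paramSet (n p) (U p) (𝒟 p) c) (s2 p) v) atTop (𝓝 0)) :
    AdaptationWorks n (fun c p => paramSet (n p) (U p) (𝒟 p) c)
      (fun p => candHS allThr (𝒟 p) (𝒜 p)) (fun p => candHS T (𝒟 p) (𝒜 p))
      (fun p => estHS (U p)) (fun p => eriskHS (U p) (s2 p)) := by
  have hcode : ∀ p, ∀ k ∈ candHS (p := p) allThr (𝒟 p) (𝒜 p),
      IsHybrid (split p k.α) k.g k.t := fun p k hk =>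
    ⟨split_le (h𝒜 p _ hk.2.1), fun i hi => hk.2.2.1.1 ⟨i, hi⟩,
      fun i j hij hj => hk.2.2.1.2
        (show (⟨i, (Fin.le_def.1 hij).trans_lt hj⟩ : Low p (split p k.α)) ≤ ⟨j, hj⟩ from hij),
      hk.2.2.2⟩
  refine adaptationWorks_of_code hn hU hs2 (fun p k => ⟨k.D, split p k.α, k.g, k.t⟩)
    (fun p k hk => ⟨hk.1, hk.2.1, hk.2.2.1, threshold_subset hT _ hk.2.2.2⟩)
    (fun p k hk => ⟨hk.1, hcode p k hk⟩)
    (fun p k _ => rfl) (fun p hp k hk y => rfl) hcard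
    (fun c hc v hv => ⟨_, hvar c hc v hv, fun p ⟨k, hk⟩ => le_mul_of_one_le_left' ?_⟩)
    (fun c hc v ε hε => ?_)
  · exact_mod_cast (Finset.card_pos.2 ⟨_, hk.1⟩).trans_le (le_max_right _ _)
  · filter_upwards [exists_threshold_near hT hc v hε] with p hp k hk
    obtain ⟨t', ht', hle⟩ := hp (split p k.α) k.g k.t (hcode p k hk)
    exact ⟨⟨k.D, k.α, k.g, t'⟩, ⟨hk.1, hk.2.1, hk.2.2.1, ht'⟩, rfl, hle⟩

end Classes

/-- The logarithmic factor may be dropped from a rate condition. -/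
theorem tendsto_of_tendsto_mul_log {a b : ℕ → ℕ} (hab : ∀ p, a p ≤ b p)
    (h : Tendsto (fun p : ℕ => (b p : ℝ) * (p : ℝ) ^ (-(1 / 2) : ℝ) *
      Real.log (p : ℝ) ^ (1 / 4 : ℝ)) atTop (𝓝 0)) :
    Tendsto (fun p : ℕ => (a p : ℝ) * (p : ℝ) ^ (-(1 / 2) : ℝ)) atTop (𝓝 0) := by
  refine tendsto_of_tendsto_of_tendsto_of_le_of_le' tendsto_const_nhds h
    (Eventually.of_forall fun p => by positivity) ?_
  filter_upwards [(Real.tendsto_log_atTop.comp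
    tendsto_natCast_atTop_atTop).eventually_ge_atTop (1 : ℝ)] with p hp
  have h1 : (a p : ℝ) ≤ b p := by exact_mod_cast hab p
  calc (a p : ℝ) * (p : ℝ) ^ (-(1 / 2) : ℝ) ≤ (b p : ℝ) * (p : ℝ) ^ (-(1 / 2) : ℝ) := by gcongr
    _ ≤ _ := le_mul_of_one_le_right (by positivity)
      (Real.one_le_rpow hp (by norm_num))

end OneWay

/-! ### Assembly of the three classes under the stated rate conditions -/

theorem theorem4p1
    (n : ∀ p : ℕ, Fin p → ℕ) (hn : ∀ p i, 0 < n p i)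
    (U : ∀ p, OneWay.Penalty p → Matrix (OneWay.Obs (n p)) (Fin p) ℝ)
    (hU : ∀ p D, OneWay.IsPenaltyBasis (n p) D (U p D))
    (s2 : ∀ p, OneWay.Data (n p) → ℝ) (hs2 : ∀ p, Measurable (s2 p))
    (T : ℕ → Set ℝ) (hT : T = OneWay.allThr ∨ T = OneWay.univThr) :
    -- parts (a), (b), (c): fixed penalty matrix
    (∀ D : ∀ p, OneWay.Penalty p,
      (∀ c : ℝ, 0 < c → ∀ v : ℝ≥0, 0 < v →
        Tendsto (fun p => OneWay.varError (n p) (OneWay.paramSet (n p) (U p) {D p} c) (s2 p) v)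
          atTop (𝓝 0)) →
      OneWay.AdaptationWorks n (fun c p => OneWay.paramSet (n p) (U p) {D p} c)
        (fun p => OneWay.candMS {D p}) (fun p => OneWay.candMS {D p})
        (fun p => OneWay.estMS (U p)) (fun p => OneWay.eriskMS (U p) (s2 p)) ∧
      OneWay.AdaptationWorks n (fun c p => OneWay.paramSet (n p) (U p) {D p} c)
        (fun p => OneWay.candST OneWay.allThr {D p}) (fun p => OneWay.candST T {D p})
        (fun p => OneWay.estST (U p)) (fun p => OneWay.eriskST (U p) (s2 p))) ∧
    -- part (d): adaptation over a set of penalty matrices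
    (∀ 𝒟 : ∀ p, Finset (OneWay.Penalty p),
      (∀ c : ℝ, 0 < c → ∀ v : ℝ≥0, 0 < v →
        Tendsto (fun p => ((𝒟 p).card : ℝ≥0∞) *
          OneWay.varError (n p) (OneWay.paramSet (n p) (U p) (𝒟 p) c) (s2 p) v)
          atTop (𝓝 0)) →
      (Tendsto (fun p : ℕ => ((𝒟 p).card : ℝ) * (p : ℝ) ^ (-(1 / 2) : ℝ)) atTop (𝓝 0) →
        OneWay.AdaptationWorks n (fun c p => OneWay.paramSet (n p) (U p) (𝒟 p) c)
          (fun p => OneWay.candMS (𝒟 p)) (fun p => OneWay.candMS (𝒟 p))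
          (fun p => OneWay.estMS (U p)) (fun p => OneWay.eriskMS (U p) (s2 p))) ∧
      (Tendsto (fun p : ℕ => ((𝒟 p).card : ℝ) * (p : ℝ) ^ (-(1 / 2) : ℝ) *
          Real.log (p : ℝ) ^ (1 / 4 : ℝ)) atTop (𝓝 0) →
        OneWay.AdaptationWorks n (fun c p => OneWay.paramSet (n p) (U p) (𝒟 p) c)
          (fun p => OneWay.candST OneWay.allThr (𝒟 p)) (fun p => OneWay.candST T (𝒟 p))
          (fun p => OneWay.estST (U p)) (fun p => OneWay.eriskST (U p) (s2 p)))) ∧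
    -- part (e): hybrid estimators, adaptation over penalty matrices and split fractions
    (∀ (𝒟 : ∀ p, Finset (OneWay.Penalty p)) (𝒜 : ℕ → Finset ℝ),
      (∀ p, ∀ α ∈ 𝒜 p, α ∈ Set.Icc (0 : ℝ) 1) →
      (∀ c : ℝ, 0 < c → ∀ v : ℝ≥0, 0 < v →
        Tendsto (fun p => ((max (𝒜 p).card (𝒟 p).card : ℕ) : ℝ≥0∞) *
          OneWay.varError (n p) (OneWay.paramSet (n p) (U p) (𝒟 p) c) (s2 p) v)
          atTop (𝓝 0)) →
      Tendsto (fun p : ℕ => ((max (𝒜 p).card (𝒟 p).card : ℕ) : ℝ) *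
          (p : ℝ) ^ (-(1 / 2) : ℝ) * Real.log (p : ℝ) ^ (1 / 4 : ℝ)) atTop (𝓝 0) →
      OneWay.AdaptationWorks n (fun c p => OneWay.paramSet (n p) (U p) (𝒟 p) c)
        (fun p => OneWay.candHS OneWay.allThr (𝒟 p) (𝒜 p))
        (fun p => OneWay.candHS T (𝒟 p) (𝒜 p))
        (fun p => OneWay.estHS (U p)) (fun p => OneWay.eriskHS (U p) (s2 p))) := by 
  refine ⟨fun D hvar => ?_, fun 𝒟 hvar => ⟨fun hcard => ?_, fun hcard => ?_⟩,
    fun 𝒟 𝒜 h𝒜 hvar hcard => ?_⟩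
  · have hcard : Tendsto (fun p : ℕ => ((({D p} : Finset (OneWay.Penalty p)).card : ℕ) : ℝ) *
        (p : ℝ) ^ (-(1 / 2) : ℝ)) atTop (𝓝 0) := by
      simpa [Function.comp_def] using (tendsto_rpow_neg_atTop (y := 1 / 2) (by norm_num)).comp
        tendsto_natCast_atTop_atTop
    have hvar' : ∀ c : ℝ, 0 < c → ∀ v : ℝ≥0, 0 < v →
        Tendsto (fun p => ((({D p} : Finset (OneWay.Penalty p)).card : ℕ) : ℝ≥0∞) *
          OneWay.varError (n p) (OneWay.paramSet (n p) (U p) {D p} c) (s2 p) v)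
          atTop (𝓝 0) := fun c hc v hv => by simpa using hvar c hc v hv
    exact ⟨OneWay.adaptationWorks_MS hn hU hs2 hcard hvar',
      OneWay.adaptationWorks_ST hn hU hs2 hT hcard hvar'⟩
  · exact OneWay.adaptationWorks_MS hn hU hs2 hcard hvar
  · exact OneWay.adaptationWorks_ST hn hU hs2 hT
      (OneWay.tendsto_of_tendsto_mul_log (fun _ => le_rfl) hcard) hvar
  · exact OneWay.adaptationWorks_HS hn hU hs2 hT h𝒜
      (OneWay.tendsto_of_tendsto_mul_log (fun _ => le_max_right _ _) hcard) hvar
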